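/- Work in intuitionistic higher-order logic (with function types, function and propositional extensionality, unique choice and the natural numbers, over arbitrary base sets), without excluded middle, together with Countable Choice and the following three axioms. - Markov Principle: a binary sequence whose terms are not all zero contains a one. - Enumerability Axiom: there are countably many countable subsets of $\mathbb{N}$. - Stable Subspace Axiom: if $A \subseteq \mathbb{N}$ is $\neg\neg$-stable, then every semidecidable subset of $A$ is the intersection of $A$ with a semidecidable subset of $\mathbb{N}$. Here a set $A$ is countable if there is a surjection $\mathbb{N} \to 1 + A$. A truth value $p$ is semidecidable, $p \in \Sigma$, if there is a binary sequence $f$ such that $p \Leftrightarrow \exists n\, f(n) = 1$. A subset $A$ of a set $X$ is semidecidable if $(x \in A) \in \Sigma$ for all $x \in X$, and overt if $(\exists x \in A\; q(x)) \in \Sigma$ for every $q : X \to \Sigma$. A topology on $X$ is a family $\mathcal{T}$ of semidecidable subsets of $X$ that is closed under finite intersections (so $X \in \mathcal{T}$) and countable unions. A sequence $(B_n)_{n \in \mathbb{N}}$ in $\mathcal{T}$ is a countable base of $\mathcal{T}$ if every $U \in \mathcal{T}$ is $\bigcup_{i \in I} B_i$ for some countable $I \subseteq \mathbb{N}$. The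 space $(X, \mathcal{T})$ is sober if $x \mapsto (U \mapsto (x \in U))$ is a bijection from $X$ to the set of maps $\mathcal{T} \to \Sigma$ that preserve finite meets and countable joins. **Theorem.** Every countably based sober space is a Spreen space. That is, it is provable in the theory above that, for every set $X$ and every topology $\mathcal{T}$ on $X$ which has a countable base and for which $(X, \mathcal{T})$ is sober: if $T \subseteq X$ is overt, $A \subseteq X$ is semidecidable, $x \in A$ and $A \cap T = \emptyset$, then there is $U \in \mathcal{T}$ such that $x \in U$ and $U \cap T = \emptyset$. -/

import Mathlib

/-!
Intuitionistic higher-order logic (the internal language of a topos with a natural numbers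
object), as a natural deduction calculus, and the notions of synthetic topology and synthetic
computability written in it. The calculus is needed because the axioms of synthetic computability
contradict excluded middle, so that they can not be stated about the propositions of Lean.
-/

universe u

namespace IHOL

/-- Types: base types (which stand for arbitrary sets), the natural numbers, the truth values,
and function types. -/
inductive Ty (S : Type u) : Type u
  | base (s : S) : Ty S
  | nat : Ty S
  | omega : Ty S
  | arrow (σ τ : Ty S) : Ty S

infixr:60 " ⇒ₜ " => Ty.arrow

/-- The type of subsets of a type. -/
abbrev Ty.pow {S : Type u} (σ : Ty S) : Ty S := σ ⇒ₜ Ty.omega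

/-- A context: the list of the types of the variables in scope, the innermost one first. -/
abbrev Ctx (S : Type u) : Type u := List (Ty S)

/-- Variables of type `τ` in a context (typed de Bruijn indices). -/
inductive Var {S : Type u} : Ctx S → Ty S → Type u
  | here {Γ : Ctx S} {τ : Ty S} : Var (τ :: Γ) τ
  | there {Γ : Ctx S} {σ τ : Ty S} (x : Var Γ τ) : Var (σ :: Γ) τ

/-- Well-typed terms in a context. Formulas are the terms of type `omega`. -/
inductive Tm {S : Type u} : Ctx S → Ty S → Type u
  | var {Γ : Ctx S} {τ : Ty S} (x : Var Γ τ) : Tm Γ τ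
  | lam {Γ : Ctx S} {σ τ : Ty S} (t : Tm (σ :: Γ) τ) : Tm Γ (σ ⇒ₜ τ)
  | app {Γ : Ctx S} {σ τ : Ty S} (f : Tm Γ (σ ⇒ₜ τ)) (t : Tm Γ σ) : Tm Γ τ
  | zero {Γ : Ctx S} : Tm Γ Ty.nat
  | succ {Γ : Ctx S} (n : Tm Γ Ty.nat) : Tm Γ Ty.nat
  | natrec {Γ : Ctx S} {τ : Ty S} (z : Tm Γ τ) (s : Tm Γ (Ty.nat ⇒ₜ τ ⇒ₜ τ))
      (n : Tm Γ Ty.nat) : Tm Γ τ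
  | eq {Γ : Ctx S} {τ : Ty S} (s t : Tm Γ τ) : Tm Γ Ty.omega
  | falsum {Γ : Ctx S} : Tm Γ Ty.omega
  | and {Γ : Ctx S} (p q : Tm Γ Ty.omega) : Tm Γ Ty.omega
  | or {Γ : Ctx S} (p q : Tm Γ Ty.omega) : Tm Γ Ty.omega
  | imp {Γ : Ctx S} (p q : Tm Γ Ty.omega) : Tm Γ Ty.omega
  | all {Γ : Ctx S} {σ : Ty S} (p : Tm (σ :: Γ) Ty.omega) : Tm Γ Ty.omega
  | ex {Γ : Ctx S} {σ : Ty S} (p : Tm (σ :: Γ) Ty.omega) : Tm Γ Ty.omega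

/-- Formulas in a context. -/
abbrev Fm {S : Type u} (Γ : Ctx S) : Type u := Tm Γ Ty.omega

section Substitution

variable {S : Type u}

/-- Renamings of variables. -/
abbrev Ren (Γ Δ : Ctx S) : Type u := ∀ τ : Ty S, Var Γ τ → Var Δ τ

/-- Simultaneous substitutions. -/
abbrev Sub (Γ Δ : Ctx S) : Type u := ∀ τ : Ty S, Var Γ τ → Tm Δ τ

/-- Extend a renaming under a binder. -/
def Ren.lift {Γ Δ : Ctx S} (r : Ren Γ Δ) (σ : Ty S) : Ren (σ :: Γ) (σ :: Δ)
  | _, .here => .here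
  | _, .there x => .there (r _ x)

/-- Apply a renaming to a term. -/
def Tm.ren : {Γ : Ctx S} → {τ : Ty S} → Tm Γ τ → {Δ : Ctx S} → Ren Γ Δ → Tm Δ τ
  | _, _, .var x, _, r => .var (r _ x)
  | _, _, .lam t, _, r => .lam (t.ren (r.lift _))
  | _, _, .app f t, _, r => .app (f.ren r) (t.ren r)
  | _, _, .zero, _, _ => .zero
  | _, _, .succ n, _, r => .succ (n.ren r)
  | _, _, .natrec z s n, _, r => .natrec (z.ren r) (s.ren r) (n.ren r)
  | _, _, .eq s t, _, r => .eq (s.ren r) (t.ren r)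
  | _, _, .falsum, _, _ => .falsum
  | _, _, .and p q, _, r => .and (p.ren r) (q.ren r)
  | _, _, .or p q, _, r => .or (p.ren r) (q.ren r)
  | _, _, .imp p q, _, r => .imp (p.ren r) (q.ren r)
  | _, _, .all p, _, r => .all (p.ren (r.lift _))
  | _, _, .ex p, _, r => .ex (p.ren (r.lift _))

/-- Weakening by one new variable. -/
def Tm.wk {Γ : Ctx S} {τ σ : Ty S} (t : Tm Γ τ) : Tm (σ :: Γ) τ := t.ren fun _ x => .there x

/-- A closed term, regarded as a term in any context. -/
def Tm.close {Γ : Ctx S} {τ : Ty S} (t : Tm ([] : Ctx S) τ) : Tm Γ τ := t.ren fun _ x => nomatch x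

/-- Extend a substitution under a binder. -/
def Sub.lift {Γ Δ : Ctx S} (s : Sub Γ Δ) (σ : Ty S) : Sub (σ :: Γ) (σ :: Δ)
  | _, .here => .var .here
  | _, .there x => (s _ x).wk

/-- Apply a (capture-avoiding) substitution to a term. -/
def Tm.sub : {Γ : Ctx S} → {τ : Ty S} → Tm Γ τ → {Δ : Ctx S} → Sub Γ Δ → Tm Δ τ
  | _, _, .var x, _, r => r _ x
  | _, _, .lam t, _, r => .lam (t.sub (r.lift _))
  | _, _, .app f t, _, r => .app (f.sub r) (t.sub r)
  | _, _, .zero, _, _ => .zero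
  | _, _, .succ n, _, r => .succ (n.sub r)
  | _, _, .natrec z s n, _, r => .natrec (z.sub r) (s.sub r) (n.sub r)
  | _, _, .eq s t, _, r => .eq (s.sub r) (t.sub r)
  | _, _, .falsum, _, _ => .falsum
  | _, _, .and p q, _, r => .and (p.sub r) (q.sub r)
  | _, _, .or p q, _, r => .or (p.sub r) (q.sub r)
  | _, _, .imp p q, _, r => .imp (p.sub r) (q.sub r)
  | _, _, .all p, _, r => .all (p.sub (r.lift _))
  | _, _, .ex p, _, r => .ex (p.sub (r.lift _))

/-- The substitution of a single term for the innermost variable. -/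
def Sub.single {Γ : Ctx S} {σ : Ty S} (t : Tm Γ σ) : Sub (σ :: Γ) Γ
  | _, .here => t
  | _, .there x => .var x

/-- `p.inst t` is `p` with `t` substituted for the innermost variable. -/
def Tm.inst {Γ : Ctx S} {σ τ : Ty S} (p : Tm (σ :: Γ) τ) (t : Tm Γ σ) : Tm Γ τ :=
  p.sub (Sub.single t)

/-- In the formulas below, weakenings (possibly repeated) are written `↑t` where Lean can
infer the type of `t`, and `t.wk` otherwise. -/
instance {Γ : Ctx S} {τ σ : Ty S} : Coe (Tm Γ τ) (Tm (σ :: Γ) τ) := ⟨Tm.wk⟩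

end Substitution

infixl:90 " ⬝ " => Tm.app
infix:50 " ≐ " => Tm.eq
infixr:35 " ∧' " => Tm.and
infixr:30 " ∨' " => Tm.or
infixr:25 " ⇒ " => Tm.imp

section Connectives

variable {S : Type u} {Γ : Ctx S}

/-- Negation. -/
def Tm.neg (p : Fm Γ) : Fm Γ := p ⇒ Tm.falsum

/-- Equivalence. -/
def Tm.iff (p q : Fm Γ) : Fm Γ := (p ⇒ q) ∧' (q ⇒ p)

/-- `All σ fun x => p` is the formula "for all `x` of type `σ`, `p`". -/
def All (σ : Ty S) (p : Tm (σ :: Γ) σ → Fm (σ :: Γ)) : Fm Γ := Tm.all (p (.var .here))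

/-- `Ex σ fun x => p` is the formula "there is `x` of type `σ` such that `p`". -/
def Ex (σ : Ty S) (p : Tm (σ :: Γ) σ → Fm (σ :: Γ)) : Fm Γ := Tm.ex (p (.var .here))

/-- `Lam σ fun x => t` is the function that maps `x` of type `σ` to `t`. If `t` is a formula, it
is the subset of all `x` that satisfy `t`. -/
def Lam (σ : Ty S) {τ : Ty S} (t : Tm (σ :: Γ) σ → Tm (σ :: Γ) τ) : Tm Γ (σ ⇒ₜ τ) :=
  Tm.lam (t (.var .here))

end Connectives

prefix:max "¬' " => Tm.neg
infix:20 " ⇔ " => Tm.iff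

section Subsets

variable {S : Type u} {Γ : Ctx S} {σ : Ty S}

/-- `x ∈' A`: membership in a subset of a type. -/
def mem (x : Tm Γ σ) (A : Tm Γ σ.pow) : Fm Γ := A ⬝ x

infix:50 " ∈' " => mem

/-- `A` is contained in `B`. -/
def subset (A B : Tm Γ σ.pow) : Fm Γ := All σ fun x => x ∈' ↑A ⇒ x ∈' ↑B

infix:50 " ⊆' " => subset

/-- The empty subset. -/
def empty : Tm Γ σ.pow := Lam σ fun _ => Tm.falsum

/-- The singleton of `x`. -/
def singleton (x : Tm Γ σ) : Tm Γ σ.pow := Lam σ fun y => y ≐ ↑x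

/-- The intersection of two subsets. -/
def inter (A B : Tm Γ σ.pow) : Tm Γ σ.pow := Lam σ fun x => x ∈' ↑A ∧' x ∈' ↑B

/-- The union of a family of subsets. -/
def sUnion (F : Tm Γ σ.pow.pow) : Tm Γ σ.pow :=
  Lam σ fun x => Ex σ.pow fun U => U ∈' ↑F ∧' ↑x ∈' U

/-- There is exactly one element in `A`. -/
def existsUnique (A : Tm Γ σ.pow) : Fm Γ :=
  Ex σ fun x => x ∈' ↑A ∧' All σ fun y => y ∈' ↑A ⇒ y ≐ ↑x

end Subsets

/-- `Deriv T Φ φ`: the formula `φ` follows in intuitionistic higher-order logic from the axioms `T`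
(closed formulas) and the hypotheses `Φ` (a list of formulas in the context of `φ`). -/
inductive Deriv {S : Type u} (T : Set (Fm ([] : Ctx S))) :
    {Γ : Ctx S} → List (Fm Γ) → Fm Γ → Prop
  | ax {Γ : Ctx S} {Φ : List (Fm Γ)} {φ : Fm ([] : Ctx S)} (h : φ ∈ T) : Deriv T Φ φ.close
  | hyp {Γ : Ctx S} {Φ : List (Fm Γ)} {φ : Fm Γ} (h : φ ∈ Φ) : Deriv T Φ φ
  -- the propositional connectives
  | falsumE {Γ : Ctx S} {Φ : List (Fm Γ)} {φ : Fm Γ} (h : Deriv T Φ Tm.falsum) : Deriv T Φ φ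
  | andI {Γ : Ctx S} {Φ : List (Fm Γ)} {φ ψ : Fm Γ} (h₁ : Deriv T Φ φ) (h₂ : Deriv T Φ ψ) :
      Deriv T Φ (φ ∧' ψ)
  | andE₁ {Γ : Ctx S} {Φ : List (Fm Γ)} {φ ψ : Fm Γ} (h : Deriv T Φ (φ ∧' ψ)) : Deriv T Φ φ
  | andE₂ {Γ : Ctx S} {Φ : List (Fm Γ)} {φ ψ : Fm Γ} (h : Deriv T Φ (φ ∧' ψ)) : Deriv T Φ ψ
  | orI₁ {Γ : Ctx S} {Φ : List (Fm Γ)} {φ ψ : Fm Γ} (h : Deriv T Φ φ) : Deriv T Φ (φ ∨' ψ)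
  | orI₂ {Γ : Ctx S} {Φ : List (Fm Γ)} {φ ψ : Fm Γ} (h : Deriv T Φ ψ) : Deriv T Φ (φ ∨' ψ)
  | orE {Γ : Ctx S} {Φ : List (Fm Γ)} {φ ψ χ : Fm Γ} (h : Deriv T Φ (φ ∨' ψ))
      (h₁ : Deriv T (φ :: Φ) χ) (h₂ : Deriv T (ψ :: Φ) χ) : Deriv T Φ χ
  | impI {Γ : Ctx S} {Φ : List (Fm Γ)} {φ ψ : Fm Γ} (h : Deriv T (φ :: Φ) ψ) : Deriv T Φ (φ ⇒ ψ)
  | impE {Γ : Ctx S} {Φ : List (Fm Γ)} {φ ψ : Fm Γ} (h : Deriv T Φ (φ ⇒ ψ)) (h₁ : Deriv T Φ φ) :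
      Deriv T Φ ψ
  -- the quantifiers
  | allI {Γ : Ctx S} {Φ : List (Fm Γ)} {σ : Ty S} {φ : Fm (σ :: Γ)}
      (h : Deriv T (Φ.map Tm.wk) φ) : Deriv T Φ (Tm.all φ)
  | allE {Γ : Ctx S} {Φ : List (Fm Γ)} {σ : Ty S} {φ : Fm (σ :: Γ)} (h : Deriv T Φ (Tm.all φ))
      (t : Tm Γ σ) : Deriv T Φ (φ.inst t)
  | exI {Γ : Ctx S} {Φ : List (Fm Γ)} {σ : Ty S} {φ : Fm (σ :: Γ)} (t : Tm Γ σ)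
      (h : Deriv T Φ (φ.inst t)) : Deriv T Φ (Tm.ex φ)
  | exE {Γ : Ctx S} {Φ : List (Fm Γ)} {σ : Ty S} {φ : Fm (σ :: Γ)} {ψ : Fm Γ}
      (h : Deriv T Φ (Tm.ex φ)) (h₁ : Deriv T (φ :: Φ.map Tm.wk) ψ.wk) : Deriv T Φ ψ
  -- equality, functions and truth values
  | eqI {Γ : Ctx S} {Φ : List (Fm Γ)} {σ : Ty S} (t : Tm Γ σ) : Deriv T Φ (t ≐ t)
  | eqE {Γ : Ctx S} {Φ : List (Fm Γ)} {σ : Ty S} (φ : Fm (σ :: Γ)) {s t : Tm Γ σ}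
      (h : Deriv T Φ (s ≐ t)) (h₁ : Deriv T Φ (φ.inst s)) : Deriv T Φ (φ.inst t)
  | beta {Γ : Ctx S} {Φ : List (Fm Γ)} {σ τ : Ty S} (t : Tm (σ :: Γ) τ) (s : Tm Γ σ) :
      Deriv T Φ (Tm.lam t ⬝ s ≐ t.inst s)
  | funext {Γ : Ctx S} {Φ : List (Fm Γ)} {σ τ : Ty S} {f g : Tm Γ (σ ⇒ₜ τ)}
      (h : Deriv T Φ (All σ fun x => f.wk ⬝ x ≐ g.wk ⬝ x)) : Deriv T Φ (f ≐ g)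
  | propext {Γ : Ctx S} {Φ : List (Fm Γ)} {p q : Fm Γ} (h : Deriv T Φ (p ⇔ q)) : Deriv T Φ (p ≐ q)
  -- functional relations are functions
  | uniqueChoice {Γ : Ctx S} {Φ : List (Fm Γ)} {σ τ : Ty S} {R : Tm Γ (σ ⇒ₜ τ.pow)}
      (h : Deriv T Φ (All σ fun x => existsUnique (R.wk ⬝ x))) :
      Deriv T Φ (Ex (σ ⇒ₜ τ) fun f => All σ fun x => (f.wk ⬝ x) ∈' (R.wk.wk ⬝ x))
  -- the natural numbers
  | zeroNeSucc {Γ : Ctx S} {Φ : List (Fm Γ)} (n : Tm Γ Ty.nat) :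
      Deriv T Φ (¬' (Tm.zero ≐ Tm.succ n))
  | succInj {Γ : Ctx S} {Φ : List (Fm Γ)} {m n : Tm Γ Ty.nat}
      (h : Deriv T Φ (Tm.succ m ≐ Tm.succ n)) : Deriv T Φ (m ≐ n)
  | induction {Γ : Ctx S} {Φ : List (Fm Γ)} {A : Tm Γ Ty.nat.pow} (h₀ : Deriv T Φ (Tm.zero ∈' A))
      (h₁ : Deriv T Φ (All Ty.nat fun n => n ∈' ↑A ⇒ Tm.succ n ∈' ↑A)) :
      Deriv T Φ (All Ty.nat fun n => n ∈' ↑A)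
  | natrecZero {Γ : Ctx S} {Φ : List (Fm Γ)} {τ : Ty S} (z : Tm Γ τ)
      (s : Tm Γ (Ty.nat ⇒ₜ τ ⇒ₜ τ)) : Deriv T Φ (Tm.natrec z s Tm.zero ≐ z)
  | natrecSucc {Γ : Ctx S} {Φ : List (Fm Γ)} {τ : Ty S} (z : Tm Γ τ)
      (s : Tm Γ (Ty.nat ⇒ₜ τ ⇒ₜ τ)) (n : Tm Γ Ty.nat) :
      Deriv T Φ (Tm.natrec z s (Tm.succ n) ≐ s ⬝ n ⬝ Tm.natrec z s n)

/-- The closed formula `φ` is a theorem of the theory with axioms `T`. -/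
def Provable {S : Type u} (T : Set (Fm ([] : Ctx S))) (φ : Fm ([] : Ctx S)) : Prop := Deriv T [] φ

section Semidecidability

variable {S : Type u} {Γ : Ctx S} {σ : Ty S}

/-- The numeral one. -/
def one : Tm Γ Ty.nat := Tm.succ Tm.zero

/-- `f` is a binary sequence, i.e., a map from the natural numbers to `{0, 1}`. -/
def binary (f : Tm Γ (Ty.nat ⇒ₜ Ty.nat)) : Fm Γ :=
  All Ty.nat fun n => ↑f ⬝ n ≐ Tm.zero ∨' ↑f ⬝ n ≐ one

/-- `p` belongs to the Rosolini dominance: `p` is equivalent to `∃ n, f n = 1` for some binary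
sequence `f`. -/
def semidec (p : Fm Γ) : Fm Γ :=
  Ex (Ty.nat ⇒ₜ Ty.nat) fun f => binary f ∧' (↑p ⇔ Ex Ty.nat fun n => ↑f ⬝ n ≐ one)

/-- `A` is a semidecidable subset of the set `X`. -/
def semidecSubset (X A : Tm Γ σ.pow) : Fm Γ :=
  A ⊆' X ∧' All σ fun x => x ∈' ↑X ⇒ semidec (x ∈' ↑A)

/-- `A` is an overt subset of the set `X`: for every map `q` from `X` to semidecidable truth
values, `∃ x ∈ A, q x` is semidecidable. -/
def overtSubset (X A : Tm Γ σ.pow) : Fm Γ :=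
  A ⊆' X ∧' All σ.pow fun q => (All σ fun x => x ∈' ↑X ⇒ semidec (↑q ⬝ x)) ⇒
    semidec (Ex σ fun x => x ∈' ↑A ∧' ↑q ⬝ x)

/-- The set `A` is countable: there is a surjection from the natural numbers onto `1 + A`. Here
`1 + A` is represented by the subsets of `A` that are empty (the added element) or singletons (the
elements of `A`). -/
def countable (A : Tm Γ σ.pow) : Fm Γ :=
  Ex (Ty.nat ⇒ₜ σ.pow) fun e =>
    (All Ty.nat fun n => e.wk ⬝ n ≐ empty ∨' Ex σ fun x => x ∈' ↑A ∧' e.wk.wk ⬝ ↑n ≐ singleton x) ∧'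
    (Ex Ty.nat fun n => e.wk ⬝ n ≐ empty) ∧'
    (All σ fun x => x ∈' ↑A ⇒ Ex Ty.nat fun n => e.wk.wk ⬝ n ≐ singleton ↑x)

end Semidecidability

section Topology

variable {S : Type u} {Γ : Ctx S} {σ : Ty S}

/-- `O` is a (Malcev) topology on the set `X`: a family of semidecidable subsets of `X` that is
closed under finite intersections and countable unions. -/
def isTopology (X : Tm Γ σ.pow) (O : Tm Γ σ.pow.pow) : Fm Γ :=
  (All σ.pow fun U => U ∈' ↑O ⇒ semidecSubset ↑X U) ∧'
  X ∈' O ∧'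
  (All σ.pow fun U => All σ.pow fun V => U.wk ∈' ↑O ⇒ V ∈' ↑O ⇒ inter U.wk V ∈' ↑O) ∧'
  (All σ.pow.pow fun F => countable F ⇒ F ⊆' ↑O ⇒ sUnion F ∈' ↑O)

/-- The sequence `B` of subsets is a countable base of the topology `O`: its members are open, and
every open set is the union of the sets `B i` with `i` in some countable set of indices. -/
def isBase (O : Tm Γ σ.pow.pow) (B : Tm Γ (Ty.nat ⇒ₜ σ.pow)) : Fm Γ :=
  (All Ty.nat fun n => B.wk ⬝ n ∈' ↑O) ∧'
  (All σ.pow fun U => U ∈' ↑O ⇒ Ex Ty.nat.pow fun I => countable I ∧'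
    U.wk ≐ Lam σ fun x => Ex Ty.nat fun i => i ∈' ↑I ∧' x.wk ∈' (↑B ⬝ i))

/-- `p` is a homomorphism of σ-frames from the topology `O` on `X` to the Rosolini dominance: a
map with semidecidable values that preserves finite meets and countable joins. -/
def isSigmaHom (X : Tm Γ σ.pow) (O p : Tm Γ σ.pow.pow) : Fm Γ :=
  (All σ.pow fun U => U ∈' ↑O ⇒ semidec (↑p ⬝ U)) ∧'
  p ⬝ X ∧'
  (All σ.pow fun U => All σ.pow fun V => U.wk ∈' ↑O ⇒ V ∈' ↑O ⇒
    (p.wk.wk ⬝ inter ↑U V ⇔ p.wk.wk ⬝ ↑U ∧' p.wk.wk ⬝ V)) ∧'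
  (All σ.pow.pow fun F => countable F ⇒ F ⊆' ↑O ⇒
    (↑p ⬝ sUnion F ⇔ Ex σ.pow fun U => U ∈' ↑F ∧' ↑p ⬝ U))

/-- The space `(X, O)` is sober: the neighbourhood filter, which maps `x` in `X` to the
homomorphism `U ↦ (x ∈ U)`, is a bijection from `X` to the homomorphisms from `O` to the Rosolini
dominance. -/
def isSober (X : Tm Γ σ.pow) (O : Tm Γ σ.pow.pow) : Fm Γ :=
  All σ.pow.pow fun p => isSigmaHom ↑X ↑O p ⇒
    existsUnique (Lam σ fun x => x ∈' ↑X ∧'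
      All σ.pow fun U => U ∈' ↑O ⇒ (↑p ⬝ U ⇔ ↑x ∈' U))

/-- `(X, O)` is a Spreen space: every point that is separated from an overt subset by a
semidecidable subset is separated from it by an open one. -/
def isSpreen (X : Tm Γ σ.pow) (O : Tm Γ σ.pow.pow) : Fm Γ :=
  All σ.pow fun T => All σ.pow fun A => All σ fun x =>
    overtSubset X.wk.wk.wk ↑T ⇒ semidecSubset X.wk.wk.wk ↑A ⇒ x ∈' ↑A ⇒ inter A.wk ↑T ≐ empty ⇒
      Ex σ.pow fun U => U ∈' ↑O ∧' ↑x ∈' U ∧' inter U ↑T ≐ empty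

end Topology

section Axioms

variable {S : Type u}

/-- The set `A` is stable under double negation. -/
def stable {Γ : Ctx S} {σ : Ty S} (A : Tm Γ σ.pow) : Fm Γ :=
  All σ fun x => ¬' ¬' (x ∈' ↑A) ⇒ x ∈' ↑A

/-- `A` is an intrinsic subspace of `Y`: every semidecidable subset of `A` is the intersection of
`A` with a semidecidable subset of `Y`. -/
def intrinsicSubspace {Γ : Ctx S} {σ : Ty S} (Y A : Tm Γ σ.pow) : Fm Γ :=
  A ⊆' Y ∧' All σ.pow fun U => semidecSubset ↑A U ⇒
    Ex σ.pow fun V => semidecSubset ↑Y V ∧' inter V ↑A ≐ ↑U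

/-- The set of all natural numbers. -/
def allNat {Γ : Ctx S} : Tm Γ (Ty.nat (S := S)).pow := Lam Ty.nat fun n => n ≐ n

/-- Markov principle: a binary sequence whose terms are not all zero contains a one. -/
def markovPrinciple : Fm ([] : Ctx S) :=
  All (Ty.nat ⇒ₜ Ty.nat) fun f => binary f ⇒ ¬' (All Ty.nat fun n => ↑f ⬝ n ≐ Tm.zero) ⇒
    Ex Ty.nat fun n => ↑f ⬝ n ≐ one

/-- Enumerability Axiom: there are countably many countable subsets of the natural numbers. -/
def enumerabilityAxiom : Fm ([] : Ctx S) :=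
  countable (Lam Ty.nat.pow fun A => countable A)

/-- Stable Subspace Axiom: a stable subset of the natural numbers is an intrinsic subspace. -/
def stableSubspaceAxiom : Fm ([] : Ctx S) :=
  All Ty.nat.pow fun A => stable A ⇒ intrinsicSubspace allNat A

/-- Countable Choice for the type `τ`. -/
def countableChoice (τ : Ty S) : Fm ([] : Ctx S) :=
  All (Ty.nat ⇒ₜ τ.pow) fun R => (All Ty.nat fun n => Ex τ fun x => x ∈' (R.wk.wk ⬝ ↑n)) ⇒
    Ex (Ty.nat ⇒ₜ τ) fun f => All Ty.nat fun n => (f.wk ⬝ n) ∈' (R.wk.wk ⬝ n)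

/-- The axioms of synthetic computability (with Countable Choice for all types). -/
inductive SyntheticComputability : Set (Fm ([] : Ctx S))
  | markov : SyntheticComputability markovPrinciple
  | enumerability : SyntheticComputability enumerabilityAxiom
  | stableSubspace : SyntheticComputability stableSubspaceAxiom
  | choice (τ : Ty S) : SyntheticComputability (countableChoice τ)

end Axioms

end IHOL

/-! Mathematical argument. Let `x ∈ A` and let the overt set `Y` be disjoint from the semidecidable
set `A`. Countable Choice enumerates the basic neighbourhoods of `x`; let `N k` be the intersection
of the first `k` of them. These are open, so "`Y` meets `N k`" is semidecidable by overtness. The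
aim is to find a `k` for which it fails.

The Enumerability Axiom and a diagonal argument yield a semidecidable `K ⊆ ℕ`, with decidable stages
`H e k`, such that every semidecidable `V` containing the complement of `K` meets `K`
(`exists_creative`). Let `D` be the set of all `e` such that `Y` meets `N k` if `k` is the least
stage at which `e` enters `K`. Markov's principle makes `D` stable, and `D` contains the complement
`E` of `K`.

The key point is that `E` is semidecidable on `D` (`semidec_isEmpty`). For `e ∈ D` choose `t k ∈ Y ∩
N k` whenever `k` is the least stage of `e`. The condition "`t k ∈ U` if `k` is the least stage, `x
∈ U` if there is no stage" defines a σ-frame homomorphism (`semidec_limit`, `isSigmaHom_limit`): one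
can run through the neighbourhoods of `x` until `e` enters `K`, because `t k` lies in all those
inspected before stage `k`. By sobriety the homomorphism is a point `y`, equal to `x` if `e ∉ K` and
to some `t k ∈ Y` if `e ∈ K`. Hence `y ∈ A` exactly when `e ∉ K`.

By the Stable Subspace Axiom, `E = V ∩ D` for some semidecidable `V`. As `V` contains the complement
of `K`, there is some `e ∈ V ∩ K`. If `k` is its least stage, then `N k` is disjoint from `Y`, since
otherwise `e ∈ D ∩ V = E`.

Formal argument. Derivations are replaced by computations in a Heyting-valued term model. Its
elements are terms with parameters up to provable equality (`Elt`), its truth values the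
Dedekind–MacNeille completion of the formulas with parameters under entailment (`Truth`). Fresh
parameters make quantifiers into infima and suprema over elements (`GTm.tr_all`, `GTm.tr_ex`), and
truth in the model gives derivability (`deriv_of_tr_const_eq_top`). Quantifying over elements is
sound only for inhabited types, so parameters exist just for the types that are inhabited given a
variable of type `τ`. This costs nothing here, because the conclusion speaks of a given point `x` of
type `τ`. -/

namespace IHOL

/-! ### Calculus of renamings and substitutions -/

section SubstitutionLemmas

variable {S : Type u} {Γ Δ Θ : Ctx S} {σ τ : Ty S}

/-- Families indexed by the variables of a context. -/
abbrev Env (F : Ty S → Type u) (Γ : Ctx S) : Type u := ∀ τ : Ty S, Var Γ τ → F τ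

/-- The environment of the empty context. -/
def Env.nil {F : Ty S → Type u} : Env F [] := fun _ x => nomatch x

/-- Extend an environment by the value of the innermost variable. -/
def Env.cons {F : Ty S → Type u} (d : F σ) (ρ : Env F Γ) : Env F (σ :: Γ)
  | _, .here => d
  | _, .there x => ρ _ x

theorem Env.cons_ext {F : Ty S → Type u} {ρ ρ' : Env F (σ :: Γ)}
    (h : ρ _ .here = ρ' _ .here) (h' : ∀ τ (x : Var Γ τ), ρ _ (.there x) = ρ' _ (.there x)) :
    ρ = ρ' := by
  funext τ x
  cases x with
  | here => exact h
  | there x => exact h' _ x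

theorem Env.nil_ext {F : Ty S → Type u} (ρ ρ' : Env F []) : ρ = ρ' := by
  funext τ x
  nomatch x

/-- Structural induction, where only binders need an argument: lifting must commute with
composition. The same scheme gives the three laws that follow. Since lifting a substitution weakens
its values, the laws with a substitution in the first place rest on laws about renamings. -/
theorem Tm.ren_ren (t : Tm Γ τ) : ∀ {Δ Θ : Ctx S} (r : Ren Γ Δ) (r' : Ren Δ Θ),
    (t.ren r).ren r' = t.ren fun _ x => r' _ (r _ x) := by
  have lift (Γ Δ Θ : Ctx S) (r : Ren Γ Δ) (r' : Ren Δ Θ) (σ : Ty S) :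
      (fun τ x => r'.lift σ τ (r.lift σ τ x)) = Ren.lift (fun _ x => r' _ (r _ x)) σ :=
    Env.cons_ext rfl fun _ _ => rfl
  induction t <;> intros <;> simp only [Tm.ren, *]

theorem Tm.ren_sub (t : Tm Γ τ) : ∀ {Δ Θ : Ctx S} (r : Ren Γ Δ) (s : Sub Δ Θ),
    (t.ren r).sub s = t.sub fun _ x => s _ (r _ x) := by
  have lift (Γ Δ Θ : Ctx S) (r : Ren Γ Δ) (s : Sub Δ Θ) (σ : Ty S) :
      (fun τ x => s.lift σ τ (r.lift σ τ x)) = Sub.lift (fun _ x => s _ (r _ x)) σ :=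
    Env.cons_ext rfl fun _ _ => rfl
  induction t <;> intros <;> simp only [Tm.ren, Tm.sub, *]

theorem Tm.sub_ren (t : Tm Γ τ) : ∀ {Δ Θ : Ctx S} (s : Sub Γ Δ) (r : Ren Δ Θ),
    (t.sub s).ren r = t.sub fun _ x => (s _ x).ren r := by
  have lift (Γ Δ Θ : Ctx S) (s : Sub Γ Δ) (r : Ren Δ Θ) (σ : Ty S) :
      (fun τ x => (s.lift σ τ x).ren (r.lift σ)) = Sub.lift (fun _ x => (s _ x).ren r) σ :=
    Env.cons_ext rfl fun _ _ => by simp [Sub.lift, Tm.wk, Tm.ren_ren, Ren.lift]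
  induction t <;> intros <;> simp only [Tm.ren, Tm.sub, *]

theorem Tm.sub_sub (t : Tm Γ τ) : ∀ {Δ Θ : Ctx S} (s : Sub Γ Δ) (s' : Sub Δ Θ),
    (t.sub s).sub s' = t.sub fun _ x => (s _ x).sub s' := by
  have lift (Γ Δ Θ : Ctx S) (s : Sub Γ Δ) (s' : Sub Δ Θ) (σ : Ty S) :
      (fun τ x => (s.lift σ τ x).sub (s'.lift σ)) = Sub.lift (fun _ x => (s _ x).sub s') σ :=
    Env.cons_ext rfl fun _ _ => by simp [Sub.lift, Tm.wk, Tm.ren_sub, Tm.sub_ren]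
  induction t <;> intros <;> simp only [Tm.sub, *]

theorem Tm.sub_var (t : Tm Γ τ) : (t.sub fun _ x => .var x) = t := by
  have lift (Γ : Ctx S) (σ : Ty S) :
      Sub.lift (fun _ x => .var x : Sub Γ Γ) σ = fun _ x => .var x :=
    Env.cons_ext rfl fun _ _ => rfl
  induction t <;> simp only [Tm.sub, *]

theorem Sub.lift_eq_cons (s : Sub Γ Δ) (σ : Ty S) :
    s.lift σ = Env.cons (F := Tm (σ :: Δ)) (.var .here) fun _ x => (s _ x).wk :=
  Env.cons_ext rfl fun _ _ => rfl

/-- Translates between the instantiations in the quantifier and equality rules and the extended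
environments of the model. -/
theorem Tm.sub_lift_inst (t : Tm (σ :: Γ) τ) (s : Sub Γ Δ) (d : Tm Δ σ) :
    (t.sub (s.lift σ)).inst d = t.sub (Env.cons (F := Tm Δ) d s) := by
  rw [Tm.inst, Tm.sub_sub]
  congr 1
  exact Env.cons_ext rfl fun _ _ => by simp [Sub.lift, Tm.wk, Tm.ren_sub, Sub.single, Env.cons,
    Tm.sub_var]

theorem Tm.sub_nil (t : Tm [] τ) (s : Sub [] Γ) : t.sub s = t.close := by
  rw [Tm.close, ← Tm.sub_var (t.ren _), Tm.ren_sub]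
  congr 1
  exact Env.nil_ext (F := Tm Γ) _ _

end SubstitutionLemmas

/-! ### Terms with generic parameters and their entailment order -/

section Generic

variable {S : Type u} {T : Set (Fm ([] : Ctx S))} {τ : Ty S} {Γ Δ : Ctx S} {σ σ' : Ty S}

/-- Interpretations in a context of countably many parameters of each type that is inhabited as
soon as `τ` is. -/
abbrev Asg (τ : Ty S) (Δ : Ctx S) : Type u := ∀ σ : Ty S, Nonempty (Tm [τ] σ) → ℕ → Tm Δ σ

/-- Weakening of an interpretation of the parameters. -/
def Asg.wk (π : Asg τ Δ) (σ : Ty S) : Asg τ (σ :: Δ) := fun σ' h n => (π σ' h n).wk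

open Classical in
/-- Change the interpretation of one parameter. -/
noncomputable def Asg.update (π : Asg τ Δ) (N : ℕ) (t : Tm Δ σ) : Asg τ Δ := fun σ' h n =>
  if e : σ = σ' ∧ n = N then e.1 ▸ t else π σ' h n

/-- The two interpretations agree on the parameters below `N`. -/
def Asg.Agree (N : ℕ) (π π' : Asg τ Δ) : Prop := ∀ σ h, ∀ n < N, π σ h n = π' σ h n

theorem Asg.agree_update (π : Asg τ Δ) (N : ℕ) (t : Tm Δ σ) : π.Agree N (π.update N t) := by
  intro σ' h n hn
  have : ¬ (σ = σ' ∧ n = N) := fun e => hn.ne e.2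
  simp [Asg.update, this]

theorem Asg.update_self (π : Asg τ Δ) (N : ℕ) (t : Tm Δ σ) (h) : π.update N t σ h N = t := by
  simp [Asg.update]

/-- Terms with finitely many parameters, presented by their interpretations in all contexts. -/
structure GTm (T : Set (Fm ([] : Ctx S))) (τ σ : Ty S) where
  /-- The interpretation of the term. -/
  val {Δ : Ctx S} (π : Asg τ Δ) : Tm Δ σ
  val_wk {Δ : Ctx S} (π : Asg τ Δ) (σ' : Ty S) : val (π.wk σ') = (val π).wk
  supp : ∃ N, ∀ {Δ : Ctx S} (π π' : Asg τ Δ), π.Agree N π' → val π = val π'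

namespace GTm

/-- The parameters. -/
def par (h : Nonempty (Tm [τ] σ)) (n : ℕ) : GTm T τ σ where
  val π := π σ h n
  val_wk _ _ := rfl
  supp := ⟨n + 1, fun _ _ e => e _ _ _ n.lt_succ_self⟩

theorem exists_supp_env : ∀ {Γ : Ctx S} (ρ : Env (GTm T τ) Γ), ∃ N, ∀ {Δ : Ctx S}
    (π π' : Asg τ Δ), π.Agree N π' → ∀ σ (x : Var Γ σ), (ρ σ x).val π = (ρ σ x).val π'
  | [], _ => ⟨0, fun _ _ _ _ x => nomatch x⟩
  | _ :: _, ρ => by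
    obtain ⟨N, hN⟩ := exists_supp_env fun _ x => ρ _ (.there x)
    obtain ⟨M, hM⟩ := (ρ _ .here).supp
    refine ⟨max M N, fun π π' e σ x => ?_⟩
    cases x with
    | here => exact hM _ _ fun _ _ n hn => e _ _ n (hn.trans_le (le_max_left ..))
    | there x => exact hN _ _ (fun _ _ n hn => e _ _ n (hn.trans_le (le_max_right ..))) _ x

/-- The value of a term in an environment. -/
def ev (t : Tm Γ σ) (ρ : Env (GTm T τ) Γ) : GTm T τ σ where
  val π := t.sub fun _ x => (ρ _ x).val π
  val_wk π σ' := by rw [Tm.wk, Tm.sub_ren]; simp only [val_wk]; rfl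
  supp := by
    obtain ⟨N, hN⟩ := exists_supp_env ρ
    exact ⟨N, fun π π' e => by simp only [hN π π' e]⟩

theorem val_ev_cons (t : Tm (σ :: Γ) σ') (d : GTm T τ σ) (ρ : Env (GTm T τ) Γ) (π : Asg τ Δ) :
    (ev t (Env.cons d ρ)).val π =
      t.sub (Env.cons (F := Tm Δ) (d.val π) fun _ x => (ρ _ x).val π) :=
  congrArg t.sub (Env.cons_ext rfl fun _ _ => rfl)

/-- Supports are finite, so some parameter is irrelevant to `w` and `ρ`. Reinterpreting it as the
newly bound variable turns a statement about that parameter into one under the binder; this supplies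
the eigenvariable of `le_all` and `ex_le`. -/
theorem exists_fresh (h : Nonempty (Tm [τ] σ)) (w : GTm T τ .omega) (ρ : Env (GTm T τ) Γ) :
    ∃ N, ∀ {Δ : Ctx S} (π : Asg τ Δ), ∃ π' : Asg τ (σ :: Δ), w.val π' = (w.val π).wk ∧
      ∀ {σ'} (t : Tm (σ :: Γ) σ'), (ev t (Env.cons (par h N) ρ)).val π' =
        t.sub (Sub.lift (fun _ x => (ρ _ x).val π) σ) := by
  obtain ⟨N, hN⟩ := exists_supp_env (Env.cons w ρ)
  refine ⟨N, fun {Δ} π => ?_⟩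
  have e := (π.wk σ).agree_update N (.var .here)
  refine ⟨(π.wk σ).update N (.var .here), ?_, fun t => ?_⟩
  · rw [← w.val_wk]
    exact (hN _ _ e _ .here).symm
  · rw [val_ev_cons, Sub.lift_eq_cons]
    congr 1
    refine Env.cons_ext (Asg.update_self _ _ _ _) fun σ' x => ?_
    exact (hN _ _ e _ (.there x)).symm.trans ((ρ _ x).val_wk _ _)

/-- Entailment of generic formulas. -/
instance : Preorder (GTm T τ .omega) where
  le p q := ∀ (Δ : Ctx S) (π : Asg τ Δ) (Φ : List (Fm Δ)), p.val π ∈ Φ → Deriv T Φ (q.val π)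
  le_refl p _ π Φ h := .hyp h
  le_trans p q r h h' _ π Φ hp := .impE (.impI (h' _ π _ (by simp))) (h _ π Φ hp)

theorem le_all (h : Nonempty (Tm [τ] σ)) {w : GTm T τ .omega} {φ : Tm (σ :: Γ) .omega}
    {ρ : Env (GTm T τ) Γ} (H : ∀ d, w ≤ ev φ (Env.cons d ρ)) : w ≤ ev (.all φ) ρ := by
  obtain ⟨N, hN⟩ := exists_fresh h w ρ
  intro Δ π Φ hw
  obtain ⟨π', h1, h2⟩ := hN π
  refine .allI ?_
  rw [← h2]
  refine H _ _ π' _ ?_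
  rw [h1]
  exact List.mem_map_of_mem hw

theorem all_le (d : GTm T τ σ) (φ : Tm (σ :: Γ) .omega) (ρ : Env (GTm T τ) Γ) :
    ev (.all φ) ρ ≤ ev φ (Env.cons d ρ) := by
  intro Δ π Φ hw
  rw [val_ev_cons, ← Tm.sub_lift_inst]
  exact .allE (.hyp hw) _

theorem le_ex (d : GTm T τ σ) (φ : Tm (σ :: Γ) .omega) (ρ : Env (GTm T τ) Γ) :
    ev φ (Env.cons d ρ) ≤ ev (.ex φ) ρ := by
  intro Δ π Φ hw
  rw [val_ev_cons, ← Tm.sub_lift_inst] at hw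
  exact .exI _ (.hyp hw)

theorem ex_le (h : Nonempty (Tm [τ] σ)) {w : GTm T τ .omega} {φ : Tm (σ :: Γ) .omega}
    {ρ : Env (GTm T τ) Γ} (H : ∀ d, ev φ (Env.cons d ρ) ≤ w) : ev (.ex φ) ρ ≤ w := by
  obtain ⟨N, hN⟩ := exists_fresh h w ρ
  intro Δ π Φ hw
  obtain ⟨π', h1, h2⟩ := hN π
  refine .exE (.hyp hw) ?_
  rw [← h1]
  refine H (par h N) _ π' _ ?_
  rw [h2]
  exact List.mem_cons_self ..

/-- Conjunction of generic formulas. -/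
def inf (p q : GTm T τ .omega) : GTm T τ .omega :=
  ev (.and (.var .here) (.var (.there .here))) (Env.cons p (Env.cons q Env.nil))

/-- Implication of generic formulas. -/
def himp (p q : GTm T τ .omega) : GTm T τ .omega :=
  ev (.imp (.var .here) (.var (.there .here))) (Env.cons p (Env.cons q Env.nil))

theorem le_inf_iff {p q r : GTm T τ .omega} : p ≤ inf q r ↔ p ≤ q ∧ p ≤ r :=
  ⟨fun h => ⟨fun _ π Φ hp => .andE₁ (h _ π Φ hp), fun _ π Φ hp => .andE₂ (h _ π Φ hp)⟩,
    fun h _ π Φ hp => .andI (h.1 _ π Φ hp) (h.2 _ π Φ hp)⟩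

theorem le_himp_iff {p q r : GTm T τ .omega} : p ≤ himp q r ↔ inf p q ≤ r := by
  refine ⟨fun h _ π Φ hp => ?_, fun h _ π Φ hp => ?_⟩
  · exact .impE (.impE (.impI (h _ π _ (List.mem_cons_self ..))) (.andE₁ (.hyp hp))) (.andE₂ (.hyp hp))
  · refine .impI (.impE (.impI (h _ π _ (List.mem_cons_self ..))) ?_)
    exact .andI (.hyp (List.mem_cons_of_mem _ hp)) (.hyp (List.mem_cons_self ..))

/-- Provable equality of generic terms. -/
instance setoid : Setoid (GTm T τ σ) where
  r s t := ∀ (Δ : Ctx S) (π : Asg τ Δ) (Φ : List (Fm Δ)), Deriv T Φ (s.val π ≐ t.val π)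
  iseqv := by
    have subst {Δ : Ctx S} {Φ : List (Fm Δ)} {r s t : Tm Δ σ} (h : Deriv T Φ (r ≐ s))
        (h' : Deriv T Φ (r ≐ t)) : Deriv T Φ (s ≐ t) := by
      have e (x : Tm Δ σ) : (Tm.var .here ≐ t.wk).inst x = (x ≐ t) :=
        congrArg (x ≐ ·) ((Tm.ren_sub ..).trans (Tm.sub_var t))
      rw [← e]
      exact .eqE _ h (by rw [e]; exact h')
    exact ⟨fun _ _ π Φ => .eqI _, fun h _ π Φ => subst (h _ π Φ) (.eqI _),
      fun h h' _ π Φ => subst (subst (h _ π Φ) (.eqI _)) (h' _ π Φ)⟩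

theorem subst {s t : GTm T τ σ} (φ : Tm (σ :: Γ) .omega) (ρ : Env (GTm T τ) Γ) {Φ : List (Fm Δ)}
    {π : Asg τ Δ} (h : Deriv T Φ (s.val π ≐ t.val π))
    (h' : Deriv T Φ ((ev φ (Env.cons s ρ)).val π)) :
    Deriv T Φ ((ev φ (Env.cons t ρ)).val π) := by
  rw [val_ev_cons, ← Tm.sub_lift_inst] at h' ⊢
  exact .eqE _ h h'

theorem ev_cons_congr (t : Tm (σ :: Γ) σ') {d d' : GTm T τ σ} (ρ : Env (GTm T τ) Γ)
    (h : d ≈ d') : ev t (Env.cons d ρ) ≈ ev t (Env.cons d' ρ) := by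
  intro Δ π Φ
  have e (x : GTm T τ σ) : (ev (.var (.there .here) ≐ t.ren (Ren.lift (fun _ x => .there x) _))
      (Env.cons x (Env.cons (ev t (Env.cons d ρ)) ρ))).val π =
      ((ev t (Env.cons d ρ)).val π ≐ (ev t (Env.cons x ρ)).val π) := by
    refine congrArg (_ ≐ ·) ((Tm.ren_sub ..).trans ?_)
    exact congrArg t.sub (Env.cons_ext rfl fun _ _ => rfl)
  rw [← e]
  exact subst _ _ (h _ π Φ) (by rw [e]; exact .eqI _)

/-- Application of generic terms. -/
def app (f : GTm T τ (σ ⇒ₜ σ')) (t : GTm T τ σ) : GTm T τ σ' :=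
  ev (.var .here ⬝ .var (.there .here)) (Env.cons f (Env.cons t Env.nil))

theorem app_congr {f f' : GTm T τ (σ ⇒ₜ σ')} {t t' : GTm T τ σ} (h : f ≈ f') (h' : t ≈ t') :
    app f t ≈ app f' t' :=
  Setoid.trans (ev_cons_congr _ _ h)
    (ev_cons_congr (.var (.there .here) ⬝ .var .here) (Env.cons f' Env.nil) h')

theorem app_lam (t : Tm (σ :: Γ) σ') (d : GTm T τ σ) (ρ : Env (GTm T τ) Γ) :
    app (ev (.lam t) ρ) d ≈ ev t (Env.cons d ρ) := by
  intro Δ π Φ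
  rw [val_ev_cons, ← Tm.sub_lift_inst]
  exact .beta _ _

/-- Induction on the context, not on the term: the innermost variable is abstracted by a `lam` and
recovered by beta, so no congruence rule under binders is needed. -/
theorem ev_congr : ∀ {Γ : Ctx S} {σ : Ty S} (t : Tm Γ σ) {ρ ρ' : Env (GTm T τ) Γ},
    (∀ σ x, ρ σ x ≈ ρ' σ x) → ev t ρ ≈ ev t ρ'
  | [], _, _, ρ, ρ', _ => by
    rw [Env.nil_ext ρ ρ']
  | σ :: Γ, _, t, ρ, ρ', h => by
    have e (ρ : Env (GTm T τ) (σ :: Γ)) : ρ = Env.cons (ρ _ .here) fun _ x => ρ _ (.there x) :=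
      Env.cons_ext rfl fun _ _ => rfl
    rw [e ρ, e ρ']
    exact Setoid.trans (Setoid.symm (app_lam _ _ _)) (Setoid.trans (app_congr
      (ev_congr (.lam t) fun σ x => h σ (.there x)) (h _ .here)) (app_lam _ _ _))

theorem le_of_equiv {p q : GTm T τ .omega} (h : p ≈ q) : p ≤ q := by
  intro Δ π Φ hp
  exact subst (.var .here) Env.nil (h _ π Φ) (.hyp hp)

/-- The nucleus of the completion of the order of generic formulas. -/
def nucleus (T : Set (Fm ([] : Ctx S))) (τ : Ty S) : Nucleus (LowerSet (GTm T τ .omega)) where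
  -- The lower bounds of the upper bounds: the Dedekind–MacNeille closure. It keeps the joins that
  -- exist among formulas, which the ideal completion by all lower sets would not.
  toFun L := ⟨{w | ∀ c, (∀ v ∈ L, v ≤ c) → w ≤ c}, fun _ _ h hw c hc => h.trans (hw c hc)⟩
  map_inf' L M := by
    apply le_antisymm
    · exact fun w h => ⟨fun c hc => h c fun v hv => hc v hv.1, fun c hc => h c fun v hv => hc v hv.2⟩
    -- The only point that uses implication: for `u ∈ L` and `v ∈ M` the conjunction of `u` and `v`
    -- lies in both, hence below `c`. Currying lets the closure property be applied to `u` and `v`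
    -- one at a time, which gives that `w` entails `w → c`.
    · intro w h c hc
      have h1 : ∀ v ∈ M, w ≤ himp v c := fun v hv => h.1 _ fun u hu => le_himp_iff.2
        (hc _ ⟨L.lower (le_inf_iff.1 (le_refl _)).1 hu, M.lower (le_inf_iff.1 (le_refl _)).2 hv⟩)
      have h2 : w ≤ himp w c := h.2 _ fun v hv => le_himp_iff.2
        ((le_inf_iff.2 ⟨(le_inf_iff.1 (le_refl _)).2, (le_inf_iff.1 (le_refl _)).1⟩).trans
          (le_himp_iff.1 (h1 v hv)))
      exact (le_inf_iff.2 ⟨le_refl _, le_refl _⟩).trans (le_himp_iff.1 h2)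
  idempotent' L w h c hc := h c fun v hv => hv c hc
  le_apply' L w hw c hc := hc w hw

end GTm

end Generic

/-! ### The Heyting-valued term model -/

section TruthValues

variable {S : Type u} {T : Set (Fm ([] : Ctx S))} {τ : Ty S} {Γ Δ : Ctx S} {σ σ' : Ty S}

/-- The complete Heyting algebra generated by the generic formulas. -/
def Truth (T : Set (Fm ([] : Ctx S))) (τ : Ty S) : Type u := Set.range (GTm.nucleus T τ)

instance : Order.Frame (Truth T τ) := inferInstanceAs (Order.Frame (Set.range (GTm.nucleus T τ)))

namespace GTm

/-- The truth value of a generic formula. -/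
def tr (p : GTm T τ .omega) : Truth T τ :=
  ⟨LowerSet.Iic p, LowerSet.Iic p, le_antisymm
    (fun _ h => h p fun _ hv => hv) (nucleus T τ).le_apply⟩

theorem tr_le_iff {p : GTm T τ .omega} {x : Truth T τ} : tr p ≤ x ↔ p ∈ x.1 :=
  ⟨fun h => h (le_refl p), fun h _ hv => x.1.lower hv h⟩

theorem tr_le_tr {p q : GTm T τ .omega} : tr p ≤ tr q ↔ p ≤ q := tr_le_iff

theorem le_iff_tr {x y : Truth T τ} : x ≤ y ↔ ∀ p, tr p ≤ x → tr p ≤ y :=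
  ⟨fun h _ hp => hp.trans h, fun h p hp => tr_le_iff.1 (h p (tr_le_iff.2 hp))⟩

/-- Closed lower sets are intersections of principal ones. This is what makes disjunctions,
existential statements and falsity genuine joins; for meets the dual fact `le_iff_tr` suffices. -/
theorem tr_le_of_forall {p : GTm T τ .omega} {x : Truth T τ} (h : ∀ c, x ≤ tr c → p ≤ c) :
    tr p ≤ x := by
  obtain ⟨_, L, rfl⟩ := x
  refine tr_le_iff.2 fun c hc => h c fun v hv => ?_
  exact hv c hc

theorem tr_inf (p q : GTm T τ .omega) : tr (inf p q) = tr p ⊓ tr q :=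
  le_antisymm (le_inf (tr_le_tr.2 (le_inf_iff.1 (le_refl _)).1)
    (tr_le_tr.2 (le_inf_iff.1 (le_refl _)).2)) <| le_iff_tr.2 fun _ h =>
      tr_le_tr.2 (le_inf_iff.2 ⟨tr_le_tr.1 (h.trans inf_le_left), tr_le_tr.1 (h.trans inf_le_right)⟩)

theorem tr_himp (p q : GTm T τ .omega) : tr (himp p q) = tr p ⇨ tr q := by
  apply le_antisymm
  · rw [_root_.le_himp_iff, ← tr_inf, tr_le_tr]
    exact le_himp_iff.1 (le_refl _)
  · refine le_iff_tr.2 fun w h => tr_le_tr.2 (le_himp_iff.2 (tr_le_tr.1 ?_))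
    rwa [tr_inf, ← _root_.le_himp_iff]

theorem tr_all [h : Nonempty (Tm [τ] σ)] (φ : Tm (σ :: Γ) .omega) (ρ : Env (GTm T τ) Γ) :
    tr (ev (.all φ) ρ) = ⨅ d, tr (ev φ (Env.cons d ρ)) :=
  le_antisymm (le_iInf fun d => tr_le_tr.2 (all_le d φ ρ)) <| le_iff_tr.2 fun _ hw =>
    tr_le_tr.2 (le_all h fun d => tr_le_tr.1 (hw.trans (iInf_le _ d)))

theorem tr_ex [h : Nonempty (Tm [τ] σ)] (φ : Tm (σ :: Γ) .omega) (ρ : Env (GTm T τ) Γ) :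
    tr (ev (.ex φ) ρ) = ⨆ d, tr (ev φ (Env.cons d ρ)) :=
  le_antisymm (tr_le_of_forall fun _ hc => ex_le h fun d => tr_le_tr.1 ((le_iSup _ d).trans hc))
    (iSup_le fun d => tr_le_tr.2 (le_ex d φ ρ))

theorem tr_or (p q : Tm Γ .omega) (ρ : Env (GTm T τ) Γ) :
    tr (ev (.or p q) ρ) = tr (ev p ρ) ⊔ tr (ev q ρ) := by
  refine le_antisymm (tr_le_of_forall fun c hc Δ π Φ h => ?_)
    (sup_le (tr_le_tr.2 fun Δ π Φ h => .orI₁ (.hyp h)) (tr_le_tr.2 fun Δ π Φ h => .orI₂ (.hyp h)))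
  exact .orE (.hyp h) (tr_le_tr.1 (le_sup_left.trans hc) _ π _ (List.mem_cons_self ..))
    (tr_le_tr.1 (le_sup_right.trans hc) _ π _ (List.mem_cons_self ..))

theorem tr_falsum (ρ : Env (GTm T τ) Γ) : tr (ev .falsum ρ) = ⊥ :=
  le_bot_iff.1 (tr_le_of_forall fun _ _ _ _ _ h => .falsumE (.hyp h))

end GTm

/-- Terms with parameters up to provable equality. -/
def Elt (T : Set (Fm ([] : Ctx S))) (τ σ : Ty S) : Type u := Quotient (GTm.setoid (T := T) (τ := τ) (σ := σ))

namespace Elt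

/-- The class of a generic term. -/
def mk (t : GTm T τ σ) : Elt T τ σ := Quotient.mk _ t

/-- The truth value of a formula with parameters. -/
def tr : Elt T τ .omega → Truth T τ := Quotient.lift GTm.tr fun _ _ h =>
  le_antisymm (GTm.tr_le_tr.2 (GTm.le_of_equiv h)) (GTm.tr_le_tr.2 (GTm.le_of_equiv (Setoid.symm h)))

instance : Coe (Elt T τ .omega) (Truth T τ) := ⟨tr⟩

/-- The value of a term in an environment. -/
noncomputable def ev (t : Tm Γ σ) (ρ : Env (Elt T τ) Γ) : Elt T τ σ :=
  mk (GTm.ev t fun _ x => (ρ _ x).out)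

theorem mk_surjective : Function.Surjective (mk : GTm T τ σ → Elt T τ σ) := Quotient.mk_surjective

theorem mk_eq {s t : GTm T τ σ} : mk s = mk t ↔
    ∀ (Δ : Ctx S) (π : Asg τ Δ) (Φ : List (Fm Δ)), Deriv T Φ (s.val π ≐ t.val π) := Quotient.eq

theorem tr_mk (p : GTm T τ .omega) : tr (mk p) = p.tr := rfl

theorem ev_mk (t : Tm Γ σ) (ρ : Env (GTm T τ) Γ) :
    ev t (fun _ x => mk (ρ _ x)) = mk (GTm.ev t ρ) :=
  Quotient.sound (GTm.ev_congr t fun _ _ => Quotient.mk_out _)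

theorem exists_env (ρ : Env (Elt T τ) Γ) : ∃ ρ' : Env (GTm T τ) Γ, ρ = fun _ x => mk (ρ' _ x) :=
  ⟨fun _ x => (ρ _ x).out, funext fun _ => funext fun _ => (Quotient.out_eq _).symm⟩

theorem cons_mk (d : GTm T τ σ) (ρ : Env (GTm T τ) Γ) :
    (Env.cons (mk d) fun _ x => mk (ρ _ x)) = fun _ x => mk (Env.cons d ρ _ x) :=
  Env.cons_ext rfl fun _ _ => rfl

/-- The substitution lemma of the model. Each operation on elements is defined by a term built from
variables, and this lemma extends its evaluation rule to arbitrary subterms. -/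
theorem ev_sub (t : Tm Γ σ) (s : Sub Γ Δ) (ρ : Env (Elt T τ) Δ) :
    ev (t.sub s) ρ = ev t fun _ x => ev (s _ x) ρ := by
  obtain ⟨ρ, rfl⟩ := exists_env ρ
  simp only [ev_mk]
  refine Quotient.sound fun Δ π Φ => ?_
  simp only [GTm.ev, Tm.sub_sub]
  exact .eqI _

@[simp] theorem ev_var (x : Var Γ σ) (ρ : Env (Elt T τ) Γ) : ev (.var x) ρ = ρ _ x := by
  obtain ⟨ρ, rfl⟩ := exists_env ρ
  exact ev_mk _ _

@[simp] theorem cons_here (d : Elt T τ σ) (ρ : Env (Elt T τ) Γ) : Env.cons d ρ _ .here = d := rfl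

@[simp] theorem cons_there (d : Elt T τ σ) (ρ : Env (Elt T τ) Γ) (x : Var Γ σ') :
    Env.cons d ρ _ (.there x) = ρ _ x := rfl

@[simp] theorem ev_wk (t : Tm Γ σ) (d : Elt T τ σ') (ρ : Env (Elt T τ) Γ) :
    ev t.wk (Env.cons d ρ) = ev t ρ := by
  rw [← Tm.sub_var t.wk, Tm.wk, Tm.ren_sub, ev_sub]
  congr
  funext
  exact ev_var _ _

theorem ev_env_cons (t : Tm Δ σ) (s : Sub Γ Δ) (ρ : Env (Elt T τ) Δ) :
    (fun σ' x => ev (Env.cons (F := Tm Δ) t s σ' x) ρ) = Env.cons (ev t ρ) fun _ x => ev (s _ x) ρ :=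
  Env.cons_ext rfl fun _ _ => rfl

theorem ev_env_nil (ρ : Env (Elt T τ) Δ) :
    (fun σ' x => ev (Env.nil (F := Tm Δ) σ' x) ρ) = Env.nil := Env.nil_ext _ _

theorem nil_mk : (Env.nil : Env (Elt T τ) []) = fun _ x => mk (Env.nil _ x) := Env.nil_ext _ _

/-- The value of a closed term. -/
noncomputable def const (t : Tm [] σ) : Elt T τ σ := ev t Env.nil

/-- Application. -/
noncomputable def app (f : Elt T τ (σ ⇒ₜ σ')) (t : Elt T τ σ) : Elt T τ σ' :=
  ev (.var .here ⬝ .var (.there .here)) (Env.cons f (Env.cons t Env.nil))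

noncomputable instance : CoeFun (Elt T τ (σ ⇒ₜ σ')) fun _ => Elt T τ σ → Elt T τ σ' := ⟨app⟩

@[simp] theorem ev_app (f : Tm Γ (σ ⇒ₜ σ')) (t : Tm Γ σ) (ρ : Env (Elt T τ) Γ) :
    ev (f ⬝ t) ρ = (ev f ρ) (ev t ρ) := by
  refine (ev_sub (.var .here ⬝ .var (.there .here))
    (Env.cons (F := Tm Γ) f (Env.cons t Env.nil)) ρ).trans ?_
  rw [ev_env_cons, ev_env_cons, ev_env_nil, app]

@[simp] theorem ev_lam_app (t : Tm (σ :: Γ) σ') (d : Elt T τ σ) (ρ : Env (Elt T τ) Γ) :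
    (ev (.lam t) ρ) d = ev t (Env.cons d ρ) := by
  obtain ⟨ρ, rfl⟩ := exists_env ρ
  obtain ⟨d, rfl⟩ := mk_surjective d
  rw [cons_mk, ev_mk, ev_mk, app, show (Env.nil : Env (Elt T τ) []) = fun _ x => mk (Env.nil _ x) from
    Env.nil_ext _ _, cons_mk, cons_mk, ev_mk]
  exact Quotient.sound (GTm.app_lam _ _ _)

@[simp] theorem tr_falsum (ρ : Env (Elt T τ) Γ) : tr (ev .falsum ρ) = ⊥ := by
  obtain ⟨ρ, rfl⟩ := exists_env ρ
  rw [ev_mk, tr_mk, GTm.tr_falsum]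

@[simp] theorem tr_and (p q : Tm Γ .omega) (ρ : Env (Elt T τ) Γ) :
    tr (ev (p ∧' q) ρ) = tr (ev p ρ) ⊓ tr (ev q ρ) := by
  obtain ⟨ρ, rfl⟩ := exists_env ρ
  simp only [ev_mk, tr_mk]
  exact GTm.tr_inf (GTm.ev p ρ) (GTm.ev q ρ)

@[simp] theorem tr_imp (p q : Tm Γ .omega) (ρ : Env (Elt T τ) Γ) :
    tr (ev (p ⇒ q) ρ) = tr (ev p ρ) ⇨ tr (ev q ρ) := by
  obtain ⟨ρ, rfl⟩ := exists_env ρ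
  simp only [ev_mk, tr_mk]
  exact GTm.tr_himp (GTm.ev p ρ) (GTm.ev q ρ)

@[simp] theorem tr_or (p q : Tm Γ .omega) (ρ : Env (Elt T τ) Γ) :
    tr (ev (p ∨' q) ρ) = tr (ev p ρ) ⊔ tr (ev q ρ) := by
  obtain ⟨ρ, rfl⟩ := exists_env ρ
  simp only [ev_mk, tr_mk, GTm.tr_or]

@[simp] theorem tr_all [Nonempty (Tm [τ] σ)] (p : Tm (σ :: Γ) .omega) (ρ : Env (Elt T τ) Γ) :
    tr (ev (.all p) ρ) = ⨅ d : Elt T τ σ, tr (ev p (Env.cons d ρ)) := by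
  obtain ⟨ρ, rfl⟩ := exists_env ρ
  simp only [ev_mk, tr_mk, GTm.tr_all, ← mk_surjective.iInf_comp, cons_mk]

@[simp] theorem tr_ex [Nonempty (Tm [τ] σ)] (p : Tm (σ :: Γ) .omega) (ρ : Env (Elt T τ) Γ) :
    tr (ev (.ex p) ρ) = ⨆ d : Elt T τ σ, tr (ev p (Env.cons d ρ)) := by
  obtain ⟨ρ, rfl⟩ := exists_env ρ
  simp only [ev_mk, tr_mk, GTm.tr_ex, ← mk_surjective.iSup_comp, cons_mk]

/-- Equality, as a truth value. -/
noncomputable def eq (s t : Elt T τ σ) : Truth T τ :=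
  tr (ev (.var .here ≐ .var (.there .here)) (Env.cons s (Env.cons t Env.nil)))

infix:75 " ≣ " => Elt.eq

@[simp] theorem tr_eq (s t : Tm Γ σ) (ρ : Env (Elt T τ) Γ) :
    tr (ev (s ≐ t) ρ) = ev s ρ ≣ ev t ρ := by
  refine congrArg tr ((ev_sub (.var .here ≐ .var (.there .here))
    (Env.cons (F := Tm Γ) s (Env.cons t Env.nil)) ρ).trans ?_)
  rw [ev_env_cons, ev_env_cons, ev_env_nil]

/-- Zero. -/
noncomputable def zero : Elt T τ .nat := const .zero

/-- The successor of a natural number. -/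
noncomputable def succ (n : Elt T τ .nat) : Elt T τ .nat :=
  ev (.succ (.var .here)) (Env.cons n Env.nil)

/-- Primitive recursion. -/
noncomputable def natrec (z : Elt T τ σ) (s : Elt T τ (.nat ⇒ₜ σ ⇒ₜ σ)) (n : Elt T τ .nat) :
    Elt T τ σ :=
  ev (.natrec (.var .here) (.var (.there .here)) (.var (.there (.there .here))))
    (Env.cons z (Env.cons s (Env.cons n Env.nil)))

@[simp] theorem ev_zero (ρ : Env (Elt T τ) Γ) : ev .zero ρ = zero := by
  refine (ev_sub .zero Env.nil ρ).trans ?_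
  rw [ev_env_nil, zero, const]

@[simp] theorem ev_succ (n : Tm Γ .nat) (ρ : Env (Elt T τ) Γ) :
    ev (.succ n) ρ = succ (ev n ρ) := by
  refine (ev_sub (.succ (.var .here)) (Env.cons (F := Tm Γ) n Env.nil) ρ).trans ?_
  rw [ev_env_cons, ev_env_nil, succ]

@[simp] theorem ev_natrec (z : Tm Γ σ) (s : Tm Γ (.nat ⇒ₜ σ ⇒ₜ σ)) (n : Tm Γ .nat)
    (ρ : Env (Elt T τ) Γ) : ev (.natrec z s n) ρ = natrec (ev z ρ) (ev s ρ) (ev n ρ) := by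
  refine (ev_sub (.natrec (.var .here) (.var (.there .here)) (.var (.there (.there .here))))
    (Env.cons (F := Tm Γ) z (Env.cons s (Env.cons n Env.nil))) ρ).trans ?_
  rw [ev_env_cons, ev_env_cons, ev_env_cons, ev_env_nil, natrec]

@[simp] theorem natrec_zero (z : Elt T τ σ) (s : Elt T τ (.nat ⇒ₜ σ ⇒ₜ σ)) :
    natrec z s zero = z := by
  obtain ⟨z, rfl⟩ := mk_surjective z
  obtain ⟨s, rfl⟩ := mk_surjective s
  rw [natrec, zero, const, nil_mk, ev_mk, cons_mk, cons_mk, cons_mk, ev_mk, mk_eq]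
  exact fun Δ π Φ => .natrecZero _ _

@[simp] theorem natrec_succ (z : Elt T τ σ) (s : Elt T τ (.nat ⇒ₜ σ ⇒ₜ σ)) (n : Elt T τ .nat) :
    natrec z s (succ n) = s n (natrec z s n) := by
  obtain ⟨z, rfl⟩ := mk_surjective z
  obtain ⟨s, rfl⟩ := mk_surjective s
  obtain ⟨n, rfl⟩ := mk_surjective n
  simp only [natrec, succ, app, nil_mk, cons_mk, ev_mk, mk_eq]
  exact fun Δ π Φ => .natrecSucc _ _ _

/-- Soundness in one stroke: a rule of the calculus that is closed under substitution becomes an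
inequality of truth values. -/
theorem tr_ev_le {p q : Tm Γ .omega} (ρ : Env (Elt T τ) Γ)
    (h : ∀ {Δ : Ctx S} {Φ : List (Fm Δ)} (s : Sub Γ Δ), Deriv T Φ (p.sub s) → Deriv T Φ (q.sub s)) :
    tr (ev p ρ) ≤ tr (ev q ρ) := by
  obtain ⟨ρ, rfl⟩ := exists_env ρ
  rw [ev_mk, ev_mk, tr_mk, tr_mk, GTm.tr_le_tr]
  exact fun Δ π Φ hp => h _ (.hyp hp)

theorem top_le_of_deriv {p : Tm Γ .omega} (ρ : Env (Elt T τ) Γ)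
    (h : ∀ {Δ : Ctx S} {Φ : List (Fm Δ)} (s : Sub Γ Δ), Deriv T Φ (p.sub s)) :
    tr (ev p ρ) = ⊤ := by
  refine top_le_iff.1 ?_
  have := tr_ev_le (p := Tm.falsum ⇒ Tm.falsum) (q := p) ρ fun s _ => h s
  rwa [tr_imp, himp_self] at this

theorem eq_refl (t : Elt T τ σ) : t ≣ t = ⊤ := top_le_of_deriv
  (p := .var .here ≐ .var .here) (Env.cons t Env.nil) fun _ => .eqI _

theorem eq_subst (p : Tm (σ :: Γ) .omega) (ρ : Env (Elt T τ) Γ) (s t : Elt T τ σ) :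
    s ≣ t ⊓ tr (ev p (Env.cons s ρ)) ≤ tr (ev p (Env.cons t ρ)) := by
  obtain ⟨ρ, rfl⟩ := exists_env ρ
  obtain ⟨s, rfl⟩ := mk_surjective s
  obtain ⟨t, rfl⟩ := mk_surjective t
  rw [eq, nil_mk, cons_mk, cons_mk, cons_mk, cons_mk, ev_mk, ev_mk, ev_mk, tr_mk, tr_mk, tr_mk,
    ← GTm.tr_inf, GTm.tr_le_tr]
  exact fun Δ π Φ h => GTm.subst p ρ (.andE₁ (.hyp h)) (.andE₂ (.hyp h))

theorem eq_funext [Nonempty (Tm [τ] σ)] (f g : Elt T τ (σ ⇒ₜ σ')) :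
    ⨅ x, (f x ≣ g x) ≤ f ≣ g := by
  have := tr_ev_le (p := All σ fun x => (.var (.there .here)) ⬝ x ≐ (.var (.there (.there .here))) ⬝ x)
    (q := .var .here ≐ .var (.there .here)) (Env.cons f (Env.cons g Env.nil) : Env (Elt T τ) _)
    fun _ h => .funext h
  simpa [All]

theorem eq_propext (p q : Elt T τ .omega) : (tr p ⇨ tr q) ⊓ (tr q ⇨ tr p) ≤ p ≣ q := by
  have := tr_ev_le (p := .var .here ⇔ .var (.there .here)) (q := .var .here ≐ .var (.there .here))
    (Env.cons p (Env.cons q Env.nil) : Env (Elt T τ) _) fun _ h => .propext h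
  simpa [Tm.iff]

theorem zero_eq_succ (n : Elt T τ .nat) : zero ≣ succ n = ⊥ := by
  have := top_le_of_deriv (p := ¬' (.zero ≐ .succ (.var .here))) (Env.cons n Env.nil : Env (Elt T τ) _)
    fun _ => .zeroNeSucc _
  exact le_bot_iff.1 (himp_eq_top_iff.1 ((himp_bot _).trans (by simpa [Tm.neg] using this)))

theorem succ_eq_succ (m n : Elt T τ .nat) : succ m ≣ succ n ≤ m ≣ n := by
  have := tr_ev_le (p := .succ (.var .here) ≐ .succ (.var (.there .here)))
    (q := .var .here ≐ .var (.there .here))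
    (Env.cons m (Env.cons n Env.nil) : Env (Elt T τ) _) fun _ h => .succInj h
  simpa

instance : Nonempty (Tm [τ] τ) := ⟨.var .here⟩
instance : Nonempty (Tm [τ] .nat) := ⟨.zero⟩
instance : Nonempty (Tm [τ] .omega) := ⟨.falsum⟩
instance [h : Nonempty (Tm [τ] σ')] : Nonempty (Tm [τ] (σ ⇒ₜ σ')) := ⟨.lam h.some.wk⟩

theorem induction (A : Elt T τ Ty.nat.pow) :
    tr (A zero) ⊓ (⨅ n, (tr (A n) ⇨ tr (A (succ n)))) ≤ ⨅ n, tr (A n) := by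
  have := tr_ev_le (p := .zero ∈' .var .here ∧'
      All .nat fun n => n ∈' .var (.there .here) ⇒ .succ n ∈' .var (.there .here))
    (q := All .nat fun n => n ∈' .var (.there .here)) (Env.cons A Env.nil : Env (Elt T τ) _)
    fun _ h => .induction (.andE₁ h) (.andE₂ h)
  simpa [All, mem]

theorem tr_const_of_mem {p : Tm [] .omega} (h : p ∈ T) : tr (const p : Elt T τ .omega) = ⊤ :=
  top_le_of_deriv _ fun s => by rw [Tm.sub_nil]; exact .ax h

/-- Completeness of the model. The parameters have to be interpreted in `Γ`, which is possible once
`Γ` has a term `x` of type `τ`, since every type with parameters is inhabited relative to `τ`. -/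
theorem deriv_of_tr_const_eq_top {p : Tm [] .omega} (h : tr (const p : Elt T τ .omega) = ⊤)
    (x : Tm Γ τ) (Φ : List (Fm Γ)) : Deriv T Φ p.close := by
  have h1 : tr (ev (.falsum ⇒ .falsum) Env.nil : Elt T τ .omega) ≤ tr (const p) := h ▸ le_top
  rw [const, nil_mk, ev_mk, ev_mk, tr_mk, tr_mk, GTm.tr_le_tr] at h1
  -- Any interpretation will do, as `p` is closed.
  have π : Asg τ Γ := fun σ h n => h.some.sub (Env.cons (F := Tm Γ) x Env.nil)
  have h2 := h1 Γ π _ (List.mem_cons_self (l := Φ))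
  simp only [GTm.ev, Tm.sub_nil] at h2
  exact .impE (.impI h2) (.impI (.hyp (List.mem_cons_self ..)))

end Elt

end TruthValues

/-! ### Natural deduction inside a frame -/

section InternalLogic

section Frame

variable {H ι : Type*} [Order.Frame H] {w p q r : H}

/-- Here and below, `w ≤ p` is read as "stage `w` forces `p`"; passing to a stage `v ≤ w`
corresponds to adding hypotheses. In this reading the lemmas are the rules of intuitionistic logic.
-/
theorem mp (h : w ≤ p ⇨ q) (hp : w ≤ p) : w ≤ q :=
  (le_inf h hp).trans himp_inf_le

theorem impI (h : ∀ v ≤ w, v ≤ p → v ≤ q) : w ≤ p ⇨ q :=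
  le_himp_iff.2 (h _ inf_le_left inf_le_right)

theorem notI (h : ∀ v ≤ w, v ≤ p → v ≤ ⊥) : w ≤ pᶜ :=
  himp_bot p ▸ impI h

theorem notE (h : w ≤ pᶜ) (hp : w ≤ p) : w ≤ q :=
  (mp (himp_bot p ▸ h) hp).trans bot_le

theorem orE (h : w ≤ p ⊔ q) (h₁ : ∀ v ≤ w, v ≤ p → v ≤ r) (h₂ : ∀ v ≤ w, v ≤ q → v ≤ r) : w ≤ r :=
  (le_inf le_rfl h).trans (inf_sup_left w p q ▸ sup_le (h₁ _ inf_le_left inf_le_right)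
    (h₂ _ inf_le_left inf_le_right))

theorem exE {F : ι → H} (h : w ≤ ⨆ i, F i) (h₁ : ∀ i, ∀ v ≤ w, v ≤ F i → v ≤ r) : w ≤ r :=
  (le_inf le_rfl h).trans (inf_iSup_eq w F ▸ iSup_le fun i => h₁ i _ inf_le_left inf_le_right)

theorem exI {F : ι → H} (i : ι) (h : w ≤ F i) : w ≤ ⨆ i, F i := le_iSup_of_le i h

theorem allE {F : ι → H} (h : w ≤ ⨅ i, F i) (i : ι) : w ≤ F i := h.trans (iInf_le F i)

theorem andE₁ (h : w ≤ p ⊓ q) : w ≤ p := h.trans inf_le_left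

theorem andE₂ (h : w ≤ p ⊓ q) : w ≤ q := h.trans inf_le_right

theorem orI₁ (h : w ≤ p) : w ≤ p ⊔ q := le_sup_of_le_left h

theorem orI₂ (h : w ≤ q) : w ≤ p ⊔ q := le_sup_of_le_right h
theorem notnot_em : w ≤ (p ⊔ pᶜ)ᶜᶜ := by
  rw [compl_sup, inf_compl_self, compl_bot]; exact le_top

/-- To prove a stable statement, one may decide any other statement. -/
theorem stable_by_cases (p : H) (hq : ∀ v ≤ w, v ≤ qᶜᶜ → v ≤ q) (h₁ : ∀ v ≤ w, v ≤ p → v ≤ q)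
    (h₂ : ∀ v ≤ w, v ≤ pᶜ → v ≤ q) : w ≤ q := by
  refine hq w le_rfl (notI fun v hv hn => notE (notnot_em (p := p)) (notI fun u hu he => ?_))
  refine notE (hu.trans hn) (orE he (fun t ht hp => ?_) fun t ht hp => ?_)
  · exact h₁ t (ht.trans (hu.trans hv)) hp
  · exact h₂ t (ht.trans (hu.trans hv)) hp

end Frame

variable {S : Type u} {T : Set (Fm ([] : Ctx S))} {τ : Ty S} {Γ : Ctx S} {σ σ' : Ty S}
  {w : Truth T τ}

namespace Elt

theorem subst (p : Tm (σ :: Γ) .omega) (ρ : Env (Elt T τ) Γ) {s t : Elt T τ σ}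
    (h : w ≤ s ≣ t) (hs : w ≤ ev p (Env.cons s ρ)) : w ≤ ev p (Env.cons t ρ) :=
  (le_inf h hs).trans (eq_subst ..)

theorem eq_rfl {t : Elt T τ σ} : w ≤ t ≣ t := eq_refl t ▸ le_top

theorem eq_of_eq {s t : Elt T τ σ} (h : s = t) : w ≤ s ≣ t := h ▸ eq_rfl

theorem eq_symm {s t : Elt T τ σ} (h : w ≤ s ≣ t) : w ≤ t ≣ s := by
  have := subst (.var .here ≐ .var (.there .here)) (Env.cons s Env.nil) h
  simp only [tr_eq, ev_var, cons_here, cons_there] at this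
  exact this eq_rfl

theorem eq_trans {r s t : Elt T τ σ} (h : w ≤ r ≣ s) (h' : w ≤ s ≣ t) : w ≤ r ≣ t := by
  have := subst (.var (.there .here) ≐ .var .here) (Env.cons r Env.nil) h'
  simp only [tr_eq, ev_var, cons_here, cons_there] at this
  exact this h

theorem eq_congr (f : Elt T τ (σ ⇒ₜ σ')) {s t : Elt T τ σ} (h : w ≤ s ≣ t) : w ≤ f s ≣ f t := by
  have := subst (.var (.there .here) ⬝ .var (.there (.there .here)) ≐
    .var (.there .here) ⬝ .var .here) (Env.cons f (Env.cons s Env.nil)) h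
  simp only [tr_eq, ev_app, ev_var, cons_here, cons_there] at this
  exact this eq_rfl

theorem eq_congr_fun {f g : Elt T τ (σ ⇒ₜ σ')} (h : w ≤ f ≣ g) (t : Elt T τ σ) : w ≤ f t ≣ g t := by
  have := subst (.var (.there .here) ⬝ .var (.there (.there .here)) ≐
    .var .here ⬝ .var (.there (.there .here))) (Env.cons f (Env.cons t Env.nil)) h
  simp only [tr_eq, ev_app, ev_var, cons_here, cons_there] at this
  exact this eq_rfl

theorem eq_mp {p q : Elt T τ .omega} (h : w ≤ p ≣ q) (hp : w ≤ p) : w ≤ q := by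
  have := subst (.var .here) Env.nil h
  simp only [ev_var, cons_here] at this
  exact this hp

theorem mem_congr (A : Elt T τ σ.pow) {s t : Elt T τ σ} (h : w ≤ s ≣ t) (hs : w ≤ A s) : w ≤ A t :=
  eq_mp (eq_congr A h) hs

theorem mem_congr_set {A B : Elt T τ σ.pow} (h : w ≤ A ≣ B) {t : Elt T τ σ} (ht : w ≤ A t) :
    w ≤ B t :=
  eq_mp (eq_congr_fun h t) ht

theorem set_ext [Nonempty (Tm [τ] σ)] {A B : Elt T τ σ.pow} (h₁ : ∀ x, ∀ v ≤ w, v ≤ A x → v ≤ B x)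
    (h₂ : ∀ x, ∀ v ≤ w, v ≤ B x → v ≤ A x) : w ≤ A ≣ B :=
  (le_iInf fun x => (le_inf (impI (h₁ x)) (impI (h₂ x))).trans (eq_propext _ _)).trans
    (eq_funext _ _)

/-- The function that maps `n` to its successor. -/
noncomputable def succFun : Elt T τ (.nat ⇒ₜ .nat) := const (Lam .nat fun n => .succ n)

theorem succFun_apply (n : Elt T τ .nat) : succFun n = succ n := by simp [succFun, const, Lam]

theorem succ_congr {m n : Elt T τ .nat} (h : w ≤ m ≣ n) : w ≤ succ m ≣ succ n := by
  simpa [succFun_apply] using eq_congr succFun h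

theorem succ_inj {m n : Elt T τ .nat} (h : w ≤ succ m ≣ succ n) : w ≤ m ≣ n :=
  h.trans (succ_eq_succ ..)

theorem zero_ne_succ {p : Truth T τ} {n : Elt T τ .nat} (h : w ≤ zero ≣ succ n) : w ≤ p :=
  (h.trans (zero_eq_succ n).le).trans bot_le

theorem nat_ind (A : Elt T τ Ty.nat.pow) (h₀ : w ≤ A zero)
    (h₁ : ∀ n, ∀ v ≤ w, v ≤ A n → v ≤ A (succ n)) (n : Elt T τ .nat) : w ≤ A n :=
  allE ((le_inf h₀ (le_iInf fun n => impI (h₁ n))).trans (induction A)) n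

/-- The number one. -/
noncomputable def one : Elt T τ .nat := succ zero

@[simp] theorem ev_one (ρ : Env (Elt T τ) Γ) : ev IHOL.one ρ = one := by simp [IHOL.one, one]

theorem zero_ne_one {p : Truth T τ} (h : w ≤ zero ≣ one) : w ≤ p := zero_ne_succ h

theorem nat_cases (n : Elt T τ .nat) : w ≤ n ≣ zero ⊔ ⨆ m, n ≣ succ m := by
  -- Induction and choice apply only to sets and relations that are elements of the model. Hence the
  -- predicate is first written as a closed term, applied to the needed elements, and then
  -- evaluated; this pattern recurs throughout.
  let A : Elt T τ Ty.nat.pow := const (Lam .nat fun n => n ≐ .zero ∨' Ex .nat fun m => ↑n ≐ .succ m)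
  have hA n : tr (A n) = n ≣ zero ⊔ ⨆ m, n ≣ succ m := by simp [A, const, Lam, Ex]
  rw [← hA]
  refine nat_ind A ?_ (fun n v _ _ => ?_) n
  · rw [hA]; exact orI₁ eq_rfl
  · rw [hA]; exact orI₂ (exI n eq_rfl)

theorem nat_dec_eq (m n : Elt T τ .nat) : w ≤ m ≣ n ⊔ (m ≣ n)ᶜ := by
  let A : Elt T τ Ty.nat.pow := const (Lam .nat fun m => All .nat fun n => ↑m ≐ n ∨' ¬' (↑m ≐ n))
  have hA m : tr (A m) = ⨅ n, (m ≣ n ⊔ (m ≣ n)ᶜ) := by simp [A, const, Lam, All, Tm.neg]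
  refine allE (F := fun n => m ≣ n ⊔ (m ≣ n)ᶜ) ?_ n
  rw [← hA]
  refine nat_ind A ?_ (fun m v _ h => ?_) m
  · rw [hA]
    refine le_iInf fun n => orE (nat_cases n) (fun v _ h => orI₁ (eq_symm h)) fun v _ h => ?_
    refine exE h fun k u _ h => orI₂ (notI fun t ht h' => ?_)
    exact zero_ne_succ (eq_trans h' (ht.trans h))
  · rw [hA] at h ⊢
    refine le_iInf fun n => orE (nat_cases n) (fun u _ h => ?_) fun u hu h' => ?_
    · exact orI₂ (notI fun t ht h' => zero_ne_succ (eq_symm (eq_trans h' (ht.trans h))))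
    · refine exE h' fun k t ht hk => orE (ht.trans (hu.trans (allE h k))) (fun s hs e => ?_)
        fun s hs e => ?_
      · exact orI₁ (eq_trans (succ_congr e) (eq_symm (hs.trans hk)))
      · refine orI₂ (notI fun r hr e' => notE (hr.trans e) (succ_inj (eq_trans e' ?_)))
        exact hr.trans (hs.trans hk)

end Elt

end InternalLogic

namespace Elt

/-! ### Order and pairing on the natural numbers of the model -/

section Arithmetic

variable {S : Type u} {T : Set (Fm ([] : Ctx S))} {τ : Ty S} {σ : Ty S} {w : Truth T τ}

attribute [local simp] const Lam All Ex mem Tm.neg Tm.iff empty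

/-- The function defined by primitive recursion. -/
noncomputable def recFun (z : Elt T τ σ) (s : Elt T τ (.nat ⇒ₜ σ ⇒ₜ σ)) : Elt T τ (.nat ⇒ₜ σ) :=
  const (Lam σ fun z => Lam (.nat ⇒ₜ σ ⇒ₜ σ) fun s => Lam .nat fun n => .natrec z.wk.wk s.wk n) z s

@[simp] theorem recFun_apply (z : Elt T τ σ) (s : Elt T τ (.nat ⇒ₜ σ ⇒ₜ σ)) (n : Elt T τ .nat) :
    recFun z s n = natrec z s n := by simp [recFun]

theorem natrec_congr {z : Elt T τ σ} {s : Elt T τ (.nat ⇒ₜ σ ⇒ₜ σ)} {m n : Elt T τ .nat}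
    (h : w ≤ m ≣ n) : w ≤ natrec z s m ≣ natrec z s n := by
  simpa using eq_congr (recFun z s) h

/-- The set of natural numbers below a given one. -/
noncomputable def below : Elt T τ (.nat ⇒ₜ Ty.nat.pow) := recFun (const empty)
  (const (Lam .nat fun k => Lam Ty.nat.pow fun s => Lam .nat fun j => ↑s ⬝ j ∨' j ≐ ↑k))

@[simp] theorem below_zero (j : Elt T τ .nat) : tr (below zero j) = ⊥ := by simp [below]

@[simp] theorem below_succ (k j : Elt T τ .nat) :
    tr (below (succ k) j) = tr (below k j) ⊔ j ≣ k := by simp [below]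

theorem below_congr {k k' j j' : Elt T τ .nat} (hk : w ≤ k ≣ k') (hj : w ≤ j ≣ j')
    (h : w ≤ below k j) : w ≤ below k' j' :=
  mem_congr _ hj (mem_congr_set (eq_congr below hk) h)

theorem below_trichotomy (k j : Elt T τ .nat) : w ≤ tr (below k j) ⊔ (j ≣ k ⊔ tr (below j k)) := by
  -- Two auxiliary inductions: `Z` shows that zero is below every successor (base case), `U` that `k
  -- < j` implies `k + 1 = j` or `k + 1 < j` (successor case).
  let Z : Elt T τ Ty.nat.pow := const
    (Lam (.nat ⇒ₜ Ty.nat.pow) fun b => Lam .nat fun j => ↑b ⬝ .succ j ⬝ .zero) below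
  have hZ j : tr (Z j) = tr (below (succ j) zero) := by simp [Z]
  let U : Elt T τ Ty.nat.pow := const (Lam (.nat ⇒ₜ Ty.nat.pow) fun b => Lam .nat fun k => Lam .nat
    fun j => (b.wk.wk ⬝ j ⬝ ↑k) ⇒ .succ ↑k ≐ j ∨' (b.wk.wk ⬝ j ⬝ .succ ↑k)) below k
  have hU k j : tr (const (Lam (.nat ⇒ₜ Ty.nat.pow) fun b => Lam .nat fun k => Lam .nat
    fun j => (b.wk.wk ⬝ j ⬝ ↑k) ⇒ .succ ↑k ≐ j ∨' (b.wk.wk ⬝ j ⬝ .succ ↑k)) below k j : Elt T τ _) =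
    tr (below j k) ⇨ (succ k ≣ j ⊔ tr (below j (succ k))) := by simp
  let A : Elt T τ Ty.nat.pow := const (Lam (.nat ⇒ₜ Ty.nat.pow) fun b => Lam .nat fun k =>
    All .nat fun j => (b.wk.wk ⬝ ↑k ⬝ j) ∨' (j ≐ ↑k) ∨' (b.wk.wk ⬝ j ⬝ ↑k)) below
  have hA k : tr (A k) = ⨅ j, (tr (below k j) ⊔ (j ≣ k ⊔ tr (below j k))) := by simp [A]
  refine allE (F := fun j => tr (below k j) ⊔ (j ≣ k ⊔ tr (below j k))) ?_ j
  rw [← hA]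
  refine nat_ind A ?_ (fun k v _ h => ?_) k
  · rw [hA]
    refine le_iInf fun j => orE (nat_cases j) (fun v _ h => orI₂ (orI₁ h)) fun v _ h => ?_
    refine exE h fun m u _ e => orI₂ (orI₂ (below_congr (eq_symm e) eq_rfl ?_))
    rw [← hZ]
    refine nat_ind Z ?_ (fun n v _ h => ?_) m
    · rw [hZ, below_succ]; exact orI₂ eq_rfl
    · rw [hZ] at h ⊢; rw [below_succ]; exact orI₁ h
  · rw [hA] at h ⊢
    refine le_iInf fun j => orE (allE h j) (fun u _ h => ?_) fun u _ h => orE h (fun t _ h => ?_) ?_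
    · rw [below_succ]; exact orI₁ (orI₁ h)
    · rw [below_succ]; exact orI₁ (orI₂ h)
    · intro t _ h
      refine orI₂ ((mp ?_ h).trans (sup_le_sup_right (eq_symm le_rfl) _))
      rw [← hU]
      refine nat_ind _ ?_ (fun n v _ h => ?_) j
      · rw [hU, below_zero, bot_himp]; exact le_top
      · rw [hU] at h ⊢
        rw [below_succ, below_succ]
        refine impI fun t ht h' => orE h' (fun s hs h' => ?_) fun s _ h' => orI₁ (succ_congr h')
        exact orE (mp ((hs.trans ht).trans h) h') (fun r _ h => orI₂ (orI₂ h))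
          fun r _ h => orI₂ (orI₁ h)

/-- The pair that follows `(0, b)` in the enumeration of the pairs of natural numbers. -/
noncomputable def pairNextZero : Elt T τ ((.nat ⇒ₜ .nat) ⇒ₜ .nat ⇒ₜ .nat) :=
  const (Lam (.nat ⇒ₜ .nat) fun s => Lam .nat fun i =>
    .natrec (.succ (↑s ⬝ IHOL.one)) (Lam .nat fun _ => Lam .nat fun _ => .zero) i)

/-- The pair that follows `(a + 1, b)` in the enumeration of the pairs of natural numbers. -/
noncomputable def pairNextSucc :
    Elt T τ ((.nat ⇒ₜ .nat) ⇒ₜ .nat ⇒ₜ (.nat ⇒ₜ .nat) ⇒ₜ .nat ⇒ₜ .nat) :=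
  const (Lam (.nat ⇒ₜ .nat) fun s => Lam .nat fun a => Lam (.nat ⇒ₜ .nat) fun _ => Lam .nat fun i =>
    .natrec a.wk.wk (Lam .nat fun _ => Lam .nat fun _ => .succ (s.wk.wk.wk.wk.wk ⬝ IHOL.one)) i)

/-- One step in the enumeration of the pairs of natural numbers. -/
noncomputable def pairStep : Elt T τ (.nat ⇒ₜ (.nat ⇒ₜ .nat) ⇒ₜ .nat ⇒ₜ .nat) :=
  const (Lam ((.nat ⇒ₜ .nat) ⇒ₜ .nat ⇒ₜ .nat) fun z =>
    Lam ((.nat ⇒ₜ .nat) ⇒ₜ .nat ⇒ₜ (.nat ⇒ₜ .nat) ⇒ₜ .nat ⇒ₜ .nat) fun r =>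
      Lam .nat fun _ => Lam (.nat ⇒ₜ .nat) fun s =>
        .natrec (z.wk.wk.wk ⬝ s) (r.wk.wk ⬝ s) (s ⬝ .zero)) pairNextZero pairNextSucc

/-- The `k`-th pair `(a, b)` of natural numbers, as a map with `0 ↦ a` and `1 ↦ b`. -/
noncomputable def pair : Elt T τ (.nat ⇒ₜ .nat ⇒ₜ .nat) :=
  recFun (const (Lam .nat fun _ => .zero)) pairStep

/-- The first component of the `k`-th pair of natural numbers. -/
noncomputable def fst : Elt T τ (.nat ⇒ₜ .nat) :=
  const (Lam (.nat ⇒ₜ .nat ⇒ₜ .nat) fun p => Lam .nat fun k => ↑p ⬝ k ⬝ .zero) pair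

/-- The second component of the `k`-th pair of natural numbers. -/
noncomputable def snd : Elt T τ (.nat ⇒ₜ .nat) :=
  const (Lam (.nat ⇒ₜ .nat ⇒ₜ .nat) fun p => Lam .nat fun k => ↑p ⬝ k ⬝ IHOL.one) pair

theorem fst_eq (k : Elt T τ .nat) : fst k = pair k zero := by simp [fst]

theorem snd_eq (k : Elt T τ .nat) : snd k = pair k one := by simp [snd]

theorem fst_zero : (fst zero : Elt T τ .nat) = zero := by simp [fst_eq, pair]

theorem snd_zero : (snd zero : Elt T τ .nat) = zero := by simp [snd_eq, pair]

/-- There are no product types, so a pair is a function evaluated at zero and one. The enumeration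
walks along antidiagonals: `(a + 1, b)` is followed by `(a, b + 1)`, and `(0, b)` by `(b + 1, 0)`.
-/
theorem pair_succ (k : Elt T τ .nat) : pair (succ k) =
    natrec (pairNextZero (pair k)) (pairNextSucc (pair k)) (pair k zero) := by
  rw [pair, recFun_apply, natrec_succ, ← recFun_apply, ← pair]
  simp [pairStep]

theorem pair_succ_of_zero {k : Elt T τ .nat} (h : w ≤ fst k ≣ zero) :
    w ≤ fst (succ k) ≣ succ (snd k) ∧ w ≤ snd (succ k) ≣ zero := by
  have e i := eq_congr_fun (natrec_congr (z := pairNextZero (pair k))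
    (s := pairNextSucc (pair k)) (fst_eq k ▸ h)) i
  simp only [← pair_succ, natrec_zero] at e
  have e0 := e zero
  have e1 := e one
  simp only [← fst_eq, ← snd_eq, pairNextZero] at e0 e1
  refine ⟨by simpa [snd_eq] using e0, by simpa [one] using e1⟩

theorem pair_succ_of_succ {k a : Elt T τ .nat} (h : w ≤ fst k ≣ succ a) :
    w ≤ fst (succ k) ≣ a ∧ w ≤ snd (succ k) ≣ succ (snd k) := by
  have e i := eq_congr_fun (natrec_congr (z := pairNextZero (pair k))
    (s := pairNextSucc (pair k)) (fst_eq k ▸ h)) i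
  simp only [← pair_succ, natrec_succ] at e
  have e0 := e zero
  have e1 := e one
  simp only [← fst_eq, ← snd_eq, pairNextSucc] at e0 e1
  refine ⟨by simpa using e0, by simpa [one, snd_eq] using e1⟩

/-- Addition, by recursion on the first argument. -/
noncomputable def add : Elt T τ (.nat ⇒ₜ .nat ⇒ₜ .nat) := recFun (const (Lam .nat fun b => b))
  (const (Lam .nat fun _ => Lam (.nat ⇒ₜ .nat) fun g => Lam .nat fun b => ↑g ⬝ .succ b))

@[simp] theorem zero_add (b : Elt T τ .nat) : add zero b = b := by simp [add]

@[simp] theorem succ_add (a b : Elt T τ .nat) : add (succ a) b = add a (succ b) := by simp [add]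

theorem add_succ (a b : Elt T τ .nat) : w ≤ add a (succ b) ≣ succ (add a b) := by
  let A : Elt T τ Ty.nat.pow := const (Lam (.nat ⇒ₜ .nat ⇒ₜ .nat) fun p => Lam .nat fun a =>
    All .nat fun b => p.wk.wk ⬝ ↑a ⬝ .succ b ≐ .succ (p.wk.wk ⬝ ↑a ⬝ b)) add
  have hA a : tr (A a) = ⨅ b, add a (succ b) ≣ succ (add a b) := by simp [A]
  refine allE (F := fun b => add a (succ b) ≣ succ (add a b)) ?_ b
  rw [← hA]
  refine nat_ind A ?_ (fun a v _ h => ?_) a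
  · rw [hA]; exact le_iInf fun b => eq_of_eq (by simp)
  · rw [hA] at h ⊢; exact le_iInf fun b => by simpa using allE h (succ b)

theorem add_zero (a : Elt T τ .nat) : w ≤ add a zero ≣ a := by
  let A : Elt T τ Ty.nat.pow := const (Lam (.nat ⇒ₜ .nat ⇒ₜ .nat) fun p => Lam .nat fun a =>
    ↑p ⬝ a ⬝ .zero ≐ a) add
  have hA a : tr (A a) = add a zero ≣ a := by simp [A]
  rw [← hA]
  refine nat_ind A ?_ (fun a v _ h => ?_) a
  · rw [hA]; exact eq_of_eq (by simp)
  · rw [hA] at h ⊢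
    exact eq_trans (eq_of_eq (succ_add a zero)) (eq_trans (add_succ a zero) (succ_congr h))

/-- The pair `(a, b)` occurs in the enumeration of the pairs of natural numbers. -/
noncomputable def Reach (a b : Elt T τ .nat) : Truth T τ := ⨆ k, (fst k ≣ a ⊓ snd k ≣ b)

theorem reach_congr {a a' b b' : Elt T τ .nat} (ha : w ≤ a ≣ a') (hb : w ≤ b ≣ b')
    (h : w ≤ Reach a b) : w ≤ Reach a' b' :=
  exE h fun k _ hv h => exI k (le_inf (eq_trans (andE₁ h) (hv.trans ha))
    (eq_trans (andE₂ h) (hv.trans hb)))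

theorem reach_succ_of_reach_zero {b : Elt T τ .nat} (h : w ≤ Reach zero b) :
    w ≤ Reach (succ b) zero :=
  exE h fun k _ _ h => exI (succ k) (le_inf
    (eq_trans (pair_succ_of_zero (andE₁ h)).1 (succ_congr (andE₂ h)))
    (pair_succ_of_zero (andE₁ h)).2)

theorem reach_of_reach_succ {a b : Elt T τ .nat} (h : w ≤ Reach (succ a) b) :
    w ≤ Reach a (succ b) :=
  exE h fun k _ _ h => exI (succ k) (le_inf (pair_succ_of_succ (andE₁ h)).1
    (eq_trans (pair_succ_of_succ (andE₁ h)).2 (succ_congr (andE₂ h))))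

/-- The binary relation `Reach` on natural numbers. -/
noncomputable def reachRel : Elt T τ (.nat ⇒ₜ Ty.nat.pow) :=
  const (Lam (.nat ⇒ₜ .nat) fun l => Lam (.nat ⇒ₜ .nat) fun r => Lam .nat fun a => Lam .nat fun b =>
    Ex .nat fun k => l.wk.wk.wk.wk ⬝ k ≐ a.wk.wk ∧' r.wk.wk.wk ⬝ k ≐ b) fst snd

theorem tr_reachRel (a b : Elt T τ .nat) : tr (reachRel a b) = Reach a b := by
  simp [reachRel, Reach]

theorem reach_add {a b : Elt T τ .nat} (h : w ≤ Reach a b) : w ≤ Reach zero (add a b) := by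
  let A : Elt T τ Ty.nat.pow := const (Lam (.nat ⇒ₜ .nat ⇒ₜ .nat) fun p =>
    Lam (.nat ⇒ₜ Ty.nat.pow) fun r => Lam .nat fun a => All .nat fun b =>
      r.wk.wk ⬝ ↑a ⬝ b ⇒ r.wk.wk ⬝ .zero ⬝ (p.wk.wk.wk ⬝ ↑a ⬝ b)) add reachRel
  have hA a : tr (A a) = ⨅ b, (Reach a b ⇨ Reach zero (add a b)) := by simp [A, tr_reachRel]
  refine mp (allE (F := fun b => Reach a b ⇨ Reach zero (add a b)) ?_ b) h
  rw [← hA]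
  refine nat_ind A ?_ (fun a v _ h => ?_) a
  · rw [hA]; exact le_iInf fun b => impI fun v _ h => by simpa using h
  · rw [hA] at h ⊢
    refine le_iInf fun b => impI fun u hu h' => ?_
    rw [succ_add]
    exact mp (allE (hu.trans h) (succ b)) (reach_of_reach_succ h')

/-- From `(a, 0)` the walk descends to `(0, a)` and then jumps to `(a + 1, 0)`, so every
antidiagonal is entered. Induction on `b` then reaches `(a, b + 1)` from `(a + 1, b)`. -/
theorem reach (a b : Elt T τ .nat) : w ≤ Reach a b := by
  let A : Elt T τ Ty.nat.pow :=
    const (Lam (.nat ⇒ₜ Ty.nat.pow) fun r => Lam .nat fun a => ↑r ⬝ a ⬝ .zero) reachRel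
  have hA a : tr (A a) = Reach a zero := by simp [A, tr_reachRel]
  let B : Elt T τ Ty.nat.pow := const (Lam (.nat ⇒ₜ Ty.nat.pow) fun r => Lam .nat fun b =>
    All .nat fun a => r.wk.wk ⬝ a ⬝ ↑b) reachRel
  have hB b : tr (B b) = ⨅ a, Reach a b := by simp [B, tr_reachRel]
  refine allE (F := fun a => Reach a b) ?_ a
  rw [← hB]
  refine nat_ind B ?_ (fun b v _ h => ?_) b
  · rw [hB]
    refine le_iInf fun a => ?_
    rw [← hA]
    refine nat_ind A ?_ (fun a v _ h => ?_) a
    · rw [hA]; exact exI zero (le_inf (eq_of_eq fst_zero) (eq_of_eq snd_zero))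
    · rw [hA] at h ⊢
      exact reach_succ_of_reach_zero (reach_congr eq_rfl (add_zero a) (reach_add h))
  · rw [hB] at h ⊢
    exact le_iInf fun a => reach_of_reach_succ (allE h (succ a))

/-- Every pair of natural numbers occurs in the enumeration. -/
theorem exists_pair (a b : Elt T τ .nat) : w ≤ ⨆ k, (fst k ≣ a ⊓ snd k ≣ b) := reach a b

end Arithmetic

end Elt

namespace Elt

/-! ### Truth values of semidecidability, overtness and countability -/

section Semidecidable

variable {S : Type u} {T : Set (Fm ([] : Ctx S))} {τ : Ty S} {Γ : Ctx S} {σ : Ty S} {w : Truth T τ}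

attribute [local simp] const Lam All Ex mem Tm.neg Tm.iff

/-- The truth value of "`f` is a binary sequence". -/
noncomputable def Binary (f : Elt T τ (.nat ⇒ₜ .nat)) : Truth T τ :=
  ⨅ n, (f n ≣ zero ⊔ f n ≣ one)

@[simp] theorem tr_binary (f : Tm Γ (.nat ⇒ₜ .nat)) (ρ : Env (Elt T τ) Γ) :
    tr (ev (binary f) ρ) = Binary (ev f ρ) := by simp [binary, Binary]

/-- The truth value of "`p` is semidecidable". -/
noncomputable def Semidec (p : Truth T τ) : Truth T τ :=
  ⨆ f : Elt T τ (.nat ⇒ₜ .nat), Binary f ⊓ ((p ⇨ ⨆ n, f n ≣ one) ⊓ ((⨆ n, f n ≣ one) ⇨ p))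

@[simp] theorem tr_semidec (p : Fm Γ) (ρ : Env (Elt T τ) Γ) :
    tr (ev (semidec p) ρ) = Semidec (tr (ev p ρ)) := by simp [semidec, Semidec]

@[simp] theorem tr_subset [Nonempty (Tm [τ] σ)] (A B : Tm Γ σ.pow) (ρ : Env (Elt T τ) Γ) :
    tr (ev (A ⊆' B) ρ) = ⨅ x, (tr ((ev A ρ) x) ⇨ tr ((ev B ρ) x)) := by simp [subset]

@[simp] theorem tr_semidecSubset [Nonempty (Tm [τ] σ)] (X A : Tm Γ σ.pow) (ρ : Env (Elt T τ) Γ) :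
    tr (ev (semidecSubset X A) ρ) = (⨅ x, (tr ((ev A ρ) x) ⇨ tr ((ev X ρ) x))) ⊓
      ⨅ x, (tr ((ev X ρ) x) ⇨ Semidec (tr ((ev A ρ) x))) := by simp [semidecSubset]

@[simp] theorem tr_overtSubset [Nonempty (Tm [τ] σ)] (X A : Tm Γ σ.pow) (ρ : Env (Elt T τ) Γ) :
    tr (ev (overtSubset X A) ρ) = (⨅ x, (tr ((ev A ρ) x) ⇨ tr ((ev X ρ) x))) ⊓
      ⨅ q : Elt T τ σ.pow, ((⨅ x, (tr ((ev X ρ) x) ⇨ Semidec (tr (q x)))) ⇨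
        Semidec (⨆ x, (tr ((ev A ρ) x) ⊓ tr (q x)))) := by simp [overtSubset]

/-- The singleton of `x`. -/
noncomputable def singleton (x : Elt T τ σ) : Elt T τ σ.pow :=
  ev (IHOL.singleton (.var .here)) (Env.cons x Env.nil)

@[simp] theorem ev_singleton (x : Tm Γ σ) (ρ : Env (Elt T τ) Γ) :
    ev (IHOL.singleton x) ρ = singleton (ev x ρ) := by
  refine (ev_sub (IHOL.singleton (.var .here)) (Env.cons (F := Tm Γ) x Env.nil) ρ).trans ?_
  rw [ev_env_cons, ev_env_nil, singleton]

@[simp] theorem tr_singleton (x y : Elt T τ σ) : tr ((singleton x) y) = y ≣ x := by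
  simp [singleton, IHOL.singleton]

@[simp] theorem ev_empty (ρ : Env (Elt T τ) Γ) :
    ev (empty : Tm Γ σ.pow) ρ = const empty := by
  refine (ev_sub empty Env.nil ρ).trans ?_
  rw [ev_env_nil, const]

theorem congr_singleton {x y : Elt T τ σ} (h : w ≤ x ≣ y) : w ≤ singleton x ≣ singleton y := by
  have := subst (IHOL.singleton (.var (.there .here)) ≐ IHOL.singleton (.var .here))
    (Env.cons x Env.nil) h
  simp only [tr_eq, ev_singleton, ev_var, cons_here, cons_there] at this
  exact this eq_rfl

theorem tr_empty (y : Elt T τ σ) : tr ((const empty : Elt T τ σ.pow) y) = ⊥ := by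
  simp [empty]

/-- The truth value of "`A` is countable". -/
noncomputable def Countable (A : Elt T τ σ.pow) : Truth T τ :=
  ⨆ e : Elt T τ (.nat ⇒ₜ σ.pow), (⨅ n, (e n ≣ const empty ⊔ ⨆ x, (tr (A x) ⊓ e n ≣ singleton x))) ⊓
    ((⨆ n, e n ≣ const empty) ⊓ ⨅ x, (tr (A x) ⇨ ⨆ n, e n ≣ singleton x))

@[simp] theorem tr_countable [Nonempty (Tm [τ] σ)] (A : Tm Γ σ.pow) (ρ : Env (Elt T τ) Γ) :
    tr (ev (countable A) ρ) = Countable (ev A ρ) := by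
  simp [-const, countable, Countable]

end Semidecidable

/-! ### Semidecidable and countable sets under Countable Choice and Markov's principle -/

section Axioms

variable {S : Type u} {τ : Ty S} {σ : Ty S}

local notation "𝔼" => Elt SyntheticComputability

variable {w p q : Truth SyntheticComputability τ}

attribute [local simp] const Lam All Ex mem Tm.neg Tm.iff

theorem choice [Nonempty (Tm [τ] σ)] (R : 𝔼 τ (.nat ⇒ₜ σ.pow)) (h : ∀ n, w ≤ ⨆ x, tr (R n x)) :
    w ≤ ⨆ f : 𝔼 τ (.nat ⇒ₜ σ), ⨅ n, tr (R n (f n)) := by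
  have := tr_const_of_mem (T := SyntheticComputability) (τ := τ) (.choice σ)
  simp only [countableChoice, const, All, tr_all, tr_imp, tr_ex, mem, ev_app, ev_wk, ev_var,
    cons_here, Ex, iInf_eq_top] at this
  exact mp (le_top.trans_eq (this R).symm) (le_iInf h)

theorem markov (f : 𝔼 τ (.nat ⇒ₜ .nat)) (hf : w ≤ Binary f) (h : w ≤ (⨅ n, f n ≣ zero)ᶜ) :
    w ≤ ⨆ n, f n ≣ one := by
  have := tr_const_of_mem (T := SyntheticComputability) (τ := τ) .markov
  simp only [markovPrinciple, const, All, tr_all, tr_imp, tr_ex, ev_app, ev_wk, ev_var,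
    cons_here, Ex, iInf_eq_top, Tm.neg, tr_falsum, himp_bot, tr_eq, ev_zero, ev_one, tr_binary]
    at this
  exact mp (mp (le_top.trans_eq (this f).symm) hf) h

/-- A decidable family of statements about numbers makes a semidecidable one. -/
theorem semidecI (d : 𝔼 τ Ty.nat.pow) (hd : ∀ n, w ≤ tr (d n) ⊔ (tr (d n))ᶜ)
    (h₁ : w ≤ p ⇨ ⨆ n, tr (d n)) (h₂ : w ≤ (⨆ n, tr (d n)) ⇨ p) : w ≤ Semidec p := by
  -- The graph of the characteristic function of `d`; choice turns it into a binary sequence.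
  let R : 𝔼 τ (.nat ⇒ₜ Ty.nat.pow) := const (Lam Ty.nat.pow fun d => Lam .nat fun n => Lam .nat fun i =>
    (i ≐ IHOL.one ∧' d.wk.wk ⬝ ↑n) ∨' (i ≐ .zero ∧' ¬' (d.wk.wk ⬝ ↑n))) d
  have hR n i : tr (R n i) = i ≣ one ⊓ tr (d n) ⊔ i ≣ zero ⊓ (tr (d n))ᶜ := by simp [R]
  refine exE (choice R fun n => ?_) fun f v hv hf => ?_
  · simp only [hR]
    refine orE (hd n) (fun v _ h => exI one (orI₁ (le_inf eq_rfl h))) fun v _ h => ?_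
    exact exI zero (orI₂ (le_inf eq_rfl h))
  · simp only [hR] at hf
    refine exI f (le_inf (le_iInf fun n => ?_) (le_inf (impI fun u hu hp => ?_)
      (impI fun u hu hp => ?_)))
    · exact orE (allE hf n) (fun u _ h => orI₂ (andE₁ h)) fun u _ h => orI₁ (andE₁ h)
    · refine exE (mp (hu.trans (hv.trans h₁)) hp) fun n t ht hn => exI n ?_
      exact orE (ht.trans (hu.trans (allE hf n))) (fun s _ h => andE₁ h)
        fun s hs h => notE (andE₂ h) (hs.trans hn)
    · refine mp (hu.trans (hv.trans h₂)) (exE hp fun n t ht hn => exI n ?_)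
      exact orE (ht.trans (hu.trans (allE hf n))) (fun s _ h => andE₂ h)
        fun s hs h => zero_ne_one (eq_trans (eq_symm (andE₁ h)) (hs.trans hn))

theorem semidecE (h : w ≤ Semidec p) (h₁ : ∀ d : 𝔼 τ Ty.nat.pow, ∀ v ≤ w,
    (∀ n, v ≤ tr (d n) ⊔ (tr (d n))ᶜ) → v ≤ p ⇨ ⨆ n, tr (d n) → v ≤ (⨆ n, tr (d n)) ⇨ p → v ≤ q) :
    w ≤ q := by
  refine exE h fun f v hv hf => ?_
  let d : 𝔼 τ Ty.nat.pow := const (Lam (.nat ⇒ₜ .nat) fun f => Lam .nat fun n => ↑f ⬝ n ≐ IHOL.one) f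
  have hd n : tr (d n) = f n ≣ one := by simp [d]
  refine h₁ d v hv (fun n => ?_) ?_ ?_
  · rw [hd]; exact nat_dec_eq _ _
  · simp only [hd]; exact andE₁ (andE₂ hf)
  · simp only [hd]; exact andE₂ (andE₂ hf)

theorem semidec_congr (h : w ≤ Semidec p) (h₁ : w ≤ p ⇨ q) (h₂ : w ≤ q ⇨ p) : w ≤ Semidec q := by
  refine semidecE h fun d v hv hd hp hp' => semidecI d hd (impI fun u hu h => ?_)
    (impI fun u hu h => ?_)
  · exact mp (hu.trans hp) (mp (hu.trans (hv.trans h₂)) h)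
  · exact mp (hu.trans (hv.trans h₁)) (mp (hu.trans hp') h)

theorem semidec_of_true (h : w ≤ p) : w ≤ Semidec p := by
  let d : 𝔼 τ Ty.nat.pow := const (Lam .nat fun n => n ≐ n)
  have hd n : tr (d n) = ⊤ := by simp [d, eq_refl]
  refine semidecI d (fun n => ?_) (impI fun u hu h => ?_) (impI fun u hu _ => hu.trans h)
  · rw [hd]; exact orI₁ le_top
  · simp only [hd]; exact exI zero le_top

theorem semidec_of_false (h : w ≤ pᶜ) : w ≤ Semidec p := by
  let d : 𝔼 τ Ty.nat.pow := const (Lam .nat fun n => .falsum)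
  have hd n : tr (d n) = ⊥ := by simp [d]
  refine semidecI d (fun n => ?_) (impI fun u hu hp => notE (hu.trans h) hp) (impI fun u hu hp => ?_)
  · rw [hd]; exact orI₂ (by rw [compl_bot]; exact le_top)
  · simp only [hd, iSup_bot] at hp; exact hp.trans bot_le

theorem semidec_of_dec (h : w ≤ p ⊔ pᶜ) : w ≤ Semidec p :=
  orE h (fun _ _ => semidec_of_true) fun _ _ => semidec_of_false

/-- Markov's principle in the form used below. With `stable_by_cases` it permits case distinctions
on arbitrary statements when the goal is semidecidable. -/
theorem semidec_stable (h : w ≤ Semidec p) (hp : w ≤ pᶜᶜ) : w ≤ p := by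
  refine exE h fun f v hv hf => mp (andE₂ (andE₂ hf)) (markov f (andE₁ hf) (notI fun u hu h0 => ?_))
  refine notE (hu.trans (hv.trans hp)) (notI fun t ht hp => ?_)
  refine exE (mp (ht.trans (hu.trans (andE₁ (andE₂ hf)))) hp) fun n s hs h1 => ?_
  exact zero_ne_one (eq_trans (eq_symm (hs.trans (ht.trans (allE h0 n)))) h1)

/-- Semidecidable statements about numbers are uniformly so. -/
theorem semidec_choice (P : 𝔼 τ Ty.nat.pow) (h : ∀ n, w ≤ Semidec (tr (P n)))
    (h₁ : ∀ F : 𝔼 τ (.nat ⇒ₜ Ty.nat.pow), ∀ v ≤ w, (∀ n k, v ≤ tr (F n k) ⊔ (tr (F n k))ᶜ) →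
      (∀ n, v ≤ tr (P n) ⇨ ⨆ k, tr (F n k)) → (∀ n, v ≤ (⨆ k, tr (F n k)) ⇨ tr (P n)) → v ≤ q) :
    w ≤ q := by
  let R : 𝔼 τ (.nat ⇒ₜ Ty.nat.pow.pow) := const (Lam Ty.nat.pow fun P => Lam .nat fun n =>
    Lam Ty.nat.pow fun d => (All .nat fun k => ↑d ⬝ k ∨' ¬' (↑d ⬝ k)) ∧'
      (P.wk.wk ⬝ ↑n ⇔ Ex .nat fun k => ↑d ⬝ k)) P
  have hR n d : tr (R n d) = (⨅ k, (tr (d k) ⊔ (tr (d k))ᶜ)) ⊓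
    ((tr (P n) ⇨ ⨆ k, tr (d k)) ⊓ ((⨆ k, tr (d k)) ⇨ tr (P n))) := by simp [R]
  refine exE (choice R fun n => ?_) fun F v hv hF => ?_
  · simp only [hR]
    exact semidecE (h n) fun d v _ hd h₁ h₂ => exI d (le_inf (le_iInf hd) (le_inf h₁ h₂))
  simp only [hR] at hF
  exact h₁ F v hv (fun n k => allE (andE₁ (allE hF n)) k) (fun n => andE₁ (andE₂ (allE hF n)))
    fun n => andE₂ (andE₂ (allE hF n))

/-- Dovetailing: step `k` runs the test for `fst k` at stage `snd k`. -/
theorem semidec_iSup (P : 𝔼 τ Ty.nat.pow) (h : ∀ n, w ≤ Semidec (tr (P n))) :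
    w ≤ Semidec (⨆ n, tr (P n)) := by
  refine semidec_choice P h fun F v hv hF hF₁ hF₂ => ?_
  let d : 𝔼 τ Ty.nat.pow := const (Lam (.nat ⇒ₜ .nat) fun l => Lam (.nat ⇒ₜ .nat) fun r =>
    Lam (.nat ⇒ₜ Ty.nat.pow) fun F => Lam .nat fun k => ↑F ⬝ (l.wk.wk.wk ⬝ k) ⬝ (r.wk.wk ⬝ k))
    fst snd F
  have hd k : tr (d k) = tr (F (fst k) (snd k)) := by simp [d]
  refine semidecI d (fun k => ?_) (impI fun u hu hp => ?_) (impI fun u hu hp => ?_)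
  · rw [hd]; exact hF (fst k) (snd k)
  · refine exE hp fun n t ht hp => ?_
    refine exE (mp (ht.trans (hu.trans (hF₁ n))) hp) fun m s hs hm => ?_
    refine exE (exists_pair n m) fun k r hr hk => exI k ?_
    rw [hd]
    exact mem_congr _ (eq_symm (andE₂ hk)) (mem_congr_set (eq_congr F (eq_symm (andE₁ hk)))
      (hr.trans hm))
  · refine exE hp fun k t ht hp => exI (fst k) ?_
    rw [hd] at hp
    exact mp (ht.trans (hu.trans (hF₂ (fst k)))) (exI (snd k) hp)

/-- The countable join of the sequence `p, q, q, …`. -/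
theorem semidec_sup (p q : 𝔼 τ .omega) (hp : w ≤ Semidec (tr p)) (hq : w ≤ Semidec (tr q)) :
    w ≤ Semidec (tr p ⊔ tr q) := by
  let P : 𝔼 τ Ty.nat.pow := const (Lam .omega fun p => Lam .omega fun q => Lam .nat fun n =>
    (n ≐ .zero ∧' p.wk.wk) ∨' (¬' (n ≐ .zero) ∧' q.wk)) p q
  have hP n : tr (P n) = n ≣ zero ⊓ tr p ⊔ (n ≣ zero)ᶜ ⊓ tr q := by simp [P]
  refine semidec_congr (semidec_iSup P fun n => ?_) (impI fun v hv h => ?_) (impI fun v hv h => ?_)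
  · rw [hP]
    refine orE (nat_dec_eq n zero) (fun v hv h => semidec_congr (hv.trans hp) ?_ ?_)
      fun v hv h => semidec_congr (hv.trans hq) ?_ ?_
    · exact impI fun u hu hp => orI₁ (le_inf (hu.trans h) hp)
    · exact impI fun u hu hp => orE hp (fun t ht h => andE₂ h)
        fun t ht h' => notE (andE₁ h') (ht.trans (hu.trans h))
    · exact impI fun u hu hp => orI₂ (le_inf (hu.trans h) hp)
    · exact impI fun u hu hp => orE hp
        (fun t ht h' => notE (ht.trans (hu.trans h)) (andE₁ h')) fun t ht h => andE₂ h
  · refine exE h fun n u hu h => ?_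
    rw [hP] at h
    exact sup_le_sup inf_le_right inf_le_right |> h.trans
  · refine orE h (fun u hu h => exI zero ?_) fun u hu h => exI one ?_
    · rw [hP]; exact orI₁ (le_inf eq_rfl h)
    · rw [hP]; exact orI₂ (le_inf (notI fun t _ h => zero_ne_one (eq_symm h)) h)

theorem semidec_inf_of_dec (hp : w ≤ p ⊔ pᶜ) (hq : w ≤ Semidec q) : w ≤ Semidec (p ⊓ q) := by
  refine orE hp (fun v hv h => semidec_congr (hv.trans hq) ?_ ?_) fun v hv h => semidec_of_false ?_
  · exact impI fun u hu hq => le_inf (hu.trans h) hq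
  · exact impI fun u hu hq => andE₂ hq
  · exact notI fun u hu h' => notE (hu.trans h) (andE₁ h')

/-- Enumerations of a set, in terms of elements. -/
theorem countableE [Nonempty (Tm [τ] σ)] {A : 𝔼 τ σ.pow} (h : w ≤ Countable A)
    (h₁ : ∀ e : 𝔼 τ (.nat ⇒ₜ σ.pow), ∀ v ≤ w, (∀ n, v ≤ (⨅ x, (tr (e n x))ᶜ) ⊔
      ⨆ x, (tr (A x) ⊓ ⨅ y, ((tr (e n y) ⇨ y ≣ x) ⊓ (y ≣ x ⇨ tr (e n y))))) →
      (∀ x, v ≤ tr (A x) ⇨ ⨆ n, tr (e n x)) → v ≤ q) : w ≤ q := by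
  refine exE h fun e v hv he => h₁ e v hv (fun n => ?_) fun x => ?_
  · refine orE (allE (andE₁ he) n) (fun u hu h => orI₁ (le_iInf fun x => notI fun t ht hx => ?_))
      fun u hu h => orI₂ (exE h fun x t ht h => exI x (le_inf (andE₁ h) (le_iInf fun y => ?_)))
    · exact (mem_congr_set (ht.trans h) hx).trans (tr_empty x).le
    · refine le_inf (impI fun s hs hy => ?_) (impI fun s hs hy => ?_)
      · exact tr_singleton x y ▸ mem_congr_set (hs.trans (andE₂ h)) hy
      · exact mem_congr_set (eq_symm (hs.trans (andE₂ h))) (tr_singleton x y ▸ hy)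
  · refine impI fun u hu hx => exE (mp (hu.trans (allE (andE₂ (andE₂ he)) x)) hx) fun n t _ h => ?_
    exact exI n (mem_congr_set (eq_symm h) (tr_singleton x x ▸ eq_rfl))

/-- Countable sets are overt: search along an enumeration. Each of its terms is known to be empty or
a singleton, so every single step is semidecidable. -/
theorem semidec_exists_mem_countable [Nonempty (Tm [τ] σ)] {A : 𝔼 τ σ.pow} (q : 𝔼 τ σ.pow)
    (hA : w ≤ Countable A) (h : ∀ x, w ≤ tr (A x) ⇨ Semidec (tr (q x))) :
    w ≤ Semidec (⨆ x, tr (A x) ⊓ tr (q x)) := by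
  refine countableE hA fun e v hv he he' => ?_
  let P : 𝔼 τ Ty.nat.pow := const (Lam (.nat ⇒ₜ σ.pow) fun e => Lam σ.pow fun A => Lam σ.pow fun q =>
    Lam .nat fun n => Ex σ fun x => e.wk.wk.wk.wk ⬝ ↑n ⬝ x ∧' A.wk.wk.wk ⬝ x ∧' q.wk.wk ⬝ x) e A q
  have hP n : tr (P n) = ⨆ x, tr (e n x) ⊓ (tr (A x) ⊓ tr (q x)) := by simp [P]
  refine semidec_congr (semidec_iSup P fun n => ?_) (impI fun u hu hp => ?_) (impI fun u hu hp => ?_)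
  · rw [hP]
    refine orE (he n) (fun u hu h => semidec_of_false (notI fun t ht hx => ?_)) fun u hu h' => ?_
    · exact exE hx fun x s hs hx => notE (hs.trans (ht.trans (allE h x))) (andE₁ hx)
    · refine exE h' fun x t ht hx => ?_
      refine semidec_congr (mp ((ht.trans (hu.trans hv)).trans (h x)) (andE₁ hx)) (impI fun s hs hq => ?_)
        (impI fun s hs hq => ?_)
      · exact exI x (le_inf (mp (andE₂ (allE (hs.trans (andE₂ hx)) x)) eq_rfl)
          (le_inf (hs.trans (andE₁ hx)) hq))
      · exact exE hq fun y r hr hy => mem_congr q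
          (mp (andE₁ (allE (hr.trans (hs.trans (andE₂ hx))) y)) (andE₁ hy)) (andE₂ (andE₂ hy))
  · refine exE hp fun n t ht hp => ?_
    rw [hP] at hp
    exact exE hp fun x s hs h => exI x (andE₂ h)
  · refine exE hp fun x t ht hx => exE (mp ((ht.trans hu).trans (he' x)) (andE₁ hx)) fun n s hs h => ?_
    exact exI n (by rw [hP]; exact exI x (le_inf h (hs.trans hx)))

/-- Overtness of `A`, tested on the decidable predicate "equal to `n`". -/
theorem semidec_mem_of_countable {A : 𝔼 τ Ty.nat.pow} (hA : w ≤ Countable A) (n : 𝔼 τ .nat) :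
    w ≤ Semidec (tr (A n)) := by
  let q : 𝔼 τ Ty.nat.pow := const (Lam .nat fun n => Lam .nat fun m => m ≐ ↑n) n
  have hq m : tr (q m) = m ≣ n := by simp [q]
  refine semidec_congr (semidec_exists_mem_countable q hA fun m => ?_) (impI fun v hv h => ?_)
    (impI fun v hv h => ?_)
  · exact impI fun v hv _ => semidec_of_dec (by rw [hq]; exact nat_dec_eq _ _)
  · refine exE h fun m u hu h => ?_
    rw [hq] at h
    exact mem_congr A (andE₂ h) (andE₁ h)
  · exact exI n (le_inf h (by rw [hq]; exact eq_rfl))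

/-- Converse of the preceding lemma, so that the Enumerability Axiom enumerates the semidecidable
sets of numbers. -/
theorem countable_of_semidec {V : 𝔼 τ Ty.nat.pow} (h : ∀ n, w ≤ Semidec (tr (V n))) :
    w ≤ Countable V := by
  refine semidec_choice V h fun F v hv hF hF₁ hF₂ => ?_
  -- At `j + 1` the enumeration lists `fst j` if its membership is confirmed at stage `snd j`, and
  -- is empty otherwise. It is empty at zero because a surjection onto `1 + V` must also hit the
  -- added element.
  let e : 𝔼 τ (.nat ⇒ₜ Ty.nat.pow) := const (Lam (.nat ⇒ₜ .nat) fun l => Lam (.nat ⇒ₜ .nat) fun r =>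
    Lam (.nat ⇒ₜ Ty.nat.pow) fun F => Lam .nat fun k => Lam .nat fun y => Ex .nat fun j =>
      k.wk.wk ≐ .succ j ∧' y.wk ≐ l.wk.wk.wk.wk.wk ⬝ j ∧'
        F.wk.wk.wk ⬝ (l.wk.wk.wk.wk.wk ⬝ j) ⬝ (r.wk.wk.wk.wk ⬝ j)) fst snd F
  have he k y : tr (e k y) = ⨆ j, k ≣ succ j ⊓ (y ≣ fst j ⊓ tr (F (fst j) (snd j))) := by simp [e]
  have key {u : Truth SyntheticComputability τ} {k j : 𝔼 τ .nat} (hk : u ≤ k ≣ succ j)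
      (hj : u ≤ F (fst j) (snd j)) :
      u ≤ e k ≣ singleton (fst j) := by
    refine set_ext (fun y t ht h => ?_) fun y t ht h => ?_
    · rw [he] at h
      rw [tr_singleton]
      refine exE h fun i s hs h => eq_trans (andE₁ (andE₂ h)) (eq_congr _ (succ_inj ?_))
      exact eq_trans (eq_symm (andE₁ h)) ((hs.trans ht).trans hk)
    · rw [tr_singleton] at h
      rw [he]
      exact exI j (le_inf (ht.trans hk) (le_inf h (ht.trans hj)))
  refine exI e (le_inf (le_iInf fun k => ?_) (le_inf (exI zero ?_) (le_iInf fun n => ?_)))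
  · refine orE (nat_cases k) (fun u hu h => orI₁ (set_ext (fun y t ht hy => ?_) fun y t ht hy => ?_))
      fun u hu h => exE h fun j t ht hk => ?_
    · rw [he] at hy
      exact exE hy fun j s hs hj => zero_ne_succ (eq_trans (eq_symm ((hs.trans ht).trans h)) (andE₁ hj))
    · rw [tr_empty] at hy; exact hy.trans bot_le
    · refine orE ((ht.trans hu).trans (hF (fst j) (snd j))) (fun s hs hj => ?_)
        fun s hs hj => orI₁ (set_ext (fun y r hr hy => ?_) fun y r hr hy => ?_)
      · refine orI₂ (exI (fst j) (le_inf ?_ (key (hs.trans hk) hj)))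
        exact mp (hs.trans (ht.trans (hu.trans (hF₂ (fst j))))) (exI (snd j) hj)
      · rw [he] at hy
        refine exE hy fun i o ho hi => notE (ho.trans (hr.trans hj)) ?_
        have e := succ_inj (eq_trans (eq_symm (andE₁ hi)) (ho.trans (hr.trans (hs.trans hk))))
        exact mem_congr _ (eq_congr snd e) (mem_congr_set (eq_congr F (eq_congr fst e))
          (andE₂ (andE₂ hi)))
      · rw [tr_empty] at hy; exact hy.trans bot_le
  · refine set_ext (fun y t ht hy => ?_) fun y t ht hy => ?_
    · rw [he] at hy
      exact exE hy fun j s hs hj => zero_ne_succ (andE₁ hj)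
    · rw [tr_empty] at hy; exact hy.trans bot_le
  · refine impI fun u hu hn => ?_
    refine exE (mp (hu.trans (hF₁ n)) hn) fun m t ht hm => ?_
    refine exE (exists_pair n m) fun j s hs hj => exI (succ j) ?_
    refine eq_trans (key eq_rfl ?_) (congr_singleton (andE₁ hj))
    exact mem_congr _ (eq_symm (andE₂ hj)) (mem_congr_set (eq_congr F (eq_symm (andE₁ hj)))
      (hs.trans hm))

end Axioms

end Elt

namespace Elt

/-! ### A creative set and least halting times -/

section Halting

variable {S : Type u} {τ : Ty S} {σ : Ty S} {Γ : Ctx S}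

local notation "𝔼" => Elt SyntheticComputability

variable {w p q : Truth SyntheticComputability τ}

attribute [local simp] const Lam All Ex mem Tm.neg Tm.iff

/-- There is a semidecidable set of numbers whose complement is productive. -/
theorem exists_creative (h₁ : ∀ H : 𝔼 τ (.nat ⇒ₜ Ty.nat.pow), ∀ v ≤ w,
    (∀ n k, v ≤ tr (H n k) ⊔ (tr (H n k))ᶜ) →
    (∀ V : 𝔼 τ Ty.nat.pow, ∀ u ≤ v, (∀ n, u ≤ Semidec (tr (V n))) →
      (∀ n, u ≤ (⨆ k, tr (H n k))ᶜ ⇨ tr (V n)) → u ≤ ⨆ n, (tr (V n) ⊓ ⨆ k, tr (H n k))) →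
    v ≤ q) : w ≤ q := by
  let C : 𝔼 τ Ty.nat.pow.pow := const (Lam Ty.nat.pow fun A => countable A)
  have hC A : tr (C A) = Countable A := by simp [C]
  have hCC : w ≤ Countable C := by
    have := tr_const_of_mem (T := SyntheticComputability) (τ := τ) .enumerability
    rw [enumerabilityAxiom, const, tr_countable] at this
    exact le_top.trans_eq this.symm
  refine countableE hCC fun e v hv he he' => ?_
  -- The diagonal set: `n` belongs to it if it lies in the `n`-th countable set, in case the
  -- enumeration has a value at `n`.
  let K : 𝔼 τ Ty.nat.pow := const (Lam (.nat ⇒ₜ Ty.nat.pow.pow) fun e => Lam .nat fun n =>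
    Ex Ty.nat.pow fun A => e.wk.wk ⬝ ↑n ⬝ A ∧' A ⬝ ↑n) e
  have hK n : tr (K n) = ⨆ A, (tr (e n A) ⊓ tr (A n)) := by simp [K]
  refine semidec_choice (w := v) K (fun n => ?_) fun H v' hv' hH hH₁ hH₂ =>
    h₁ H v' (hv'.trans hv) hH fun V u hu hV hHV => ?_
  · rw [hK]
    refine orE (he n) (fun u hu h => semidec_of_false (notI fun t ht hA => ?_)) fun u hu h => ?_
    · exact exE hA fun A s hs hA => notE (hs.trans (ht.trans (allE h A))) (andE₁ hA)
    · refine exE h fun A t ht hA => ?_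
      refine semidec_congr (semidec_mem_of_countable (hC A ▸ andE₁ hA) n) (impI fun s hs h => ?_)
        (impI fun s hs h => ?_)
      · exact exI A (le_inf (mp (andE₂ (allE (hs.trans (andE₂ hA)) A)) eq_rfl) h)
      · refine exE h fun A' r hr h => mem_congr_set ?_ (andE₂ h)
        exact mp (andE₁ (allE (hr.trans (hs.trans (andE₂ hA))) A')) (andE₁ h)
  -- An index `n` of `V` itself is the required element of `V` and of `K`.
  · have hn := mp ((hu.trans hv').trans (he' V)) (hC V ▸ countable_of_semidec hV)
    refine exE hn fun n t ht hn => ?_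
    have hKV : t ≤ tr (K n) ⇨ tr (V n) := by
      rw [hK]
      refine orE ((ht.trans (hu.trans hv')).trans (he n)) (fun s hs h => ?_) fun s hs h => ?_
      · exact notE (allE h V) (hs.trans hn)
      · refine exE h fun A r hr hA => impI fun o ho hA' => exE hA' fun A' m hm hA' => ?_
        have e₁ := mp (andE₁ (allE (hm.trans (ho.trans (andE₂ hA))) A')) (andE₁ hA')
        have e₂ := mp (andE₁ (allE (hm.trans (ho.trans (andE₂ hA))) V))
          (hm.trans (ho.trans (hr.trans (hs.trans hn))))
        exact mem_congr_set (eq_trans e₁ (eq_symm e₂)) (andE₂ hA')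
    -- If `n ∉ K`, then `n ∈ V` by assumption on `V`, so `n ∈ K` because `n` is an index of `V`.
    -- Thus `n ∈ K` is not false, hence true by Markov's principle.
    have hKn : t ≤ ⨆ k, tr (H n k) := by
      refine semidec_stable ?_ (notI fun s hs h => notE h ?_)
      · exact semidecI (H n) (fun k => (ht.trans hu).trans (hH n k)) (impI fun _ _ => id)
          (impI fun _ _ => id)
      · have hVn := mp (hs.trans (ht.trans (hHV n))) h
        refine mp ((hs.trans (ht.trans hu)).trans (hH₁ n)) ?_
        rw [hK]
        exact exI V (le_inf (hs.trans hn) hVn)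
    exact exI n (le_inf (mp hKV (mp ((ht.trans hu).trans (hH₂ n)) hKn)) hKn)

/-- No number below a given one belongs to a set. -/
noncomputable def noneBelow : 𝔼 τ (Ty.nat.pow ⇒ₜ Ty.nat.pow) := const
  (Lam (.nat ⇒ₜ Ty.nat.pow) fun b => Lam Ty.nat.pow fun h => Lam .nat fun n =>
    All .nat fun j => b.wk.wk.wk ⬝ ↑n ⬝ j ⇒ ¬' (h.wk.wk ⬝ j)) below

/-- The least element of a set. -/
noncomputable def least : 𝔼 τ (Ty.nat.pow ⇒ₜ Ty.nat.pow) := const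
  (Lam (Ty.nat.pow ⇒ₜ Ty.nat.pow) fun m => Lam Ty.nat.pow fun h => Lam .nat fun n =>
    ↑h ⬝ n ∧' m.wk.wk ⬝ ↑h ⬝ n) noneBelow

theorem tr_noneBelow (h : 𝔼 τ Ty.nat.pow) (n : 𝔼 τ .nat) :
    tr (noneBelow h n) = ⨅ j, (tr (below n j) ⇨ (tr (h j))ᶜ) := by simp [noneBelow]

theorem tr_least (h : 𝔼 τ Ty.nat.pow) (n : 𝔼 τ .nat) :
    tr (least h n) = tr (h n) ⊓ tr (noneBelow h n) := by simp [least]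

variable {h : 𝔼 τ Ty.nat.pow}

theorem not_mem_of_noneBelow {n j : 𝔼 τ .nat} (hn : w ≤ noneBelow h n) (hj : w ≤ below n j)
    (hj' : w ≤ h j) : w ≤ q := by
  rw [tr_noneBelow] at hn
  exact notE (mp (allE hn j) hj) hj'

theorem noneBelow_of_forall (n : 𝔼 τ .nat) (hh : w ≤ (⨆ k, tr (h k))ᶜ) : w ≤ noneBelow h n := by
  rw [tr_noneBelow]
  exact le_iInf fun j => impI fun v hv _ => notI fun u hu hj => notE (hu.trans (hv.trans hh))
    (exI j hj)

/-- Bounded search, by induction on the bound. -/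
theorem exists_least_or_noneBelow (hh : ∀ n, w ≤ tr (h n) ⊔ (tr (h n))ᶜ) (n : 𝔼 τ .nat) :
    w ≤ (⨆ k, (tr (below n k) ⊓ tr (least h k))) ⊔ tr (noneBelow h n) := by
  let A : 𝔼 τ Ty.nat.pow := const (Lam (.nat ⇒ₜ Ty.nat.pow) fun b => Lam Ty.nat.pow fun l =>
    Lam Ty.nat.pow fun m => Lam .nat fun n =>
      (Ex .nat fun k => b.wk.wk.wk.wk ⬝ ↑n ⬝ k ∧' l.wk.wk.wk ⬝ k) ∨' m.wk ⬝ n)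
    below (least h) (noneBelow h)
  have hA n : tr (A n) = (⨆ k, (tr (below n k) ⊓ tr (least h k))) ⊔ tr (noneBelow h n) := by simp [A]
  rw [← hA]
  refine nat_ind A ?_ (fun n v hv ih => ?_) n
  · rw [hA, tr_noneBelow]
    refine orI₂ (le_iInf fun j => ?_)
    rw [below_zero, bot_himp]; exact le_top
  · rw [hA] at ih ⊢
    refine orE ih (fun u hu h' => orI₁ (exE h' fun k t ht hk => exI k (le_inf ?_ (andE₂ hk))))
      fun u hu h' => orE ((hu.trans hv).trans (hh n)) (fun t ht hn => orI₁ (exI n (le_inf ?_ ?_)))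
        fun t ht hn => orI₂ ?_
    · rw [below_succ]; exact orI₁ (andE₁ hk)
    · rw [below_succ]; exact orI₂ eq_rfl
    · rw [tr_least]; exact le_inf hn (ht.trans h')
    · rw [tr_noneBelow] at h' ⊢
      refine le_iInf fun j => impI fun s hs hj => ?_
      rw [below_succ] at hj
      refine orE hj (fun r hr hj => mp (hr.trans (hs.trans (ht.trans (allE h' j)))) hj)
        fun r hr e => notI fun o ho hj => notE (ho.trans (hr.trans (hs.trans hn))) ?_
      exact mem_congr h (ho.trans e) hj

theorem exists_least (hh : ∀ n, w ≤ tr (h n) ⊔ (tr (h n))ᶜ) (hk : w ≤ ⨆ k, tr (h k)) :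
    w ≤ ⨆ k, tr (least h k) := by
  refine exE hk fun k v hv hk => orE (exists_least_or_noneBelow (fun n => hv.trans (hh n)) k)
    (fun u hu h' => exE h' fun n t ht hn => exI n (andE₂ hn)) fun u hu h' => exI k ?_
  rw [tr_least]
  exact le_inf (hu.trans hk) h'

theorem mem_of_least {k : 𝔼 τ .nat} (hk : w ≤ least h k) : w ≤ h k :=
  andE₁ (hk.trans (tr_least h k).le)

theorem noneBelow_of_least {k : 𝔼 τ .nat} (hk : w ≤ least h k) : w ≤ noneBelow h k :=
  andE₂ (hk.trans (tr_least h k).le)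

theorem least_unique {m n : 𝔼 τ .nat} (hm : w ≤ least h m) (hn : w ≤ least h n) : w ≤ m ≣ n := by
  refine orE (below_trichotomy n m) (fun v hv h' => ?_) fun v hv h' =>
    orE h' (fun _ _ h' => h') fun u hu h' => ?_
  · exact not_mem_of_noneBelow (hv.trans (noneBelow_of_least hn)) h' (hv.trans (mem_of_least hm))
  · exact not_mem_of_noneBelow (hu.trans (hv.trans (noneBelow_of_least hm))) h'
      (hu.trans (hv.trans (mem_of_least hn)))

theorem noneBelow_dec (hh : ∀ n, w ≤ tr (h n) ⊔ (tr (h n))ᶜ) (n : 𝔼 τ .nat) :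
    w ≤ tr (noneBelow h n) ⊔ (tr (noneBelow h n))ᶜ := by
  refine orE (exists_least_or_noneBelow hh n) (fun v hv h' => orI₂ (notI fun u hu hn => ?_))
    fun v hv h' => orI₁ h'
  exact exE (hu.trans h') fun k t ht hk => not_mem_of_noneBelow (ht.trans hn) (andE₁ hk)
    (mem_of_least (andE₂ hk))

theorem dec_inf (hp : w ≤ p ⊔ pᶜ) (hq : w ≤ q ⊔ qᶜ) : w ≤ p ⊓ q ⊔ (p ⊓ q)ᶜ := by
  refine orE hp (fun v hv hp => orE (hv.trans hq) (fun u hu hq => orI₁ (le_inf (hu.trans hp) hq))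
    fun u hu hq => orI₂ (notI fun t ht h => notE (ht.trans hq) (andE₂ h)))
    fun v hv hp => orI₂ (notI fun t ht h => notE (ht.trans hp) (andE₁ h))

theorem least_dec (hh : ∀ n, w ≤ tr (h n) ⊔ (tr (h n))ᶜ) (n : 𝔼 τ .nat) :
    w ≤ tr (least h n) ⊔ (tr (least h n))ᶜ := by
  rw [tr_least]
  exact dec_inf (hh n) (noneBelow_dec hh n)

/-- The successor matters: `h` is excluded at `j` too, so that `j` is strictly less than `k` and the
`j`-th neighbourhood is among the first `k`. -/
theorem below_of_noneBelow_succ {j k : 𝔼 τ .nat} (hj : w ≤ noneBelow h (succ j)) (hk : w ≤ h k) :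
    w ≤ below k j := by
  refine orE (below_trichotomy k j) (fun _ _ h' => h') fun v hv h' =>
    not_mem_of_noneBelow (hv.trans hj) ?_ (hv.trans hk)
  rw [below_succ]
  exact orE h' (fun u hu h' => orI₂ (eq_symm h')) fun u hu h' => orI₁ h'

end Halting

end Elt

namespace Elt

/-! ### Truth values of the topological notions -/

section Spreen

variable {S : Type u} {T : Set (Fm ([] : Ctx S))} {τ : Ty S} {σ : Ty S} {Γ : Ctx S}

attribute [local simp] Lam All Ex mem Tm.neg Tm.iff

/-- The intersection of two sets. -/
noncomputable def inter (A B : Elt T τ σ.pow) : Elt T τ σ.pow :=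
  ev (IHOL.inter (.var .here) (.var (.there .here))) (Env.cons A (Env.cons B Env.nil))

@[simp] theorem ev_inter (A B : Tm Γ σ.pow) (ρ : Env (Elt T τ) Γ) :
    ev (IHOL.inter A B) ρ = inter (ev A ρ) (ev B ρ) := by
  refine (ev_sub (IHOL.inter (.var .here) (.var (.there .here)))
    (Env.cons (F := Tm Γ) A (Env.cons B Env.nil)) ρ).trans ?_
  rw [ev_env_cons, ev_env_cons, ev_env_nil, inter]

@[simp] theorem tr_inter (A B : Elt T τ σ.pow) (x : Elt T τ σ) :
    tr ((inter A B) x) = tr (A x) ⊓ tr (B x) := by simp [inter, IHOL.inter]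

/-- The union of a family of sets. -/
noncomputable def sUnion (F : Elt T τ σ.pow.pow) : Elt T τ σ.pow :=
  ev (IHOL.sUnion (.var .here)) (Env.cons F Env.nil)

@[simp] theorem ev_sUnion (F : Tm Γ σ.pow.pow) (ρ : Env (Elt T τ) Γ) :
    ev (IHOL.sUnion F) ρ = sUnion (ev F ρ) := by
  refine (ev_sub (IHOL.sUnion (.var .here)) (Env.cons (F := Tm Γ) F Env.nil) ρ).trans ?_
  rw [ev_env_cons, ev_env_nil, sUnion]

@[simp] theorem tr_sUnion [Nonempty (Tm [τ] σ)] (F : Elt T τ σ.pow.pow) (x : Elt T τ σ) :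
    tr ((sUnion F) x) = ⨆ U, (tr (F U) ⊓ tr (U x)) := by simp [sUnion, IHOL.sUnion]

theorem tr_isTopology [Nonempty (Tm [τ] σ)] (X : Tm Γ σ.pow) (O : Tm Γ σ.pow.pow)
    (ρ : Env (Elt T τ) Γ) : tr (ev (isTopology X O) ρ) =
      (⨅ U : Elt T τ σ.pow, (tr ((ev O ρ) U) ⇨ (⨅ x, (tr (U x) ⇨ tr ((ev X ρ) x))) ⊓
        ⨅ x, (tr ((ev X ρ) x) ⇨ Semidec (tr (U x))))) ⊓ (tr ((ev O ρ) (ev X ρ)) ⊓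
      ((⨅ U, ⨅ V, (tr ((ev O ρ) U) ⇨ tr ((ev O ρ) V) ⇨ tr ((ev O ρ) (inter U V)))) ⊓
      ⨅ F : Elt T τ σ.pow.pow, (Countable F ⇨ (⨅ U, (tr (F U) ⇨ tr ((ev O ρ) U))) ⇨
        tr ((ev O ρ) (sUnion F))))) := by
  unfold isTopology
  simp only [All, mem, tr_all, tr_imp, tr_and, ev_app, ev_wk, ev_var, cons_here,
    ev_inter, ev_sUnion, tr_countable, tr_subset, tr_semidecSubset]

theorem tr_isSigmaHom [Nonempty (Tm [τ] σ)] (X : Tm Γ σ.pow) (O p : Tm Γ σ.pow.pow)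
    (ρ : Env (Elt T τ) Γ) : tr (ev (isSigmaHom X O p) ρ) =
      (⨅ U, (tr ((ev O ρ) U) ⇨ Semidec (tr ((ev p ρ) U)))) ⊓ (tr ((ev p ρ) (ev X ρ)) ⊓
      ((⨅ U, ⨅ V, (tr ((ev O ρ) U) ⇨ tr ((ev O ρ) V) ⇨
        (tr ((ev p ρ) (inter U V)) ⇨ tr ((ev p ρ) U) ⊓ tr ((ev p ρ) V)) ⊓
        (tr ((ev p ρ) U) ⊓ tr ((ev p ρ) V) ⇨ tr ((ev p ρ) (inter U V))))) ⊓
      ⨅ F : Elt T τ σ.pow.pow, (Countable F ⇨ (⨅ U, (tr (F U) ⇨ tr ((ev O ρ) U))) ⇨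
        (tr ((ev p ρ) (sUnion F)) ⇨ ⨆ U, (tr (F U) ⊓ tr ((ev p ρ) U))) ⊓
        ((⨆ U, (tr (F U) ⊓ tr ((ev p ρ) U))) ⇨ tr ((ev p ρ) (sUnion F)))))) := by
  unfold isSigmaHom
  simp only [All, Ex, mem, Tm.iff, tr_all, tr_imp, tr_and, tr_ex, tr_semidec, ev_app, ev_wk,
    ev_var, cons_here, ev_inter, ev_sUnion, tr_countable, tr_subset]

/-- The truth value of "`p` is a homomorphism from `O` to the Rosolini dominance". -/
noncomputable def SigmaHom (X : Elt T τ σ.pow) (O p : Elt T τ σ.pow.pow) : Truth T τ :=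
  tr (ev (isSigmaHom (.var (.there (.there .here))) (.var (.there .here)) (.var .here))
    (Env.cons p (Env.cons O (Env.cons X Env.nil))))

theorem tr_isSigmaHom_eq [Nonempty (Tm [τ] σ)] (X : Tm Γ σ.pow) (O p : Tm Γ σ.pow.pow)
    (ρ : Env (Elt T τ) Γ) :
    tr (ev (isSigmaHom X O p) ρ) = SigmaHom (ev X ρ) (ev O ρ) (ev p ρ) := by
  rw [SigmaHom, tr_isSigmaHom, tr_isSigmaHom]
  simp only [ev_var, cons_here, cons_there]

theorem tr_isSober [Nonempty (Tm [τ] σ)] (X : Tm Γ σ.pow) (O : Tm Γ σ.pow.pow)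
    (ρ : Env (Elt T τ) Γ) : tr (ev (isSober X O) ρ) =
      ⨅ p : Elt T τ σ.pow.pow,
        (SigmaHom (ev X ρ) (ev O ρ) p ⇨
          ⨆ x : Elt T τ σ, ((tr ((ev X ρ) x) ⊓
            ⨅ U, (tr ((ev O ρ) U) ⇨ (tr (p U) ⇨ tr (U x)) ⊓ (tr (U x) ⇨ tr (p U)))) ⊓
            ⨅ y, (tr ((ev X ρ) y) ⊓ (⨅ U, (tr ((ev O ρ) U) ⇨
              (tr (p U) ⇨ tr (U y)) ⊓ (tr (U y) ⇨ tr (p U)))) ⇨ y ≣ x))) := by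
  simp [isSober, existsUnique, tr_isSigmaHom_eq]

theorem tr_isSpreen [Nonempty (Tm [τ] σ)] (X : Tm Γ σ.pow) (O : Tm Γ σ.pow.pow)
    (ρ : Env (Elt T τ) Γ) : tr (ev (isSpreen X O) ρ) =
      ⨅ Y : Elt T τ σ.pow, ⨅ A : Elt T τ σ.pow, ⨅ x,
        ((⨅ x, (tr (Y x) ⇨ tr ((ev X ρ) x))) ⊓
          (⨅ q : Elt T τ σ.pow, ((⨅ x, (tr ((ev X ρ) x) ⇨ Semidec (tr (q x)))) ⇨
            Semidec (⨆ x, (tr (Y x) ⊓ tr (q x))))) ⇨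
          (⨅ x, (tr (A x) ⇨ tr ((ev X ρ) x))) ⊓ (⨅ x, (tr ((ev X ρ) x) ⇨ Semidec (tr (A x)))) ⇨
          tr (A x) ⇨ inter A Y ≣ const empty ⇨
          ⨆ U, (tr ((ev O ρ) U) ⊓ (tr (U x) ⊓ inter U Y ≣ const empty))) := by
  simp [isSpreen]

/-- One inequality is enough, since being a base is only a hypothesis; it replaces equality of sets
by pointwise equivalence. -/
theorem tr_isBase [Nonempty (Tm [τ] σ)] (O : Tm Γ σ.pow.pow) (B : Tm Γ (.nat ⇒ₜ σ.pow))
    (ρ : Env (Elt T τ) Γ) : tr (ev (isBase O B) ρ) ≤ (⨅ n, tr ((ev O ρ) ((ev B ρ) n))) ⊓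
      ⨅ U, (tr ((ev O ρ) U) ⇨ ⨆ I : Elt T τ Ty.nat.pow, (Countable I ⊓
        ⨅ x, ((tr (U x) ⇨ ⨆ i, (tr (I i) ⊓ tr ((ev B ρ) i x))) ⊓
          ((⨆ i, (tr (I i) ⊓ tr ((ev B ρ) i x))) ⇨ tr (U x))))) := by
  simp only [isBase, tr_and, All, tr_all, mem, ev_app, ev_wk, ev_var, cons_here, Ex, tr_imp, tr_ex,
    tr_countable, tr_eq]
  refine inf_le_inf_left _ (iInf_mono fun U => himp_le_himp_left (iSup_mono fun I =>
    inf_le_inf_left _ (le_iInf fun x => le_inf (impI fun v hv h => ?_) (impI fun v hv h => ?_))))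
  · simpa using mem_congr_set hv h
  · exact mem_congr_set (eq_symm hv) (by simpa using h)

end Spreen

/-! ### The limit homomorphism -/

section Main

variable {S : Type u} {τ : Ty S}

local notation "𝔼" => Elt SyntheticComputability

variable {w p q : Truth SyntheticComputability τ}

attribute [local simp] const Lam All Ex mem Tm.neg Tm.iff

variable {X A Y : 𝔼 τ τ.pow} {O : 𝔼 τ τ.pow.pow} {B : 𝔼 τ (.nat ⇒ₜ τ.pow)} {x : 𝔼 τ τ}
  {g h : 𝔼 τ Ty.nat.pow} {c : 𝔼 τ (.nat ⇒ₜ .nat)} {N : 𝔼 τ (.nat ⇒ₜ τ.pow)} {t : 𝔼 τ (.nat ⇒ₜ τ)}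

/-- The basic neighbourhoods of a point can be enumerated. -/
theorem exists_enum_basic (hB : ∀ i, w ≤ Semidec (tr (B i x)))
    (h₁ : ∀ g : 𝔼 τ Ty.nat.pow, ∀ v ≤ w, (∀ j, v ≤ tr (g j) ⊔ (tr (g j))ᶜ) →
      (∀ j, v ≤ tr (g j) ⇨ tr (B (fst j) x)) →
      (∀ i, v ≤ tr (B i x) ⇨ ⨆ j, (tr (g j) ⊓ fst j ≣ i)) → v ≤ q) : w ≤ q := by
  let P : 𝔼 τ Ty.nat.pow := const (Lam (.nat ⇒ₜ τ.pow) fun B => Lam τ fun x => Lam .nat fun i =>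
    B.wk.wk ⬝ i ⬝ x.wk) B x
  have hP i : tr (P i) = tr (B i x) := by simp [P]
  refine semidec_choice P (fun i => by rw [hP]; exact hB i) fun G v hv hG hG₁ hG₂ => ?_
  simp only [hP] at hG₁ hG₂
  -- A number `j` codes a basic set `fst j` and a stage `snd j` at which `x` is seen to lie in it.
  -- The codes that are correct form a decidable set.
  let g : 𝔼 τ Ty.nat.pow := const (Lam (.nat ⇒ₜ .nat) fun l => Lam (.nat ⇒ₜ .nat) fun r =>
    Lam (.nat ⇒ₜ Ty.nat.pow) fun G => Lam .nat fun j => ↑G ⬝ (l.wk.wk.wk ⬝ j) ⬝ (r.wk.wk ⬝ j))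
    fst snd G
  have hg j : tr (g j) = tr (G (fst j) (snd j)) := by simp [g]
  refine h₁ g v hv (fun j => ?_) (fun j => impI fun u hu hj => ?_) fun i => impI fun u hu hi => ?_
  · rw [hg]; exact hG _ _
  · rw [hg] at hj
    exact mp (hu.trans (hG₂ _)) (exI _ hj)
  · refine exE (mp (hu.trans (hG₁ i)) hi) fun m t ht hm => ?_
    refine exE (exists_pair i m) fun j s hs hj => exI j (le_inf ?_ (andE₁ hj))
    rw [hg]
    exact mem_congr _ (eq_symm (andE₂ hj)) (mem_congr_set (eq_congr G (eq_symm (andE₁ hj)))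
      (hs.trans hm))

/-- The homomorphism that corresponds to the point `t k` if `k` is the least element of `h`, and to
`x` if `h` is empty. -/
noncomputable def limit (h : 𝔼 τ Ty.nat.pow) (t : 𝔼 τ (.nat ⇒ₜ τ)) (x : 𝔼 τ τ) : 𝔼 τ τ.pow.pow :=
  const (Lam Ty.nat.pow fun l => Lam Ty.nat.pow fun h => Lam (.nat ⇒ₜ τ) fun t => Lam τ fun x =>
    Lam τ.pow fun U => (All .nat fun k => l.wk.wk.wk.wk.wk ⬝ k ⇒ ↑U ⬝ (t.wk.wk.wk ⬝ k)) ∧'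
      (¬' (Ex .nat fun k => h.wk.wk.wk.wk ⬝ k) ⇒ U ⬝ ↑x)) (least h) h t x

/-- Conjoined implications avoid deciding whether `h` is empty, and commute with meets at once.
Semidecidability and joins are what require work. -/
theorem tr_limit (U : 𝔼 τ τ.pow) : tr (limit h t x U) =
    (⨅ k, (tr (least h k) ⇨ tr (U (t k)))) ⊓ ((⨆ k, tr (h k))ᶜ ⇨ tr (U x)) := by simp [limit]

theorem limit_of_least {U : 𝔼 τ τ.pow} {k : 𝔼 τ .nat} (hk : w ≤ least h k) (hU : w ≤ U (t k)) :
    w ≤ limit h t x U := by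
  rw [tr_limit]
  refine le_inf (le_iInf fun n => impI fun v hv hn => ?_) (impI fun v hv hn => ?_)
  · exact mem_congr U (eq_congr t (least_unique (hv.trans hk) hn)) (hv.trans hU)
  · exact notE hn (exI k (hv.trans (mem_of_least hk)))

theorem limit_of_empty {U : 𝔼 τ τ.pow} (hh : w ≤ (⨆ k, tr (h k))ᶜ) (hU : w ≤ U x) :
    w ≤ limit h t x U := by
  rw [tr_limit]
  refine le_inf (le_iInf fun n => impI fun v hv hn => ?_) (impI fun v hv hn => hv.trans hU)
  exact notE (hv.trans hh) (exI n (mem_of_least hn))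

theorem of_limit_of_least {U : 𝔼 τ τ.pow} {k : 𝔼 τ .nat} (hU : w ≤ limit h t x U)
    (hk : w ≤ least h k) : w ≤ U (t k) := by
  rw [tr_limit] at hU
  exact mp (allE (andE₁ hU) k) hk

theorem of_limit_of_empty {U : 𝔼 τ τ.pow} (hU : w ≤ limit h t x U) (hh : w ≤ (⨆ k, tr (h k))ᶜ) :
    w ≤ U x := by
  rw [tr_limit] at hU
  exact mp (andE₂ hU) hh

/-- The limit is semidecidable on open sets. -/
theorem semidec_limit (hh : ∀ n, w ≤ tr (h n) ⊔ (tr (h n))ᶜ) (hg : ∀ j, w ≤ tr (g j) ⊔ (tr (g j))ᶜ)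
    (hgx : ∀ j, w ≤ tr (g j) ⇨ tr (B (c j) x))
    (hxg : ∀ i, w ≤ tr (B i x) ⇨ ⨆ j, (tr (g j) ⊓ c j ≣ i))
    (ht : ∀ j k, w ≤ tr (below k j) ⇨ tr (g j) ⇨ tr (least h k) ⇨ tr (B (c j) (t k)))
    {U : 𝔼 τ τ.pow} (hUt : ∀ k, w ≤ Semidec (tr (U (t k)))) {I : 𝔼 τ Ty.nat.pow}
    (hI : w ≤ Countable I) (hUI : ∀ y, w ≤ tr (U y) ⇨ ⨆ i, (tr (I i) ⊓ tr (B i y)))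
    (hIU : ∀ y, w ≤ (⨆ i, (tr (I i) ⊓ tr (B i y))) ⇨ tr (U y)) :
    w ≤ Semidec (tr (limit h t x U)) := by
  -- The search that verifies the limit at `U`. `P k`: the least element `k` of `h` has been found,
  -- and `t k ∈ U`. `Q k`, below: `h` has no element up to and including `k`, while the `k`-th code
  -- gives a basic neighbourhood of `x` contained in `U`.
  let P : 𝔼 τ (.nat ⇒ₜ .omega) := const (Lam Ty.nat.pow fun l => Lam (.nat ⇒ₜ τ) fun t =>
    Lam τ.pow fun U => Lam .nat fun k => l.wk.wk.wk ⬝ k ∧' U.wk ⬝ (t.wk.wk ⬝ k)) (least h) t U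
  have hP k : tr (P k) = tr (least h k) ⊓ tr (U (t k)) := by simp [P]
  let Q : 𝔼 τ (.nat ⇒ₜ .omega) := const (Lam Ty.nat.pow fun m => Lam Ty.nat.pow fun g =>
    Lam (.nat ⇒ₜ .nat) fun c => Lam Ty.nat.pow fun I => Lam .nat fun k =>
      m.wk.wk.wk.wk ⬝ .succ k ∧' g.wk.wk.wk ⬝ k ∧' I.wk ⬝ (c.wk.wk ⬝ k)) (noneBelow h) g c I
  have hQ k : tr (Q k) = tr (noneBelow h (succ k)) ⊓ (tr (g k) ⊓ tr (I (c k))) := by simp [Q]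
  let R : 𝔼 τ Ty.nat.pow := const (Lam Ty.nat.pow fun P => Lam Ty.nat.pow fun Q =>
    Lam .nat fun k => P.wk.wk ⬝ k ∨' Q.wk ⬝ k) P Q
  have hR k : tr (R k) = tr (P k) ⊔ tr (Q k) := by simp [R]
  have hS : w ≤ Semidec (⨆ k, tr (R k)) := by
    refine semidec_iSup R fun k => ?_
    rw [hR]
    refine semidec_sup _ _ ?_ ?_
    · rw [hP]; exact semidec_inf_of_dec (least_dec hh k) (hUt k)
    · rw [hQ]
      exact semidec_inf_of_dec (noneBelow_dec hh _)
        (semidec_inf_of_dec (hg k) (semidec_mem_of_countable hI _))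
  refine semidec_congr hS (impI fun v hv hk => exE hk fun k u hu hk => ?_) (impI fun v hv hl => ?_)
  · rw [hR, hP, hQ] at hk
    refine orE hk (fun s hs hk => limit_of_least (andE₁ hk) (andE₂ hk)) fun s hs hk => ?_
    have hsw := hs.trans (hu.trans hv)
    rw [tr_limit]
    refine le_inf (le_iInf fun n => impI fun r hr hn => ?_) (impI fun r hr hn => ?_)
    -- If `h` later turns out to have least element `n`, then `k < n`, so `t n` lies in the basic
    -- set found by `Q k`.
    · refine mp ((hr.trans hsw).trans (hIU _)) (exI (c k) (le_inf (hr.trans (andE₂ (andE₂ hk))) ?_))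
      exact mp (mp (mp ((hr.trans hsw).trans (ht k n))
        (below_of_noneBelow_succ (hr.trans (andE₁ hk)) (mem_of_least hn)))
        (hr.trans (andE₁ (andE₂ hk)))) hn
    · refine mp ((hr.trans hsw).trans (hIU _)) (exI (c k) (le_inf (hr.trans (andE₂ (andE₂ hk))) ?_))
      exact mp ((hr.trans hsw).trans (hgx k)) (hr.trans (andE₁ (andE₂ hk)))
  -- Success of the search is semidecidable, hence stable, so one may decide whether `h` is
  -- inhabited.
  · refine stable_by_cases (⨆ k, tr (h k))
      (fun u hu hn => semidec_stable ((hu.trans hv).trans hS) hn) (fun u hu hk => ?_) fun u hu hk => ?_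
    · refine exE (exists_least (fun n => (hu.trans hv).trans (hh n)) hk) fun k s hs hk => exI k ?_
      rw [hR, hP]
      exact orI₁ (le_inf hk (of_limit_of_least (hs.trans (hu.trans hl)) hk))
    · refine exE (mp ((hu.trans hv).trans (hUI x)) (of_limit_of_empty (hu.trans hl) hk))
        fun i s hs hi => ?_
      have hsw := hs.trans (hu.trans hv)
      refine exE (mp (hsw.trans (hxg i)) (andE₂ hi)) fun j r hr hj => exI j ?_
      rw [hR, hQ]
      refine orI₂ (le_inf (noneBelow_of_forall _ (hr.trans (hs.trans hk))) (le_inf (andE₁ hj) ?_))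
      exact mem_congr I (eq_symm (andE₂ hj)) (hr.trans (andE₁ hi))

/-- In either case, `h` inhabited or empty, the limit is evaluation at a point. Finite meets need no
case distinction. For joins the cases may be distinguished because the existence of a suitable `U ∈
F` is semidecidable (`F` being countable) and hence stable. -/
theorem isSigmaHom_limit (hh : ∀ n, w ≤ tr (h n) ⊔ (tr (h n))ᶜ)
    (hXt : ∀ k, w ≤ X (t k)) (hXx : w ≤ X x) (hO : ∀ U, w ≤ tr (O U) ⇨ Semidec (tr (limit h t x U))) :
    w ≤ SigmaHom X O (limit h t x) := by
  rw [SigmaHom, tr_isSigmaHom]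
  simp only [ev_var, cons_here, cons_there]
  refine le_inf (le_iInf hO) (le_inf ?_ (le_inf ?_ ?_))
  · rw [tr_limit]
    exact le_inf (le_iInf fun k => impI fun v hv _ => hv.trans (hXt k)) (impI fun v hv _ => hv.trans hXx)
  · refine le_iInf fun U => le_iInf fun V => impI fun v hv _ => impI fun u hu _ => le_inf
      (impI fun s hs hl => le_inf ?_ ?_) (impI fun s hs hl => ?_)
    · rw [tr_limit] at hl ⊢
      simp only [tr_inter] at hl
      exact le_inf (le_iInf fun k => impI fun r hr hk => andE₁ (mp (allE (andE₁ (hr.trans hl)) k) hk))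
        (impI fun r hr hk => andE₁ (mp (andE₂ (hr.trans hl)) hk))
    · rw [tr_limit] at hl ⊢
      simp only [tr_inter] at hl
      exact le_inf (le_iInf fun k => impI fun r hr hk => andE₂ (mp (allE (andE₁ (hr.trans hl)) k) hk))
        (impI fun r hr hk => andE₂ (mp (andE₂ (hr.trans hl)) hk))
    · rw [tr_limit]
      simp only [tr_inter]
      exact le_inf (le_iInf fun k => impI fun r hr hk => le_inf
          (of_limit_of_least (hr.trans (andE₁ hl)) hk) (of_limit_of_least (hr.trans (andE₂ hl)) hk))
        (impI fun r hr hk => le_inf (of_limit_of_empty (hr.trans (andE₁ hl)) hk)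
          (of_limit_of_empty (hr.trans (andE₂ hl)) hk))
  · refine le_iInf fun F => impI fun v hv hF => impI fun u hu hFO => le_inf
      (impI fun s hs hl => ?_) (impI fun s hs hl => exE hl fun U r hr hU => ?_)
    · have hS : u ≤ Semidec (⨆ U, (tr (F U) ⊓ tr (limit h t x U))) :=
        semidec_exists_mem_countable _ (hu.trans hF) fun U => impI fun r hr hU =>
          mp ((hr.trans (hu.trans hv)).trans (hO U)) (mp (hr.trans (allE hFO U)) hU)
      refine stable_by_cases (⨆ k, tr (h k)) (fun r hr hn => semidec_stable ((hr.trans hs).trans hS) hn)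
        (fun r hr hk => ?_) fun r hr hk => ?_
      · have hrw := hr.trans (hs.trans (hu.trans hv))
        refine exE (exists_least (fun n => hrw.trans (hh n)) hk) fun k m hm hk => ?_
        have := of_limit_of_least (hm.trans (hr.trans hl)) hk
        rw [tr_sUnion] at this
        exact exE this fun U o ho hU => exI U (le_inf (andE₁ hU)
          (limit_of_least (ho.trans hk) (andE₂ hU)))
      · have := of_limit_of_empty (hr.trans hl) hk
        rw [tr_sUnion] at this
        exact exE this fun U o ho hU => exI U (le_inf (andE₁ hU)
          (limit_of_empty (ho.trans hk) (andE₂ hU)))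
    · have := andE₂ hU
      rw [tr_limit] at this ⊢
      simp only [tr_sUnion]
      exact le_inf (le_iInf fun k => impI fun m hm hk => exI U (le_inf (hm.trans (andE₁ hU))
          (mp (allE (andE₁ (hm.trans this)) k) hk)))
        (impI fun m hm hk => exI U (le_inf (hm.trans (andE₁ hU)) (mp (andE₂ (hm.trans this)) hk)))

end Main

end Elt

namespace Elt

/-! ### Separating a point from an overt set -/

section Separation

variable {S : Type u} {τ : Ty S}

local notation "𝔼" => Elt SyntheticComputability

variable {w : Truth SyntheticComputability τ}

attribute [local simp] const Lam All Ex mem Tm.neg Tm.iff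

variable {X A Y : 𝔼 τ τ.pow} {O : 𝔼 τ τ.pow.pow} {B : 𝔼 τ (.nat ⇒ₜ τ.pow)} {x : 𝔼 τ τ}
  {g h : 𝔼 τ Ty.nat.pow} {c : 𝔼 τ (.nat ⇒ₜ .nat)} {N : 𝔼 τ (.nat ⇒ₜ τ.pow)}

/-- If the overt set `Y` meets the neighbourhood `N k` of `x` whenever `k` is the least element of
`h`, then a semidecidable set that separates `x` from `Y` can be used to verify that `h` is empty. -/
theorem semidec_isEmpty
    (hO : ∀ U, w ≤ tr (O U) ⇨ (⨅ y, (tr (U y) ⇨ tr (X y))) ⊓ ⨅ y, (tr (X y) ⇨ Semidec (tr (U y))))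
    (hbase : ∀ U, w ≤ tr (O U) ⇨ ⨆ I : 𝔼 τ Ty.nat.pow, (Countable I ⊓
      ⨅ y, ((tr (U y) ⇨ ⨆ i, (tr (I i) ⊓ tr (B i y))) ⊓
        ((⨆ i, (tr (I i) ⊓ tr (B i y))) ⇨ tr (U y)))))
    (hsober : ∀ p, w ≤ SigmaHom X O p ⇨ ⨆ y, ((tr (X y) ⊓
        ⨅ U, (tr (O U) ⇨ (tr (p U) ⇨ tr (U y)) ⊓ (tr (U y) ⇨ tr (p U)))) ⊓
      ⨅ z, (tr (X z) ⊓ (⨅ U, (tr (O U) ⇨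
        (tr (p U) ⇨ tr (U z)) ⊓ (tr (U z) ⇨ tr (p U)))) ⇨ z ≣ y)))
    (hY : ∀ y, w ≤ tr (Y y) ⇨ tr (X y)) (hA : ∀ y, w ≤ tr (X y) ⇨ Semidec (tr (A y)))
    (hXx : w ≤ X x) (hAx : w ≤ A x) (hAY : ∀ y, w ≤ (tr (A y) ⊓ tr (Y y))ᶜ)
    (hh : ∀ n, w ≤ tr (h n) ⊔ (tr (h n))ᶜ) (hg : ∀ j, w ≤ tr (g j) ⊔ (tr (g j))ᶜ)
    (hgx : ∀ j, w ≤ tr (g j) ⇨ tr (B (c j) x))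
    (hxg : ∀ i, w ≤ tr (B i x) ⇨ ⨆ j, (tr (g j) ⊓ c j ≣ i))
    (hN : ∀ j k y, w ≤ tr (below k j) ⇨ tr (g j) ⇨ tr (N k y) ⇨ tr (B (c j) y))
    (hYN : ∀ k, w ≤ tr (least h k) ⇨ ⨆ y, (tr (Y y) ⊓ tr (N k y))) :
    w ≤ Semidec (⨆ k, tr (h k))ᶜ := by
  -- Choice needs a point for every `k`. Being the least element of `h` is decidable, so the default
  -- value `x` can be used for all other `k`.
  let R : 𝔼 τ (.nat ⇒ₜ τ.pow) := const (Lam τ.pow fun X => Lam Ty.nat.pow fun l => Lam τ.pow fun Y =>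
    Lam (.nat ⇒ₜ τ.pow) fun N => Lam .nat fun k => Lam τ fun y => X.wk.wk.wk.wk.wk ⬝ y ∧'
      (l.wk.wk.wk.wk ⬝ ↑k ⇒ Y.wk.wk.wk ⬝ y ∧' N.wk.wk ⬝ ↑k ⬝ y)) X (least h) Y N
  have hR k y : tr (R k y) = tr (X y) ⊓ (tr (least h k) ⇨ tr (Y y) ⊓ tr (N k y)) := by simp [R]
  refine exE (choice R fun k => ?_) fun t v hv ht => ?_
  · simp only [hR]
    refine orE (least_dec hh k) (fun v hv hk => ?_) fun v hv hk => exI x (le_inf (hv.trans hXx) ?_)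
    · refine exE (mp (hv.trans (hYN k)) hk) fun y u hu hy => exI y (le_inf ?_ ?_)
      · exact mp ((hu.trans hv).trans (hY y)) (andE₁ hy)
      · exact impI fun s hs _ => hs.trans hy
    · exact impI fun u hu hk' => notE (hu.trans hk) hk'
  simp only [hR] at ht
  have hXt k : v ≤ X (t k) := andE₁ (allE ht k)
  have ht' k := andE₂ (allE ht k)
  have hom : v ≤ SigmaHom X O (limit h t x) := by
    refine isSigmaHom_limit (fun n => hv.trans (hh n)) hXt (hv.trans hXx) fun U =>
      impI fun u hu hU => ?_
    have huw := hu.trans hv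
    refine exE (mp (huw.trans (hbase U)) hU) fun I s hs hI => ?_
    have hsw := hs.trans huw
    refine semidec_limit (B := B) (g := g) (c := c) (fun n => hsw.trans (hh n))
      (fun j => hsw.trans (hg j)) (fun j => hsw.trans (hgx j)) (fun i => hsw.trans (hxg i))
      (fun j k => ?_) (fun k => ?_) (andE₁ hI) (fun y => andE₁ (allE (andE₂ hI) y))
      (fun y => andE₂ (allE (andE₂ hI) y))
    · refine impI fun r hr hb => impI fun o ho hj => impI fun m hm hk => ?_
      have hms := hm.trans (ho.trans hr)
      exact mp (mp (mp ((hms.trans hsw).trans (hN j k (t k))) ((hm.trans ho).trans hb))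
        (hm.trans hj)) (andE₂ (mp ((hms.trans (hs.trans hu)).trans (ht' k)) hk))
    · exact mp (allE (andE₂ (mp (hsw.trans (hO U)) (hs.trans hU))) (t k))
        ((hs.trans hu).trans (hXt k))
  refine exE (mp (hv.trans (hsober _)) hom) fun y u hu hy => ?_
  have huw := hu.trans hv
  -- The semidecidable statement is `y ∈ A`, where `y` is the point that sobriety assigns to the
  -- limit.
  refine semidec_congr (mp (huw.trans (hA y)) (andE₁ (andE₁ hy))) (impI fun s hs hAy => ?_)
    (impI fun s hs hk => ?_)
  · refine notI fun r hr hk => ?_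
    have hrw := hr.trans (hs.trans huw)
    refine exE (exists_least (fun n => hrw.trans (hh n)) hk) fun k o ho hk => ?_
    have hov := ho.trans (hr.trans (hs.trans hu))
    refine notE ((ho.trans hrw).trans (hAY y)) (le_inf (ho.trans (hr.trans hAy)) ?_)
    refine mem_congr Y ?_ (andE₁ (mp (hov.trans (ht' k)) hk))
    -- Uniqueness in sobriety: if `k` is the least element of `h`, then `t k` induces the same
    -- homomorphism as `y`, so `y = t k ∈ Y`, against `y ∈ A`. In the empty case `x` takes the place
    -- of `t k`.
    refine mp (allE (ho.trans (hr.trans (hs.trans (andE₂ hy)))) (t k)) (le_inf (hov.trans (hXt k)) ?_)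
    exact le_iInf fun U => impI fun m hm _ => le_inf
      (impI fun l hl hU => of_limit_of_least hU (hl.trans (hm.trans hk)))
      (impI fun l hl hU => limit_of_least (hl.trans (hm.trans hk)) hU)
  · refine mem_congr A ?_ (hs.trans (huw.trans hAx))
    refine mp (allE (hs.trans (andE₂ hy)) x) (le_inf (hs.trans (huw.trans hXx)) ?_)
    exact le_iInf fun U => impI fun m hm _ => le_inf
      (impI fun l hl hU => of_limit_of_empty hU (hl.trans (hm.trans hk)))
      (impI fun l hl hU => limit_of_empty (hl.trans (hm.trans hk)) hU)

/-- The intersection of the first `k` basic neighbourhoods of a point. -/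
noncomputable def nbhd (X : 𝔼 τ τ.pow) (B : 𝔼 τ (.nat ⇒ₜ τ.pow)) (c : 𝔼 τ (.nat ⇒ₜ .nat))
    (g : 𝔼 τ Ty.nat.pow) : 𝔼 τ (.nat ⇒ₜ τ.pow) :=
  const (Lam (.nat ⇒ₜ Ty.nat.pow) fun b => Lam τ.pow fun X => Lam (.nat ⇒ₜ τ.pow) fun B =>
    Lam (.nat ⇒ₜ .nat) fun c => Lam Ty.nat.pow fun g => Lam .nat fun k => Lam τ fun y =>
      X.wk.wk.wk.wk.wk ⬝ y ∧' All .nat fun j => b.wk.wk.wk.wk.wk.wk.wk ⬝ k.wk.wk ⬝ j ⇒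
        g.wk.wk.wk ⬝ j ⇒ B.wk.wk.wk.wk.wk ⬝ (c.wk.wk.wk.wk ⬝ j) ⬝ y.wk) below X B c g

theorem tr_nbhd (k : 𝔼 τ .nat) (y : 𝔼 τ τ) : tr (nbhd X B c g k y) =
    tr (X y) ⊓ ⨅ j, (tr (below k j) ⇨ tr (g j) ⇨ tr (B (c j) y)) := by simp [nbhd]

/-- Induction on `k`. The start is the whole space; as `g` is decidable, each step either intersects
with one more basic set or changes nothing. -/
theorem nbhd_open (hX : w ≤ O X) (hB : ∀ n, w ≤ O (B n))
    (hinter : ∀ U V, w ≤ tr (O U) ⇨ tr (O V) ⇨ tr (O (inter U V)))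
    (hg : ∀ j, w ≤ tr (g j) ⊔ (tr (g j))ᶜ) (k : 𝔼 τ .nat) : w ≤ O (nbhd X B c g k) := by
  let P : 𝔼 τ Ty.nat.pow := const (Lam τ.pow.pow fun O => Lam (.nat ⇒ₜ τ.pow) fun N => Lam .nat fun k =>
    O.wk.wk ⬝ (↑N ⬝ k)) O (nbhd X B c g)
  have hP k : tr (P k) = tr (O (nbhd X B c g k)) := by simp [P]
  rw [← hP]
  refine nat_ind P ?_ (fun k v hv ih => ?_) k
  · rw [hP]
    refine mem_congr O (set_ext (fun y u hu hy => ?_) fun y u hu hy => ?_) hX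
    · rw [tr_nbhd]
      refine le_inf hy (le_iInf fun j => ?_)
      rw [below_zero, bot_himp]; exact le_top
    · rw [tr_nbhd] at hy
      exact andE₁ hy
  · rw [hP] at ih ⊢
    have mono {u : Truth SyntheticComputability τ} {y : 𝔼 τ τ} (hy : u ≤ nbhd X B c g (succ k) y) :
        u ≤ nbhd X B c g k y := by
      rw [tr_nbhd] at hy ⊢
      refine le_inf (andE₁ hy) (le_iInf fun j => impI fun s hs hj => ?_)
      refine mp (hs.trans (allE (andE₂ hy) j)) ?_
      rw [below_succ]
      exact orI₁ hj
    refine orE (hv.trans (hg k)) (fun u hu hk => ?_) fun u hu hk => ?_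
    · refine mem_congr O (set_ext (fun y s hs hy => ?_) fun y s hs hy => ?_)
        (mp (mp ((hu.trans hv).trans (hinter _ (B (c k)))) (hu.trans ih)) ((hu.trans hv).trans (hB _)))
      · rw [tr_inter, tr_nbhd] at hy
        rw [tr_nbhd]
        refine le_inf (andE₁ (andE₁ hy)) (le_iInf fun j => impI fun r hr hj => impI fun m hm hj' => ?_)
        rw [below_succ] at hj
        refine orE (hm.trans hj) (fun o ho hj => ?_) fun o ho hj => ?_
        · exact mp (mp (ho.trans (hm.trans (hr.trans (allE (andE₂ (andE₁ hy)) j)))) hj) (ho.trans hj')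
        · exact mem_congr_set (eq_congr B (eq_congr c (eq_symm hj)))
            (ho.trans (hm.trans (hr.trans (andE₂ hy))))
      · rw [tr_inter]
        refine le_inf (mono hy) ?_
        rw [tr_nbhd] at hy
        refine mp (mp (allE (andE₂ hy) k) ?_) (hs.trans hk)
        rw [below_succ]
        exact orI₂ eq_rfl
    · refine mem_congr O (set_ext (fun y s hs hy => ?_) fun y s hs hy => mono hy) (hu.trans ih)
      rw [tr_nbhd] at hy ⊢
      refine le_inf (andE₁ hy) (le_iInf fun j => impI fun r hr hj => ?_)
      rw [below_succ] at hj
      refine orE hj (fun o ho hj => mp (ho.trans (hr.trans (allE (andE₂ hy) j))) hj)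
        fun o ho hj => impI fun m hm hj' => notE ((hm.trans (ho.trans (hr.trans hs))).trans hk) ?_
      exact mem_congr g (hm.trans hj) hj'

theorem stableSubspace {D U : 𝔼 τ Ty.nat.pow} {p : Truth SyntheticComputability τ}
    (hD : ∀ n, w ≤ (tr (D n))ᶜᶜ ⇨ tr (D n)) (hUD : ∀ n, w ≤ tr (U n) ⇨ tr (D n))
    (hU : ∀ n, w ≤ tr (D n) ⇨ Semidec (tr (U n)))
    (h₁ : ∀ V : 𝔼 τ Ty.nat.pow, ∀ v ≤ w, (∀ n, v ≤ Semidec (tr (V n))) →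
      v ≤ inter V D ≣ U → v ≤ p) : w ≤ p := by
  have := tr_const_of_mem (T := SyntheticComputability) (τ := τ) .stableSubspace
  unfold stableSubspaceAxiom stable intrinsicSubspace at this
  simp only [const, All, mem, tr_all, tr_imp, tr_and, Ex, tr_ex, tr_eq, ev_app, ev_wk, ev_var, cons_here,
    ev_inter, tr_semidecSubset, Tm.neg, tr_falsum, himp_bot, iInf_eq_top] at this
  have hs := andE₂ (mp (le_top.trans_eq (this D).symm) (le_iInf hD))
  refine exE (mp (allE hs U) (le_inf (le_iInf hUD) (le_iInf hU))) fun V v hv hV => ?_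
  refine h₁ V v hv (fun n => mp (allE (andE₂ (andE₁ hV)) n) ?_) (andE₂ hV)
  simp [allNat, eq_refl]

/-- The theorem at a fixed stage. The separating open set is `N k`, where `k` is the least stage of
some `e` that lies in the creative set and in the semidecidable set `V` provided by the Stable
Subspace Axiom. -/
theorem isSpreen_of_isSober
    (hO : ∀ U, w ≤ tr (O U) ⇨ (⨅ y, (tr (U y) ⇨ tr (X y))) ⊓ ⨅ y, (tr (X y) ⇨ Semidec (tr (U y))))
    (hX : w ≤ O X) (hinter : ∀ U V, w ≤ tr (O U) ⇨ tr (O V) ⇨ tr (O (inter U V)))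
    (hB : ∀ n, w ≤ O (B n))
    (hbase : ∀ U, w ≤ tr (O U) ⇨ ⨆ I : 𝔼 τ Ty.nat.pow, (Countable I ⊓
      ⨅ y, ((tr (U y) ⇨ ⨆ i, (tr (I i) ⊓ tr (B i y))) ⊓
        ((⨆ i, (tr (I i) ⊓ tr (B i y))) ⇨ tr (U y)))))
    (hsober : ∀ p, w ≤ SigmaHom X O p ⇨ ⨆ y, ((tr (X y) ⊓
        ⨅ U, (tr (O U) ⇨ (tr (p U) ⇨ tr (U y)) ⊓ (tr (U y) ⇨ tr (p U)))) ⊓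
      ⨅ z, (tr (X z) ⊓ (⨅ U, (tr (O U) ⇨
        (tr (p U) ⇨ tr (U z)) ⊓ (tr (U z) ⇨ tr (p U)))) ⇨ z ≣ y)))
    (hY : ∀ y, w ≤ tr (Y y) ⇨ tr (X y))
    (hovert : ∀ q : 𝔼 τ τ.pow, w ≤ (⨅ y, (tr (X y) ⇨ Semidec (tr (q y)))) ⇨
      Semidec (⨆ y, (tr (Y y) ⊓ tr (q y))))
    (hA : ∀ y, w ≤ tr (X y) ⇨ Semidec (tr (A y)))
    (hXx : w ≤ X x) (hAx : w ≤ A x) (hAY : w ≤ inter A Y ≣ const empty) :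
    w ≤ ⨆ U, (tr (O U) ⊓ (tr (U x) ⊓ inter U Y ≣ const empty)) := by
  have hAY' y : w ≤ (tr (A y) ⊓ tr (Y y))ᶜ := notI fun v hv hy => by
    rw [← tr_inter] at hy
    exact (mem_congr_set (hv.trans hAY) hy).trans (tr_empty y).le
  refine exists_enum_basic (B := B) (x := x)
    (fun i => mp (allE (andE₂ (mp (hO _) (hB i))) x) hXx) fun g w₁ h₁ hg hgx hxg => ?_
  refine exists_creative fun H w₂ h₂ hH hHV => ?_
  have h₂w := h₂.trans h₁
  let N := nbhd X B fst g
  have hNO k : w₁ ≤ O (N k) := nbhd_open (h₁.trans hX) (fun n => h₁.trans (hB n))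
    (fun U V => h₁.trans (hinter U V)) hg k
  have hN j k y {v : Truth SyntheticComputability τ} : v ≤ tr (below k j) ⇨ tr (g j) ⇨ tr (N k y) ⇨
      tr (B (fst j) y) := impI fun v _ hj => impI fun u hu hg => impI fun s hs hy => by
    rw [tr_nbhd] at hy
    exact mp (mp (allE (andE₂ hy) j) ((hs.trans hu).trans hj)) (hs.trans hg)
  let M : 𝔼 τ Ty.nat.pow := const (Lam τ.pow fun Y => Lam (.nat ⇒ₜ τ.pow) fun N => Lam .nat fun k =>
    Ex τ fun y => Y.wk.wk.wk ⬝ y ∧' N.wk.wk ⬝ ↑k ⬝ y) Y N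
  have hM k : tr (M k) = ⨆ y, (tr (Y y) ⊓ tr (N k y)) := by simp [M]
  have hMs k : w₁ ≤ Semidec (tr (M k)) := by
    rw [hM]
    exact mp (h₁.trans (hovert (N k))) (andE₂ (mp (h₁.trans (hO _)) (hNO k)))
  -- The programs whose halting time `k`, if any, makes `Y` meet `N k`. Those that never halt
  -- satisfy this vacuously.
  let D : 𝔼 τ Ty.nat.pow := const (Lam (Ty.nat.pow ⇒ₜ Ty.nat.pow) fun l =>
    Lam (.nat ⇒ₜ Ty.nat.pow) fun H => Lam Ty.nat.pow fun M => Lam .nat fun e =>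
      All .nat fun k => l.wk.wk.wk.wk ⬝ (H.wk.wk.wk ⬝ ↑e) ⬝ k ⇒ M.wk.wk ⬝ k) least H M
  have hD e : tr (D e) = ⨅ k, (tr (least (H e) k) ⇨ tr (M k)) := by simp [D]
  let E : 𝔼 τ Ty.nat.pow := const (Lam (.nat ⇒ₜ Ty.nat.pow) fun H => Lam .nat fun e =>
    ¬' (Ex .nat fun k => H.wk.wk ⬝ ↑e ⬝ k)) H
  have hE e : tr (E e) = (⨆ k, tr (H e k))ᶜ := by simp [E]
  refine stableSubspace (D := D) (U := E) (fun e => impI fun v hv hn => ?_)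
    (fun e => impI fun v hv he => ?_) (fun e => impI fun v hv he => ?_) fun V w₃ h₃ hV hVD => ?_
  -- `D` is stable since its conditions have semidecidable, hence stable, conclusions.
  · rw [hD] at hn ⊢
    refine le_iInf fun k => impI fun u hu hk => semidec_stable ((hu.trans (hv.trans h₂)).trans (hMs k)) ?_
    exact notI fun s hs hM => notE (hs.trans (hu.trans hn)) (notI fun r hr h' =>
      notE (hr.trans hM) (mp (allE h' k) (hr.trans (hs.trans hk))))
  · rw [hE] at he
    rw [hD]
    exact le_iInf fun k => impI fun u hu hk => notE (hu.trans he) (exI k (mem_of_least hk))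
  · rw [hD] at he
    rw [hE]
    have hvw := hv.trans h₂w
    have hv1 := hv.trans h₂
    exact semidec_isEmpty (N := N) (fun U => hvw.trans (hO U)) (fun U => hvw.trans (hbase U))
      (fun p => hvw.trans (hsober p)) (fun y => hvw.trans (hY y)) (fun y => hvw.trans (hA y))
      (hvw.trans hXx) (hvw.trans hAx) (fun y => hvw.trans (hAY' y)) (fun n => hv.trans (hH e n))
      (fun j => hv1.trans (hg j)) (fun j => hv1.trans (hgx j)) (fun i => hv1.trans (hxg i))
      (fun j k y => hN j k y) (fun k => by rw [← hM]; exact allE he k)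
  · have h₃w := h₃.trans h₂w
    -- `V` contains `E`, the complement of the creative set, so it meets the creative set.
    have hex := hHV V w₃ h₃ hV fun e => impI fun v hv he => by
      rw [← hE] at he
      have := mem_congr_set (eq_symm (hv.trans hVD)) he
      rw [tr_inter] at this
      exact andE₁ this
    refine exE hex fun e w₄ h₄ he => ?_
    refine exE (exists_least (fun n => (h₄.trans h₃).trans (hH e n)) (andE₂ he)) fun k w₅ h₅ hk => ?_
    have h₅w := (h₅.trans h₄).trans h₃w
    refine exI (N k) (le_inf (((h₅.trans h₄).trans (h₃.trans h₂)).trans (hNO k)) (le_inf ?_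
      (set_ext (fun y v hv hy => ?_) fun y v hv hy => ?_)))
    · rw [tr_nbhd]
      exact le_inf (h₅w.trans hXx) (le_iInf fun j => impI fun v hv _ => (hv.trans (h₅.trans (h₄.trans
        (h₃.trans h₂)))).trans (hgx j))
    · rw [tr_inter] at hy
      -- A point `y` of `N k ∩ Y` would put `e` into `D`, as `k` is its only least stage; then `e ∈
      -- V ∩ D = E`, although `e` halts.
      have hDe : v ≤ D e := by
        rw [hD]
        refine le_iInf fun n => impI fun u hu hn => mem_congr M (least_unique (hu.trans (hv.trans hk)) hn) ?_
        rw [hM]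
        exact exI y (hu.trans (le_inf (andE₂ hy) (andE₁ hy)))
      have hEe := mem_congr_set (hv.trans (h₅.trans (h₄.trans hVD))) (t := e)
        (by rw [tr_inter]; exact le_inf (hv.trans (h₅.trans (andE₁ he))) hDe)
      rw [hE] at hEe
      exact notE hEe (exI k (hv.trans (mem_of_least hk)))
    · exact (hy.trans (tr_empty y).le).trans bot_le

theorem tr_isSpreen_of_isSober : tr (const (All τ.pow fun X => All τ.pow.pow fun O =>
    All (.nat ⇒ₜ τ.pow) fun B => isTopology X.wk.wk ↑O ⇒ isBase O.wk B ⇒ isSober X.wk.wk ↑O ⇒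
      isSpreen X.wk.wk ↑O) : 𝔼 τ .omega) = ⊤ := by
  refine top_le_iff.1 ?_
  simp only [const, All, tr_all, tr_imp]
  refine le_iInf fun X => le_iInf fun O => le_iInf fun B => impI fun v₁ _ hO => impI fun v₂ h₂ hB =>
    impI fun v₃ h₃ hs => ?_
  replace hO := h₃.trans (h₂.trans hO)
  replace hB := h₃.trans (hB.trans (tr_isBase ..))
  rw [tr_isTopology] at hO
  rw [tr_isSober] at hs
  rw [tr_isSpreen]
  simp only [ev_wk, ev_var, cons_here] at hO hB hs ⊢
  refine le_iInf fun Y => le_iInf fun A => le_iInf fun x => impI fun v₄ h₄ hY => impI fun v₅ h₅ hA =>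
    impI fun v₆ h₆ hx => impI fun v₇ h₇ hAY => ?_
  replace hA := h₇.trans (h₆.trans hA)
  replace hY := h₇.trans (h₆.trans (h₅.trans hY))
  replace hx := h₇.trans hx
  have h := h₇.trans (h₆.trans (h₅.trans h₄))
  replace hO := h.trans hO
  replace hB := h.trans hB
  replace hs := h.trans hs
  exact isSpreen_of_isSober (fun U => allE (andE₁ hO) U) (andE₁ (andE₂ hO))
    (fun U V => allE (allE (andE₁ (andE₂ (andE₂ hO))) U) V) (fun n => allE (andE₁ hB) n)
    (fun U => allE (andE₂ hB) U) (fun p => allE hs p) (fun y => allE (andE₁ hY) y)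
    (fun q => allE (andE₂ hY) q) (fun y => allE (andE₂ hA) y) (mp (allE (andE₁ hA) x) hx) hx hAY

end Separation

end Elt

/-! ### From truth in the model to a closed derivation -/

section Instantiation

variable {S : Type u} {T : Set (Fm ([] : Ctx S))} {Γ Δ : Ctx S} {σ τ : Ty S}

theorem Tm.ren_eq_sub (t : Tm Γ τ) (r : Ren Γ Δ) : t.ren r = t.sub fun _ x => .var (r _ x) := by
  rw [← Tm.sub_var (t.ren r), Tm.ren_sub]

theorem Deriv.all_sub {Φ : List (Fm Δ)} {φ : Fm (σ :: Γ)} {s : Sub Γ Δ}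
    (h : Deriv T Φ ((Tm.all φ).sub s)) (t : Tm Δ σ) :
    Deriv T Φ (φ.sub (Env.cons (F := Tm Δ) t s)) := by
  rw [← Tm.sub_lift_inst]
  exact .allE h t

/-- To derive a universal implication between universal statements, its variables may be assumed to
be in the context. -/
theorem Deriv.all_imp_all {σ₁ σ₂ σ₃ σ₄ σ₅ σ₆ : Ty S} {p q r : Fm [σ₃, σ₂, σ₁]}
    {φ : Fm [σ₆, σ₅, σ₄, σ₃, σ₂, σ₁]}
    (h : ∀ Φ : List (Fm [σ₆, σ₅, σ₄, σ₃, σ₂, σ₁]), Deriv T Φ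
      (Tm.all (.all (.all (p ⇒ q ⇒ r ⇒ .all (.all (.all φ)))))).close) :
    Deriv T [] (Tm.all (.all (.all (p ⇒ q ⇒ r ⇒ .all (.all (.all φ)))))) := by
  -- After all introductions, the context contains the variables of the conclusion, so the closed
  -- statement has to be derivable only there. It is then specialised to these very variables.
  refine .allI (.allI (.allI (.impI (.impI (.impI (.allI (.allI (.allI ?_))))))))
  simp only [← Tm.sub_nil _ Env.nil] at h
  have e (ψ : Fm [σ₃, σ₂, σ₁]) : ψ.sub (Env.cons (F := Tm [σ₆, σ₅, σ₄, σ₃, σ₂, σ₁])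
      (.var (.there (.there (.there .here)))) (Env.cons (.var (.there (.there (.there (.there .here)))))
      (Env.cons (.var (.there (.there (.there (.there (.there .here)))))) Env.nil))) =
      ψ.wk.wk.wk := by
    rw [Tm.wk, Tm.wk, Tm.wk, Tm.ren_ren, Tm.ren_ren, Tm.ren_eq_sub]
    refine congrArg ψ.sub ?_
    funext _ x
    match x with
    | .here | .there .here | .there (.there .here) => rfl
  have h₁ := (((h ([r, q, p].map fun ψ => ψ.wk.wk.wk)).all_sub
    (.var (.there (.there (.there (.there (.there .here))))))).all_sub
    (.var (.there (.there (.there (.there .here)))))).all_sub (.var (.there (.there (.there .here))))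
  have h₂ := ((h₁.impE (.hyp (by simp [e]))).impE (.hyp (by simp [e]))).impE (.hyp (by simp [e]))
  have h₃ := ((h₂.all_sub (.var (.there (.there .here)))).all_sub (.var (.there .here))).all_sub
    (.var .here)
  refine cast (congrArg (Deriv T _) ?_) h₃
  refine Eq.symm <| (Tm.sub_var φ).symm.trans (congrArg φ.sub ?_)
  funext _ x
  match x with
  | .here | .there .here | .there (.there .here) | .there (.there (.there .here))
  | .there (.there (.there (.there .here)))
  | .there (.there (.there (.there (.there .here)))) => rfl

end Instantiation

end IHOL

theorem mainTheorem2 {S : Type u} (τ : IHOL.Ty S) :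
    IHOL.Provable IHOL.SyntheticComputability
      (IHOL.All τ.pow fun X => IHOL.All τ.pow.pow fun O => IHOL.All (IHOL.Ty.nat ⇒ₜ τ.pow) fun B =>
        IHOL.isTopology X.wk.wk ↑O ⇒ IHOL.isBase O.wk B ⇒ IHOL.isSober X.wk.wk ↑O ⇒
          IHOL.isSpreen X.wk.wk ↑O) := by
  -- The innermost variable is the point to be separated; it is the term of type `τ` that interprets
  -- the parameters of the model.
  exact IHOL.Deriv.all_imp_all fun Φ =>
    IHOL.Elt.deriv_of_tr_const_eq_top IHOL.Elt.tr_isSpreen_of_isSober (.var .here) Φ
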